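/- **Conventions.** Fix $k\ge 2$. The arcs of a set partition of $[N]=\{1,\dots,N\}$ are the pairs $(i,j)$, $i<j$, of consecutive elements of a block. The partition is $k$-noncrossing if it has no $k$ arcs with $i_1<\dots<i_k<j_1<\dots<j_k$, and 2-regular if it has no arc $(i,i+1)$. Let $\mathcal P_{k,2}(N)$ be the set of 2-regular $k$-noncrossing partitions of $[N]$. A loop-free $k$-noncrossing braid over $[n]$ is a set of arcs $(i,j)$ with $1\le i<j\le n$, in which every vertex is the left end of at most one arc and the right end of at most one arc, without $k$ arcs such that $i_1<\dots<i_k\le j_1<\dots<j_k$. A shape is an integer partition $\lambda$ with at most $k-1$ rows. A loop-free braid walk of length $2m$ is a sequence of shapes $X^0,\dots,X^{2m}$ in which each pair of steps $X^{2s}\to X^{2s+1}\to X^{2s+2}$ is one of $(-\square_j,\varnothing)$, $(\varnothing,+\square_j)$, $(\varnothing,\varnothing)$, $(+\square_j,-\square_t)$ with $(j,t)\ne(1,1)$, where $\pm\square_j$ adds or removes a square in row $j$ and $\varnothing$ does nothing. Let $\omega_n(\lambda)$ be the number of sequences of shapes of length $n$ from $\varnothing$ to $\lambda$ that remove a square or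 do nothing at each odd step and add a square or do nothing at each even step, and put $$W(\lambda,m)=\sum_{h=0}^{m}(-1)^h\binom mh\,\omega_{2(m-h)+1}(\lambda),$$ with $W(\lambda,m)=0$ if $\lambda$ is not a shape. For $\mu$ obtained from $\lambda$ by a step $\alpha$, put $V(\lambda,\mu,m)=0$ if $\mu$ is not a shape, and otherwise $$V(\lambda,\mu,m)=\begin{cases}W(\mu,m)+\sum_{t=1}^{k-1} W(\mu+\square_t,m)&\alpha=\varnothing,\\ W(\mu,m)&\alpha=-\square_j,\\ \sum_{t:\,(j,t)\neq(1,1)}W(\mu-\square_t,m)&\alpha=+\square_j;\end{cases}$$ put $V(\lambda,\mu,m)=0$ if $\mu$ does not arise from $\lambda$ by such a step. The machine is a unit-cost random access machine. Its programs consist of finitely many instructions on finitely many registers and arrays of natural numbers: constants, addition, truncated subtraction, multiplication, division with remainder, position of the leading binary digit, indirect array access, conditional, loop, and drawing a uniformly distributed independent random element of $\{0,\dots,n-1\}$ for a given $n\ge1$. Each instruction costs one unit of time; space is the length of the arrays. **Theorem.** Let $k\ge2$. 1. For all $m\ge 0$ and all $\lambda$, $W(\lambda,m)$ is the number of loop-free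 braid walks of length $2m$ from $\varnothing$ to $\lambda$, and also the number of those from $\lambda$ to $\varnothing$. 2. For every $N\ge1$, replacing each arc $(i,j)$ by $(i,j-1)$ is a bijection from $\mathcal P_{k,2}(N)$ onto the set of loop-free $k$-noncrossing braids over $[N-1]$. The following map is a bijection from the set of loop-free braid walks of length $2(N-1)$ from $\varnothing$ to $\varnothing$ onto the same set of braids: start with the empty Young tableau and follow the walk, where the steps $2v-1$ and $2v$ belong to the vertex $v$; an added square receives the entry $v$; when the last square of a row is removed, its entry is taken out by reverse row insertion (it replaces in the row above the largest smaller entry, which moves on in the same way), and if the entry $y$ leaves the tableau from the first row, then $(y,v)$ is an arc. 3. There are two programs (preprocessing and sampler) and a constant $C$, depending only on $k$, such that the following holds for every $N\ge1$, with all numbers in registers and arrays below $2^{CN}$. On input $N$, the preprocessing halts within $CN^{k+1}$ steps, with arrays of length $CN^k$, in a deterministic final state; one of its arrays then contains $W(\lambda,m)$ for all $0\le m<N$ and all $\lambda\in\{0,\dots,N-1\}^{k-1}$. On input $N$, with the final arrays of the preprocessing as a read-only table and with its own memory initially zero, the sampler always halts within $CN$ steps, with arrays of length $CN$. It outputs a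 loop-free braid walk $X^0,\dots,X^{2(N-1)}$ from $\varnothing$ to $\varnothing$ and the partition in $\mathcal P_{k,2}(N)$ that corresponds to this walk under the bijections of 2. Every element of $\mathcal P_{k,2}(N)$ is output with probability $1/|\mathcal P_{k,2}(N)|$. The walk is a Markov process (in the shape and, after odd steps, the last step): for $0\le s<N-1$, given $X^0,\dots,X^{2s}$ with $X^{2s}=\lambda$, the probability of $X^{2s+1}=\mu$ is $V(\lambda,\mu,N-2-s)/W(\lambda,N-1-s)$; and given $X^0,\dots,X^{2s+1}$ with $X^{2s}=\lambda$, $X^{2s+1}=\mu$, the probability of $X^{2s+2}=\nu$ is $W(\nu,N-2-s)/V(\lambda,\mu,N-2-s)$ for every $\nu$ for which $\lambda\to\mu\to\nu$ is an allowed pair of steps. -/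

import Mathlib

noncomputable section

/-! ## Set partitions, crossings, braids -/

/-- `(i, j)` is an arc of the standard representation of the set partition `P` of
`[N] = {1, …, N}`: `i < j` are consecutive elements of one block. -/
def IsArc {N : ℕ} (P : Finpartition (Finset.Icc 1 N)) (i j : ℕ) : Prop :=
  ∃ B ∈ P.parts, i ∈ B ∧ j ∈ B ∧ i < j ∧ ∀ m ∈ B, ¬ (i < m ∧ m < j)

/-- No `k` arcs `(i₁, j₁), …, (i_k, j_k)` with `i₁ < ⋯ < i_k < j₁ < ⋯ < j_k`. -/
def IsNoncrossing {N : ℕ} (k : ℕ) (P : Finpartition (Finset.Icc 1 N)) : Prop :=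
  ¬ ∃ a b : Fin k → ℕ, StrictMono a ∧ StrictMono b ∧ (∀ r s, a r < b s) ∧
    ∀ r, IsArc P (a r) (b r)

/-- Distinct elements of one block have distance at least `m`. -/
def IsSetRegular {N : ℕ} (m : ℕ) (P : Finpartition (Finset.Icc 1 N)) : Prop :=
  ∀ B ∈ P.parts, ∀ x ∈ B, ∀ y ∈ B, x < y → x + m ≤ y

/-- The set of `m`-regular, `k`-noncrossing partitions of `[N]`. -/
def regularNoncrossing (k m N : ℕ) : Set (Finpartition (Finset.Icc 1 N)) :=
  {P | IsNoncrossing k P ∧ IsSetRegular m P}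

/-- Braids over `[n]`, given by their arcs `(i, j)` with `1 ≤ i ≤ j ≤ n` (a loop if `i = j`):
every vertex is the left end of at most one arc and the right end of at most one arc. -/
def IsBraid (n : ℕ) (A : Set (ℕ × ℕ)) : Prop :=
  (∀ a ∈ A, 1 ≤ a.1 ∧ a.1 ≤ a.2 ∧ a.2 ≤ n) ∧
  (∀ a ∈ A, ∀ b ∈ A, a.1 = b.1 → a = b) ∧ (∀ a ∈ A, ∀ b ∈ A, a.2 = b.2 → a = b)

/-- The set of loop-free `k`-noncrossing braids over `[n]`. In a braid the arcs `(i, j)` and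
`(j, l)` cross, so a `k`-crossing is `i₁ < ⋯ < i_k ≤ j₁ < ⋯ < j_k`. -/
def loopFreeBraids (k n : ℕ) : Set (Set (ℕ × ℕ)) :=
  {A | IsBraid n A ∧ (∀ i, (i, i) ∉ A) ∧
    ¬ ∃ a b : Fin k → ℕ, StrictMono a ∧ StrictMono b ∧ (∀ r s, a r ≤ b s) ∧
      ∀ r, (a r, b r) ∈ A}

/-- The braid over `[N - 1]` of a partition of `[N]`: the arc `(i, j)` becomes `(i, j - 1)`. -/
def partitionToBraid {N : ℕ} (P : Finpartition (Finset.Icc 1 N)) : Set (ℕ × ℕ) :=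
  {a | IsArc P a.1 (a.2 + 1)}

/-! ## Shapes and walks

A shape with at most `k - 1` rows is a weakly decreasing `lam : Fin (k - 1) → ℕ`
(`lam r` squares in row `r + 1`). Adding `(k - 2, k - 3, …, 0)` turns shapes into the lattice
points `ν₁ > ν₂ > ⋯ > ν_{k-1} ≥ 0`. A sequence of shapes of length `n`, with members
`X 0, …, X n`, is a function on `ℕ` that is constant from `n` on. -/

/-- Candidates for shapes with at most `k - 1` rows (they are shapes if `Antitone`). -/
abbrev Rows (k : ℕ) : Type := Fin (k - 1) → ℕ

/-- One square in row `j`; so `mu = lam + box j` says that `mu` is `lam` with a square added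
to row `j`, and `lam = mu + box j` that `mu` is `lam` with a square removed from row `j`. -/
def box {k : ℕ} (j : Fin (k - 1)) : Rows k := Pi.single j 1

/-- Walks of length `n` from the empty shape to `lam` that remove a square or do nothing at odd
steps, and add a square or do nothing at even steps (the walks of partitions). -/
def partitionWalks (k n : ℕ) (lam : Rows k) : Set (ℕ → Rows k) :=
  {X | X 0 = 0 ∧ X n = lam ∧ (∀ i, Antitone (X i)) ∧ (∀ i, n ≤ i → X i = X n) ∧
    ∀ i < n,
      (Even i → X (i + 1) = X i ∨ ∃ j, X i = X (i + 1) + box j) ∧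
      (Odd i → X (i + 1) = X i ∨ ∃ j, X (i + 1) = X i + box j)}

/-- `lam → mu → nu` is one of the elementary moves `(-□, ∅)`, `(∅, +□)`, `(∅, ∅)`,
`(+□_j, -□_t)` of braids, other than the move `(+□₁, -□₁)` of a loop. -/
def LoopFreeMove {k : ℕ} (lam mu nu : Rows k) : Prop :=
  (∃ j, lam = mu + box j ∧ nu = mu) ∨
  (mu = lam ∧ ∃ j, nu = mu + box j) ∨
  (mu = lam ∧ nu = mu) ∨
  (∃ j t, mu = lam + box j ∧ mu = nu + box t ∧ ¬ ((j : ℕ) = 0 ∧ (t : ℕ) = 0))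

/-- Loop-free braid walks of length `2 * m` from `lam` to `nu`. -/
def loopFreeWalks (k m : ℕ) (lam nu : Rows k) : Set (ℕ → Rows k) :=
  {X | X 0 = lam ∧ X (2 * m) = nu ∧ (∀ i, Antitone (X i)) ∧
    (∀ i, 2 * m ≤ i → X i = X (2 * m)) ∧
    ∀ s < m, LoopFreeMove (X (2 * s)) (X (2 * s + 1)) (X (2 * s + 2))}

/-- The inclusion-exclusion formula `∑ₕ (-1)ʰ (m choose h) ω(2 (m - h) + 1, lam)`, where
`ω(n, lam)` counts the partition walks of length `n` from the empty shape to `lam`. -/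
def walkCount (k m : ℕ) (lam : Rows k) : ℤ :=
  ∑ h ∈ Finset.range (m + 1),
    (-1) ^ h * (m.choose h : ℤ) * ((partitionWalks k (2 * (m - h) + 1) lam).ncard : ℤ)

open Classical in
/-- The count attached to the intermediate shape `mu`, reached from `lam` by the first half of an
elementary move, when `2 * m + 1` steps remain; it depends on whether that half move did nothing,
removed a square, or added a square in row `j`. -/
def halfWalkCount (k m : ℕ) (lam mu : Rows k) : ℤ :=
  if ¬ Antitone mu then 0
  else if mu = lam then walkCount k m mu + ∑ t, walkCount k m (mu + box t)
  else if ∃ j, lam = mu + box j then walkCount k m mu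
  else ∑ j, if mu = lam + box j then
      ∑ t, if 1 ≤ mu t ∧ ¬ ((j : ℕ) = 0 ∧ (t : ℕ) = 0) then walkCount k m (mu - box t) else 0
    else 0

/-! ## From walks to braids

The correspondence between walks and braids through Young tableaux. A tableau is given by its
rows, `T 1, T 2, …`; as rows are increasing, a row is the set of its entries. -/

/-- Reverse row insertion: the entry `x` enters row `r` and replaces there the largest entry
smaller than `x`, which then enters row `r - 1`, and so on; the second component of the value is
the entry that leaves the tableau from row `1`. -/
def bump : (r : ℕ) → (ℕ → Finset ℕ) → ℕ → (ℕ → Finset ℕ) × ℕ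
  | 0, T, x => (T, x)
  | r + 1, T, x =>
    let y := ((T (r + 1)).filter (fun z => z < x)).sup id
    bump r (Function.update T (r + 1) (insert x ((T (r + 1)).erase y))) y

/-- The number (from `1` on) of the row in which `mu` has fewer squares than `lam`;
`0` if there is none. -/
def shrinkingRow {k : ℕ} (lam mu : Rows k) : ℕ :=
  Finset.univ.sup fun r : Fin (k - 1) => if mu r < lam r then (r : ℕ) + 1 else 0

/-- One step `lam → mu` at the vertex `v`: a new square receives the entry `v`; if the last square
of row `r` is removed, its entry is taken out by reverse row insertion, and the entry `y` that
leaves the tableau is reported: it gives the arc `(y, v)`. -/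
def tableauStep {k : ℕ} (v : ℕ) (lam mu : Rows k) (T : ℕ → Finset ℕ) :
    (ℕ → Finset ℕ) × Option ℕ :=
  match shrinkingRow lam mu with
  | 0 => (fun i => if 0 < i ∧ i = shrinkingRow mu lam then insert v (T i) else T i, none)
  | r + 1 =>
    let x := (T (r + 1)).sup id
    let p := bump r (Function.update T (r + 1) ((T (r + 1)).erase x)) x
    (p.1, some p.2)

/-- The tableau after the first `i` steps of `X`; steps `2 v - 1` and `2 v` belong to vertex `v`. -/
def tableauAt {k : ℕ} (X : ℕ → Rows k) : ℕ → ℕ → Finset ℕ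
  | 0 => fun _ => ∅
  | i + 1 => (tableauStep (i / 2 + 1) (X i) (X (i + 1)) (tableauAt X i)).1

/-- The arcs of the braid over `[m]` of a braid walk `X` of length `2 * m`. -/
def walkToBraid {k : ℕ} (m : ℕ) (X : ℕ → Rows k) : Set (ℕ × ℕ) :=
  {a | ∃ i < 2 * m, a.2 = i / 2 + 1 ∧
    (tableauStep (i / 2 + 1) (X i) (X (i + 1)) (tableauAt X i)).2 = some a.1}

/-! ## A random access machine with unit costs -/

/-- Arithmetic instructions on natural numbers: truncated subtraction, quotient and remainder of
the division with remainder, and the position of the leading binary digit of the first operand. -/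
inductive ArithOp : Type
  | plus | minus | times | quot | rest | lead

/-- The value of an arithmetic instruction. -/
def ArithOp.eval : ArithOp → ℕ → ℕ → ℕ
  | .plus, a, b => a + b
  | .minus, a, b => a - b
  | .times, a, b => a * b
  | .quot, a, b => a / b
  | .rest, a, b => a % b
  | .lead, a, _ => Nat.log 2 a

/-- Programs. Registers and arrays are named by natural numbers; a program mentions only finitely
many. -/
inductive Program : Type
  /-- do nothing -/
  | skip
  /-- register `x` gets the constant `c` -/
  | const (x c : ℕ)
  /-- register `x` gets the result of `o` on registers `y`, `z` -/
  | arith (o : ArithOp) (x y z : ℕ)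
  /-- register `x` gets the entry of the array `a` whose index is in register `y` -/
  | load (x a y : ℕ)
  /-- the same for the array `a` of the read-only table -/
  | fetch (x a y : ℕ)
  /-- the entry of the array `a` whose index is in register `y` becomes register `x` -/
  | store (a y x : ℕ)
  /-- register `x` gets a uniformly distributed random element of `{0, …, n - 1}`, independent of
  everything before, where `n` is in register `y` -/
  | random (x y : ℕ)
  /-- first `p`, then `q` -/
  | seq (p q : Program)
  /-- `p` if register `x` is not `0`, else `q` -/
  | cond (x : ℕ) (p q : Program)
  /-- repeat `p` as long as register `x` is not `0` -/
  | loop (x : ℕ) (p : Program)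

/-- Contents of the registers and of the arrays. -/
structure Memory : Type where
  /-- content of a register -/
  reg : ℕ → ℕ
  /-- content of an array at an index -/
  arr : ℕ → ℕ → ℕ

/-- The programs that remain to be executed, in this order, and the memory. -/
abbrev Config : Type := List Program × Memory

/-- Write `v` to register `x` and go on with `rest`; abort (`none`) if `v` has more than `w`
binary digits. -/
def writeReg (w : ℕ) (rest : List Program) (M : Memory) (x v : ℕ) : Option Config :=
  if v < 2 ^ w then some (rest, { M with reg := Function.update M.reg x v }) else none

/-- One step, of cost `1`, of a machine with arrays of length `S`, registers and array entries of
`w` binary digits, and the read-only table `tab`. The machine aborts (`none`) if it leaves these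
limits, or if it is to draw from the empty set. -/
def stepProgram (S w : ℕ) (tab : ℕ → ℕ → ℕ) (p : Program) (rest : List Program) (M : Memory) :
    PMF (Option Config) :=
  match p with
  | .skip => PMF.pure (some (rest, M))
  | .const x c => PMF.pure (writeReg w rest M x c)
  | .arith o x y z => PMF.pure (writeReg w rest M x (o.eval (M.reg y) (M.reg z)))
  | .load x a y =>
    PMF.pure (if M.reg y < S then writeReg w rest M x (M.arr a (M.reg y)) else none)
  | .fetch x a y => PMF.pure (writeReg w rest M x (tab a (M.reg y)))
  | .store a y x =>
    PMF.pure (if M.reg y < S then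
      some (rest, { M with
        arr := Function.update M.arr a (Function.update (M.arr a) (M.reg y) (M.reg x)) })
      else none)
  | .random x y =>
    match M.reg y with
    | 0 => PMF.pure none
    | n + 1 => (PMF.uniformOfFintype (Fin (n + 1))).map fun v => writeReg w rest M x (v : ℕ)
  | .seq p q => PMF.pure (some (p :: q :: rest, M))
  | .cond x p q => PMF.pure (some ((if M.reg x ≠ 0 then p else q) :: rest, M))
  | .loop x p => PMF.pure (some (if M.reg x ≠ 0 then p :: .loop x p :: rest else rest, M))

/-- One step of the machine; a machine that has halted or aborted stays as it is. -/
def stepConfig (S w : ℕ) (tab : ℕ → ℕ → ℕ) : Option Config → PMF (Option Config)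
  | none => PMF.pure none
  | some ([], M) => PMF.pure (some ([], M))
  | some (p :: rest, M) => stepProgram S w tab p rest M

/-- The distribution of the configuration after a number of steps. -/
def runSteps (S w : ℕ) (tab : ℕ → ℕ → ℕ) : ℕ → Option Config → PMF (Option Config)
  | 0, c => PMF.pure c
  | t + 1, c => (stepConfig S w tab c).bind (runSteps S w tab t)

/-- The final memory of a machine that has halted, `none` for any other. -/
def haltedMemory : Option Config → Option Memory
  | some ([], M) => some M
  | _ => none

/-- The machine at the start: the input `N` is in register `0`; all the rest is `0`. -/
def inputMemory (N : ℕ) : Memory where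
  reg := fun x => if x = 0 then N else 0
  arr := fun _ _ => 0

/-- The distribution of the final memory of the program `p` on the input `N` with time `t`, arrays
of length `S`, word length `w`, and read-only table `tab`; the value `none` stands for the event
that the machine aborts or has not halted after `t` steps. -/
def execute (t S w : ℕ) (tab : ℕ → ℕ → ℕ) (p : Program) (N : ℕ) : PMF (Option Memory) :=
  (runSteps S w tab t (some ([p], inputMemory N))).map haltedMemory

/-- The probability that a run halts in time and within the limits, with a final memory that
has the property `E`. -/
def prob (p : PMF (Option Memory)) (E : Memory → Prop) : ℝ :=
  (p.toOuterMeasure {r | ∃ M, r = some M ∧ E M}).toReal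

/-- The output convention for partitions `P` of `[N]`: for `1 ≤ i ≤ N`, entry `i` of array `0` is
the successor of `i` in its block, and `0` if `i` is the largest element of its block. -/
def OutputsPartition {N : ℕ} (M : Memory) (P : Finpartition (Finset.Icc 1 N)) : Prop :=
  ∀ i ∈ Finset.Icc 1 N, ∀ j, 0 < j → (M.arr 0 i = j ↔ IsArc P i j)

/-- The output convention for sequences of shapes of length `n`: array `1` contains the rows of
the members, one after the other. -/
def outputWalk (k n : ℕ) (M : Memory) : ℕ → Rows k :=
  fun i r => M.arr 1 ((k - 1) * min i n + r)

end

/-! Counting. A braid move and a pair of steps of a walk of partitions are described by the same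
data, a code: a row that gains a square, or none, and a row that loses one, or none. Only the shape
in the middle differs, and it does no harm to the counting, since the middle and the end determine
the code (`mid_target_inj`, `peak_target_inj`). A walk of partitions of length 2m+1, read backwards,
is a sequence of m arbitrary codes and an idle step; a loop-free braid walk is a sequence of codes
other than (1,1). As row 1 can always grow and shrink again, the sum over all codes is A = T + J,
where T is the sum over the loop-free codes and J is the restriction to shapes, which commutes with
A. The binomial expansion of (A - J)^m is the formula for W (`walkCount_eq`).

Bijections. Lowering all right ends by one turns i_r < j_s into i_r ≤ j_s and arcs (i, i+1) into
loops. For walks, the tableau algorithm is read from the last vertex to the first. Reverse row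
insertion is undone by row insertion, so at the vertex v the left end of the arc ending at v is
inserted, and then v, the largest possible entry, is deleted if it is present. Hence the braid
determines all tableaux (`tableauAt_eq_backTab`), and they determine the walk. The tableau at v
belongs to the word that lists the left ends of the arcs over v by decreasing right ends. By
Schensted's theorem (`IsTabOf.row_nonempty_iff`) its number of rows is the length of the longest
decreasing subsequence, which is the size of the largest crossing over v. So fewer than k rows at
all times means k-noncrossing. The move (1,1) is the one at which v itself would leave, that is, a
loop.

Algorithm. The recursion over the first move fills a table of all W(λ, m), addressed in base N. The
sampler draws one number below W(∅, N-1) and unranks it: at every vertex it subtracts the numbers of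
walks that belong to the possible moves until the rank falls into an interval. Since unranking is a
bijection (`decode_bijOn`), the walk is uniform; the probability of a beginning is a quotient of
numbers of walks, and the number of continuations depends on the current shape only
(`ncard_walksAlong_sep`), which gives the transition probabilities. The running time is linear
because a row of the tableau is kept as one number whose binary digits mark the entries: the largest
entry below x is the leading digit of the remainder modulo 2^x, so reverse insertion through at most
k-1 rows takes a bounded number of steps. -/

noncomputable section

/-! ## Elementary moves and their codes -/

/-- A code `(a, b)` stands for "add a square in row `a`, remove a square from row `b`". -/
abbrev Code (k : ℕ) : Type := Option (Fin (k - 1)) × Option (Fin (k - 1))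

/-- At most one square. -/
def obox {k : ℕ} : Option (Fin (k - 1)) → Rows k
  | none => 0
  | some j => box j

/-- The code of a loop. -/
def IsLoopCode {k : ℕ} (c : Code k) : Prop :=
  ∃ j t : Fin (k - 1), c = (some j, some t) ∧ (j : ℕ) = 0 ∧ (t : ℕ) = 0

/-- The shape reached from `lam` by the code `c`. -/
def target {k : ℕ} (lam : Rows k) (c : Code k) : Rows k := lam + obox c.1 - obox c.2

/-- The code `c` leads from the shape `lam` through shapes. -/
def Allowed {k : ℕ} (lam : Rows k) (c : Code k) : Prop :=
  Antitone lam ∧ Antitone (lam + obox c.1) ∧ Antitone (target lam c) ∧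
    target lam c + obox c.2 = lam + obox c.1

/-- The shape in the middle of a braid move. -/
def mid {k : ℕ} (lam : Rows k) : Code k → Rows k
  | (some a, some _) => lam + box a
  | (some _, none) => lam
  | (none, some b) => lam - box b
  | (none, none) => lam

/-- The shape in the middle of a pair of steps of a walk of partitions. -/
def peak {k : ℕ} (lam : Rows k) (c : Code k) : Rows k := lam + obox c.1

/-- All codes. -/
def allCodes (k : ℕ) : List (Code k) := (Finset.univ : Finset (Code k)).toList

open Classical in
/-- The codes of the loop-free moves. -/
def moveCodes (k : ℕ) : List (Code k) :=
  ((Finset.univ : Finset (Code k)).filter fun c => ¬ IsLoopCode c).toList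

theorem nodup_allCodes (k : ℕ) : (allCodes k).Nodup := Finset.nodup_toList _

theorem mem_allCodes {k : ℕ} (c : Code k) : c ∈ allCodes k := by simp [allCodes]

theorem nodup_moveCodes (k : ℕ) : (moveCodes k).Nodup := Finset.nodup_toList _

theorem mem_moveCodes {k : ℕ} {c : Code k} : c ∈ moveCodes k ↔ ¬ IsLoopCode c := by
  simp [moveCodes]

theorem box_apply {k : ℕ} (j r : Fin (k - 1)) : (box j : Rows k) r = if r = j then 1 else 0 := by
  simp [box, Pi.single_apply]

theorem box_inj {k : ℕ} {j t : Fin (k - 1)} : (box j : Rows k) = box t ↔ j = t := by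
  constructor
  · intro h
    by_contra hne
    have := congrFun h j
    simp [box_apply, hne] at this
  · rintro rfl; rfl

theorem box_ne_zero {k : ℕ} (j : Fin (k - 1)) : (box j : Rows k) ≠ 0 := by
  intro h
  have := congrFun h j
  simp [box_apply] at this

theorem obox_inj {k : ℕ} {a b : Option (Fin (k - 1))} (h : (obox a : Rows k) = obox b) :
    a = b := by
  cases a <;> cases b <;> simp_all [obox, box_ne_zero, box_inj, eq_comm]

theorem add_box_ne {k : ℕ} (lam : Rows k) (j : Fin (k - 1)) : lam + box j ≠ lam := by
  intro h
  exact box_ne_zero j (add_eq_left.mp h)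

theorem target_eq_of_add_eq {k : ℕ} {lam nu : Rows k} {c : Code k}
    (h : lam + obox c.1 = nu + obox c.2) : target lam c = nu := by
  rw [target, h, add_tsub_cancel_right]

theorem add_add_box_ne {k : ℕ} (lam : Rows k) (i j : Fin (k - 1)) :
    lam + box i + box j ≠ lam := by
  intro h
  have := congrFun h i
  simp only [Pi.add_apply, box_apply, if_true] at this
  omega

/-- If the middle differs from `lam`, it shows whether the first step added or removed a square, and
in which row. If it equals `lam`, the first step was idle and the target shows the second one. -/
theorem mid_target_inj {k : ℕ} {lam : Rows k} {c d : Code k} (hc : Allowed lam c)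
    (hd : Allowed lam d) (h1 : mid lam c = mid lam d) (h2 : target lam c = target lam d) :
    c = d := by
  obtain ⟨-, -, -, hc⟩ := hc
  obtain ⟨-, -, -, hd⟩ := hd
  rw [← h2] at hd
  generalize ht : target lam c = nu at *
  obtain ⟨a, b⟩ := c
  obtain ⟨a', b'⟩ := d
  have key : ∀ b : Fin (k - 1), nu + box b = lam → lam - box b = nu := by
    intro b hb; rw [← hb, add_tsub_cancel_right]
  rcases a with _ | a <;> rcases b with _ | b <;> rcases a' with _ | a' <;> rcases b' with _ | b' <;>
    simp only [obox, mid, add_zero] at hc hd h1 ⊢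
  -- Incompatible patterns of codes would make a shape equal to itself plus one or two squares;
  -- otherwise a common summand cancels and `box_inj` identifies the rows.
  all_goals first
    | rfl
    | (exfalso; exact add_box_ne _ _ h1)
    | (exfalso; exact add_box_ne _ _ h1.symm)
    | (exfalso; subst hc; exact add_box_ne _ _ hd)
    | (exfalso; subst hd; exact add_box_ne _ _ hc)
    | (exfalso; subst hc; exact add_add_box_ne _ _ _ hd)
    | (exfalso; subst hc; exact add_add_box_ne _ _ _ hd.symm)
    | (rw [box_inj.mp (add_left_cancel (hc.trans hd.symm))])
    | (rw [box_inj.mp (add_left_cancel (hc.symm.trans hd))])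
    | (have e := box_inj.mp (add_left_cancel h1)
       subst e
       rw [box_inj.mp (add_left_cancel (hc.trans hd.symm))])
    | (exfalso
       rw [key _ hc] at h1
       subst hc
       first
        | exact add_box_ne _ _ h1.symm
        | exact add_add_box_ne _ _ _ h1.symm)
    | (exfalso
       rw [key _ hd] at h1
       subst hd
       first
        | exact add_box_ne _ _ h1.symm
        | exact add_box_ne _ _ h1
        | exact add_add_box_ne _ _ _ h1.symm
        | exact add_add_box_ne _ _ _ h1)

theorem peak_target_inj {k : ℕ} {lam : Rows k} {c d : Code k} (hc : Allowed lam c)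
    (hd : Allowed lam d) (h1 : peak lam c = peak lam d) (h2 : target lam c = target lam d) :
    c = d := by
  obtain ⟨-, -, -, hc⟩ := hc
  obtain ⟨-, -, -, hd⟩ := hd
  have e1 := obox_inj (add_left_cancel h1)
  rw [← h2, ← e1, ← hc] at hd
  exact Prod.ext e1 (obox_inj (add_left_cancel hd)).symm

theorem antitone_mid {k : ℕ} {lam : Rows k} {c : Code k} (hc : Allowed lam c) :
    Antitone (mid lam c) := by
  obtain ⟨h1, h2, h3, -⟩ := hc
  rcases c with ⟨_ | a, _ | b⟩ <;> simp_all [mid, obox, target]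

/-- The four kinds of moves are the four patterns of codes. The last clause of `Allowed` says that
the truncated subtraction in `target` really removes a square. -/
theorem loopFreeMove_iff {k : ℕ} {lam mu nu : Rows k} (h1 : Antitone lam) (h2 : Antitone mu)
    (h3 : Antitone nu) :
    LoopFreeMove lam mu nu ↔
      ∃ c ∈ moveCodes k, Allowed lam c ∧ mu = mid lam c ∧ nu = target lam c := by
  constructor
  · rintro (⟨j, rfl, rfl⟩ | ⟨rfl, j, rfl⟩ | ⟨rfl, rfl⟩ | ⟨j, t, rfl, h, hl⟩)
    · refine ⟨(none, some j), ?_, ?_⟩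
      · rw [mem_moveCodes]; rintro ⟨_, _, h, -⟩; simp at h
      · have e : target (nu + box j) (none, some j) = nu := by simp [target, obox]
        refine ⟨⟨h1, by simpa [obox] using h1, by rwa [e], by rw [e]; simp [obox]⟩, ?_, e.symm⟩
        simp [mid]
    · refine ⟨(some j, none), ?_, ?_⟩
      · rw [mem_moveCodes]; rintro ⟨_, _, h, -⟩; simp at h
      · have e : target mu (some j, none) = mu + box j := by simp [target, obox]
        exact ⟨⟨h1, h3, by rwa [e], by rw [e]; simp [obox]⟩, rfl, e.symm⟩
    · refine ⟨(none, none), ?_, ?_⟩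
      · rw [mem_moveCodes]; rintro ⟨_, _, h, -⟩; simp at h
      · have e : target nu (none, none) = nu := by simp [target, obox]
        exact ⟨⟨h1, by simpa [obox] using h1, by rwa [e], by rw [e]⟩, rfl, e.symm⟩
    · refine ⟨(some j, some t), ?_, ?_⟩
      · rw [mem_moveCodes]; rintro ⟨j', t', h, hh⟩
        simp only [Prod.mk.injEq, Option.some.injEq] at h
        obtain ⟨rfl, rfl⟩ := h
        exact hl hh
      · have e : target lam (some j, some t) = nu := target_eq_of_add_eq h
        exact ⟨⟨h1, h2, by rwa [e], by rw [e]; exact h.symm⟩, rfl, e.symm⟩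
  · rintro ⟨⟨a, b⟩, hm, ⟨-, -, -, h⟩, rfl, rfl⟩
    rw [mem_moveCodes] at hm
    rcases a with _ | a <;> rcases b with _ | b
    · right; right; left
      simp [mid, target, obox]
    · left
      refine ⟨b, ?_, ?_⟩
      · simpa [obox, mid, target] using h.symm
      · simp [mid, target, obox]
    · right; left
      exact ⟨rfl, a, by simp [mid, target, obox]⟩
    · right; right; right
      refine ⟨a, b, rfl, h.symm, fun hh => hm ⟨a, b, rfl, hh⟩⟩

/-! ## Choosing from a weighted list -/

/-- The item of a weighted list at a rank, and the rank inside of this item. -/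
def pick {α : Type*} (f : α → ℕ) (d : α) : List α → ℕ → α × ℕ
  | [], u => (d, u)
  | c :: cs, u => if u < f c then (c, u) else pick f d cs (u - f c)

/-- The ranks form consecutive intervals of lengths `f c`, one for each item. As the items are
distinct, the interval can be recovered from the item. -/
theorem pick_bijOn {α : Type*} (f : α → ℕ) (d : α) (L : List α) (hL : L.Nodup) :
    Set.BijOn (pick f d L) (Set.Iio (L.map f).sum) {p | p.1 ∈ L ∧ p.2 < f p.1} := by
  induction L with
  | nil =>
    refine ⟨fun u hu => by simp at hu, fun u hu => by simp at hu, fun p hp => by simp at hp⟩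
  | cons c cs ih =>
    rw [List.nodup_cons] at hL
    obtain ⟨im, ii, is⟩ := ih hL.2
    refine ⟨fun u hu => ?_, fun u hu w hw h => ?_, fun p hp => ?_⟩
    · simp only [Set.mem_Iio, List.map_cons, List.sum_cons] at hu
      rw [pick]
      split_ifs with h
      · exact ⟨List.mem_cons_self, h⟩
      · obtain ⟨h1, h2⟩ := im (x := u - f c) (by simp only [Set.mem_Iio]; omega)
        exact ⟨List.mem_cons_of_mem _ h1, h2⟩
    · simp only [Set.mem_Iio, List.map_cons, List.sum_cons] at hu hw
      rw [pick, pick] at h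
      split_ifs at h with h1 h2 h2
      · exact (Prod.ext_iff.mp h).2
      · exfalso
        obtain ⟨h3, -⟩ := im (x := w - f c) (by simp only [Set.mem_Iio]; omega)
        rw [← h] at h3
        exact hL.1 h3
      · exfalso
        obtain ⟨h3, -⟩ := im (x := u - f c) (by simp only [Set.mem_Iio]; omega)
        rw [h] at h3
        exact hL.1 h3
      · have := ii (x₁ := u - f c) (by simp only [Set.mem_Iio]; omega) (x₂ := w - f c)
          (by simp only [Set.mem_Iio]; omega) h
        omega
    · obtain ⟨hp1, hp2⟩ := hp
      rcases List.mem_cons.mp hp1 with h | h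
      · refine ⟨p.2, ?_, ?_⟩
        · simp only [Set.mem_Iio, List.map_cons, List.sum_cons]; rw [← h]; omega
        · rw [pick, ← h, if_pos hp2]
      · obtain ⟨u, hu, e⟩ := is (a := p) ⟨h, hp2⟩
        refine ⟨u + f c, ?_, ?_⟩
        · simp only [Set.mem_Iio, List.map_cons, List.sum_cons] at hu ⊢; omega
        · rw [pick, if_neg (by omega), Nat.add_sub_cancel]; exact e

/-! ## Counting and ranking walks -/

open Classical in
/-- The number of walks of `m` moves with codes in `L` from `lam` to the empty shape. -/
def codeCount {k : ℕ} (L : List (Code k)) : ℕ → Rows k → ℕ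
  | 0, lam => if lam = 0 then 1 else 0
  | m + 1, lam =>
    (L.map fun c => if Allowed lam c then codeCount L m (target lam c) else 0).sum

open Classical in
/-- The number of walks of `m + 1` moves from `lam` to the empty shape with a given first code. -/
def codeWeight {k : ℕ} (L : List (Code k)) (m : ℕ) (lam : Rows k) (c : Code k) : ℕ :=
  if Allowed lam c then codeCount L m (target lam c) else 0

theorem codeCount_succ {k : ℕ} (L : List (Code k)) (m : ℕ) (lam : Rows k) :
    codeCount L (m + 1) lam = (L.map (codeWeight L m lam)).sum := rfl

/-- Two new members at the start of a sequence. -/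
def consPair {α : Type*} (x y : α) (X : ℕ → α) : ℕ → α
  | 0 => x
  | 1 => y
  | i + 2 => X i

/-- The walk of a given rank. -/
def decode {k : ℕ} (L : List (Code k)) (g : Rows k → Code k → Rows k) :
    ℕ → Rows k → ℕ → ℕ → Rows k
  | 0, lam, _ => fun _ => lam
  | m + 1, lam, u =>
    let p := pick (codeWeight L m lam) (none, none) L u
    consPair lam (g lam p.1) (decode L g m (target lam p.1) p.2)

/-- Walks of `m` moves with codes in `L` from `lam` to the empty shape; `g` is the shape in
the middle of a move. -/
def codeWalks {k : ℕ} (L : List (Code k)) (g : Rows k → Code k → Rows k) (m : ℕ)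
    (lam : Rows k) : Set (ℕ → Rows k) :=
  {X | X 0 = lam ∧ X (2 * m) = 0 ∧ (∀ i, Antitone (X i)) ∧ (∀ i, 2 * m ≤ i → X i = X (2 * m)) ∧
    ∀ s < m, ∃ c ∈ L, Allowed (X (2 * s)) c ∧ X (2 * s + 1) = g (X (2 * s)) c ∧
      X (2 * s + 2) = target (X (2 * s)) c}

theorem decode_zero {k : ℕ} (L : List (Code k)) (g : Rows k → Code k → Rows k) (m : ℕ)
    (lam : Rows k) (u : ℕ) : decode L g m lam u 0 = lam := by
  cases m <;> rfl

theorem consPair_mem_codeWalks {k : ℕ} {L : List (Code k)} {g : Rows k → Code k → Rows k}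
    (hg : ∀ lam c, Allowed lam c → Antitone (g lam c)) {m : ℕ} {lam : Rows k} {c : Code k}
    (hc : c ∈ L) (ha : Allowed lam c) {X : ℕ → Rows k} (hX : X ∈ codeWalks L g m (target lam c)) :
    consPair lam (g lam c) X ∈ codeWalks L g (m + 1) lam := by
  obtain ⟨h0, h1, h2, h3, h4⟩ := hX
  refine ⟨rfl, h1, fun i => ?_, fun i hi => ?_, fun s hs => ?_⟩
  · match i with
    | 0 => exact ha.1
    | 1 => exact hg _ _ ha
    | i + 2 => exact h2 i
  · obtain ⟨i, rfl⟩ : ∃ j, i = j + 2 := ⟨i - 2, by omega⟩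
    exact h3 i (by omega)
  · match s with
    | 0 => exact ⟨c, hc, ha, rfl, h0⟩
    | s + 1 => exact h4 s (by omega)

/-- By `pick_bijOn` a rank is a first code together with a rank among the walks that continue from
its target. The hypothesis `hi` makes it possible to read the code off the first two steps. -/
theorem decode_bijOn {k : ℕ} {L : List (Code k)} (hL : L.Nodup) {g : Rows k → Code k → Rows k}
    (hg : ∀ lam c, Allowed lam c → Antitone (g lam c))
    (hi : ∀ lam c d, Allowed lam c → Allowed lam d → g lam c = g lam d →
      target lam c = target lam d → c = d) (m : ℕ) (lam : Rows k) :
    Set.BijOn (decode L g m lam) (Set.Iio (codeCount L m lam)) (codeWalks L g m lam) := by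
  induction m generalizing lam with
  | zero =>
    refine ⟨fun u hu => ?_, fun u hu w hw _ => ?_, fun X hX => ?_⟩
    · simp only [Set.mem_Iio, codeCount] at hu
      split_ifs at hu with h
      · subst h
        exact ⟨rfl, rfl, fun _ => fun _ _ _ => le_rfl, fun _ _ => rfl, fun s hs => by omega⟩
      · omega
    · simp only [Set.mem_Iio, codeCount] at hu hw
      split_ifs at hu hw <;> omega
    · obtain ⟨h0, h1, h2, h3, h4⟩ := hX
      have e : lam = 0 := h0.symm.trans h1
      refine ⟨0, by simp [codeCount, e], ?_⟩
      funext i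
      have := h3 i (by omega)
      rw [this, h1, e]; rfl
  | succ m ih =>
    obtain ⟨pm, pi, ps⟩ := pick_bijOn (codeWeight L m lam) (none, none) L hL
    have key : ∀ u < codeCount L (m + 1) lam,
        let p := pick (codeWeight L m lam) (none, none) L u
        p.1 ∈ L ∧ Allowed lam p.1 ∧ p.2 < codeCount L m (target lam p.1) := by
      intro u hu p
      obtain ⟨h1, h2⟩ := pm (x := u) hu
      rw [codeWeight] at h2
      split_ifs at h2 with h
      · exact ⟨h1, h, h2⟩
      · omega
    refine ⟨fun u hu => ?_, fun u hu w hw h => ?_, fun X hX => ?_⟩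
    · obtain ⟨h1, h2, h3⟩ := key u hu
      exact consPair_mem_codeWalks hg h1 h2 ((ih _).mapsTo h3)
    · obtain ⟨u1, u2, u3⟩ := key u hu
      obtain ⟨w1, w2, w3⟩ := key w hw
      simp only [decode] at h
      have e1 := congrFun h 1
      have et : decode L g m _ _ = decode L g m _ _ := funext fun i => congrFun h (i + 2)
      have e2 := congrFun et 0
      rw [decode_zero, decode_zero] at e2
      have e3 := hi _ _ _ u2 w2 e1 e2
      apply pi hu hw
      refine Prod.ext e3 ?_
      rw [e3] at et u3
      exact (ih _).injOn u3 w3 et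
    · obtain ⟨h0, h1, h2, h3, h4⟩ := hX
      obtain ⟨c, hc, ha, e1, e2⟩ := h4 0 (by omega)
      simp only [mul_zero, zero_add] at e1 e2 ha
      rw [h0] at e1 e2 ha
      have ht : (fun i => X (i + 2)) ∈ codeWalks L g m (target lam c) := by
        refine ⟨e2, h1, fun i => h2 _, fun i hi => h3 _ (by omega), fun s hs => ?_⟩
        exact h4 (s + 1) (by omega)
      obtain ⟨u', hu', eu⟩ := (ih _).surjOn ht
      obtain ⟨u, hu, e⟩ := ps (a := (c, u')) ⟨hc, by
        simp only [codeWeight, if_pos ha]; exact hu'⟩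
      refine ⟨u, hu, ?_⟩
      funext i
      match i with
      | 0 => exact h0.symm
      | 1 => simp only [decode, e, consPair]; exact e1.symm
      | i + 2 => simp only [decode, e, consPair, eu]

theorem ncard_codeWalks {k : ℕ} {L : List (Code k)} (hL : L.Nodup)
    {g : Rows k → Code k → Rows k} (hg : ∀ lam c, Allowed lam c → Antitone (g lam c))
    (hi : ∀ lam c d, Allowed lam c → Allowed lam d → g lam c = g lam d →
      target lam c = target lam d → c = d) (m : ℕ) (lam : Rows k) :
    (codeWalks L g m lam).ncard = codeCount L m lam := by
  rw [← (decode_bijOn hL hg hi m lam).ncard_eq]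
  simp [Set.ncard_eq_toFinset_card']

theorem loopFreeWalks_eq (k m : ℕ) (lam : Rows k) :
    loopFreeWalks k m lam 0 = codeWalks (moveCodes k) mid m lam := by
  ext X
  constructor
  · rintro ⟨h0, h1, h2, h3, h4⟩
    exact ⟨h0, h1, h2, h3, fun s hs => (loopFreeMove_iff (h2 _) (h2 _) (h2 _)).mp (h4 s hs)⟩
  · rintro ⟨h0, h1, h2, h3, h4⟩
    exact ⟨h0, h1, h2, h3, fun s hs => (loopFreeMove_iff (h2 _) (h2 _) (h2 _)).mpr (h4 s hs)⟩

/-- The number of loop-free braid walks of `m` moves from `lam` to the empty shape. -/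
def moveCount {k : ℕ} (m : ℕ) (lam : Rows k) : ℕ := codeCount (moveCodes k) m lam

theorem decode_bijOn_loopFreeWalks (k m : ℕ) (lam : Rows k) :
    Set.BijOn (decode (moveCodes k) mid m lam) (Set.Iio (moveCount m lam))
      (loopFreeWalks k m lam 0) := by
  rw [loopFreeWalks_eq]
  exact decode_bijOn (nodup_moveCodes k) (fun _ _ => antitone_mid)
    (fun _ _ _ => mid_target_inj) m lam

theorem ncard_loopFreeWalks_zero (k m : ℕ) (lam : Rows k) :
    (loopFreeWalks k m lam 0).ncard = moveCount m lam := by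
  rw [loopFreeWalks_eq]
  exact ncard_codeWalks (nodup_moveCodes k) (fun _ _ => antitone_mid)
    (fun _ _ _ => mid_target_inj) m lam

/-! ## Reversal -/

theorem LoopFreeMove.symm {k : ℕ} {lam mu nu : Rows k} (h : LoopFreeMove lam mu nu) :
    LoopFreeMove nu mu lam := by
  rcases h with ⟨j, h1, h2⟩ | ⟨h1, j, h2⟩ | ⟨h1, h2⟩ | ⟨j, t, h1, h2, h3⟩
  · exact Or.inr (Or.inl ⟨h2.symm, j, h1⟩)
  · exact Or.inl ⟨j, h2, h1.symm⟩
  · exact Or.inr (Or.inr (Or.inl ⟨h2.symm, by rw [h1]⟩))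
  · exact Or.inr (Or.inr (Or.inr ⟨t, j, h2, h1, fun hh => h3 hh.symm⟩))

theorem reverse_mem_loopFreeWalks {k m : ℕ} {lam nu : Rows k} {X : ℕ → Rows k}
    (hX : X ∈ loopFreeWalks k m lam nu) : (fun i => X (2 * m - i)) ∈ loopFreeWalks k m nu lam := by
  obtain ⟨h0, h1, h2, h3, h4⟩ := hX
  refine ⟨by simpa using h1, by simpa using h0, fun i => h2 _, fun i hi => ?_, fun s hs => ?_⟩
  · simp only [Nat.sub_eq_zero_of_le hi, Nat.sub_self]
  · have := (h4 (m - 1 - s) (by omega)).symm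
    have e1 : 2 * m - 2 * s = 2 * (m - 1 - s) + 2 := by omega
    have e2 : 2 * m - (2 * s + 1) = 2 * (m - 1 - s) + 1 := by omega
    have e3 : 2 * m - (2 * s + 2) = 2 * (m - 1 - s) := by omega
    simp only [e1, e2, e3]
    exact this

theorem ncard_loopFreeWalks_comm (k m : ℕ) (lam nu : Rows k) :
    (loopFreeWalks k m lam nu).ncard = (loopFreeWalks k m nu lam).ncard := by
  have inv : ∀ {lam nu : Rows k} {X : ℕ → Rows k}, X ∈ loopFreeWalks k m lam nu →
      (fun i => (fun i => X (2 * m - i)) (2 * m - i)) = X := by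
    rintro lam nu X ⟨-, -, -, h3, -⟩
    funext i
    by_cases hi : i ≤ 2 * m
    · simp only [Nat.sub_sub_self hi]
    · have : 2 * m - (2 * m - i) = 2 * m := by omega
      simp only [this]
      exact (h3 i (by omega)).symm
  refine Set.ncard_congr (fun X _ i => X (2 * m - i)) (fun X hX => reverse_mem_loopFreeWalks hX)
    (fun X Y hX hY h => ?_) (fun Y hY => ⟨_, reverse_mem_loopFreeWalks hY, inv hY⟩)
  rw [← inv hX, ← inv hY]
  funext i
  exact congrFun h (2 * m - i)

/-- Nothing can be removed from the empty shape, so the first of the 2m+1 steps is idle. Read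
backwards, the others are m pairs of an optional addition and an optional removal, that is, m
arbitrary codes with `peak` in the middle. -/
theorem ncard_partitionWalks (k m : ℕ) (lam : Rows k) :
    (partitionWalks k (2 * m + 1) lam).ncard = codeCount (allCodes k) m lam := by
  rw [← ncard_codeWalks (nodup_allCodes k) (g := peak) (fun _ _ h => h.2.1)
    (fun _ _ _ => peak_target_inj) m lam]
  have first : ∀ X ∈ partitionWalks k (2 * m + 1) lam, X 1 = 0 := by
    rintro X ⟨h0, -, -, -, h4⟩
    rcases (h4 0 (by omega)).1 (by simp) with h | ⟨j, h⟩
    · simpa [h0] using h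
    · exfalso
      rw [h0] at h
      have := congrFun h j
      simp [box_apply] at this
  refine Set.ncard_congr (fun X _ i => X (2 * m + 1 - i)) (fun X hX => ?_)
    (fun X Y hX hY h => ?_) (fun Y hY => ?_)
  · have h1' := first X hX
    obtain ⟨h0, h1, h2, h3, h4⟩ := hX
    refine ⟨by simpa using h1, ?_, fun i => h2 _, fun i hi => ?_, fun s hs => ?_⟩
    · have : 2 * m + 1 - 2 * m = 1 := by omega
      simp only [this]; exact h1'
    · have : 2 * m + 1 - 2 * m = 1 := by omega
      simp only [this, h1']
      rcases Nat.lt_or_ge (2 * m) i with h | h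
      · rw [Nat.sub_eq_zero_of_le (by omega), h0]
      · have : 2 * m + 1 - i = 1 := by omega
        rw [this, h1']
    · have e1 : 2 * m + 1 - 2 * s = 2 * (m - 1 - s) + 3 := by omega
      have e2 : 2 * m + 1 - (2 * s + 1) = 2 * (m - 1 - s) + 2 := by omega
      have e3 : 2 * m + 1 - (2 * s + 2) = 2 * (m - 1 - s) + 1 := by omega
      simp only [e1, e2, e3]
      generalize hr : m - 1 - s = r
      have s1 := (h4 (2 * r + 2) (by omega)).1 ⟨r + 1, by ring⟩
      have s2 := (h4 (2 * r + 1) (by omega)).2 ⟨r, by ring⟩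
      simp only [show 2 * r + 2 + 1 = 2 * r + 3 by ring, show 2 * r + 1 + 1 = 2 * r + 2 by ring]
        at s1 s2
      obtain ⟨a, ha⟩ : ∃ a, X (2 * r + 2) = X (2 * r + 3) + obox a := by
        rcases s1 with h | ⟨j, h⟩
        · exact ⟨none, by rw [h]; simp [obox]⟩
        · exact ⟨some j, h⟩
      obtain ⟨b, hb⟩ : ∃ b, X (2 * r + 2) = X (2 * r + 1) + obox b := by
        rcases s2 with h | ⟨j, h⟩
        · exact ⟨none, by rw [h]; simp [obox]⟩
        · exact ⟨some j, h⟩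
      have ht : target (X (2 * r + 3)) (a, b) = X (2 * r + 1) :=
        target_eq_of_add_eq (ha.symm.trans hb)
      refine ⟨(a, b), mem_allCodes _, ⟨h2 _, ?_, ?_, ?_⟩, ha, ht.symm⟩
      · simp only [← ha]; exact h2 _
      · rw [ht]; exact h2 _
      · rw [ht]; exact hb.symm.trans ha
  · funext i
    rcases Nat.lt_or_ge (2 * m + 1) i with hi | hi
    · rw [hX.2.2.2.1 i hi.le, hY.2.2.2.1 i hi.le, hX.2.1, hY.2.1]
    · have := congrFun h (2 * m + 1 - i)
      simpa only [Nat.sub_sub_self hi] using this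
  · obtain ⟨h0, h1, h2, h3, h4⟩ := hY
    refine ⟨fun i => Y (2 * m + 1 - i), ⟨?_, by simpa using h0, fun i => h2 _, fun i hi => ?_,
      fun i hi => ⟨fun he => ?_, fun ho => ?_⟩⟩, ?_⟩
    · simp only [Nat.sub_zero]; rw [h3 _ (by omega), h1]
    · simp only [Nat.sub_eq_zero_of_le hi, Nat.sub_self]
    · obtain ⟨r, hr⟩ := he
      rcases Nat.eq_zero_or_pos r with hr0 | hr0
      · left
        have : i = 0 := by omega
        subst this
        simp only [zero_add, Nat.sub_zero, Nat.add_sub_cancel]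
        exact (h3 _ (by omega)).symm
      · obtain ⟨c, -, ha, e1, e2⟩ := h4 (m - r) (by omega)
        have f1 : 2 * m + 1 - i = 2 * (m - r) + 1 := by omega
        have f2 : 2 * m + 1 - (i + 1) = 2 * (m - r) := by omega
        simp only [f1, f2, e1, peak]
        cases hc : c.1 with
        | none => left; simp [obox]
        | some j => right; exact ⟨j, rfl⟩
    · obtain ⟨r, hr⟩ := ho
      obtain ⟨c, -, ha, e1, e2⟩ := h4 (m - r - 1) (by omega)
      have f1 : 2 * m + 1 - i = 2 * (m - r - 1) + 2 := by omega
      have f2 : 2 * m + 1 - (i + 1) = 2 * (m - r - 1) + 1 := by omega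
      simp only [f1, f2, e1, e2, peak]
      have := ha.2.2.2
      cases hc : c.2 with
      | none => left; rw [hc] at this; simpa [obox] using this.symm
      | some j => right; refine ⟨j, ?_⟩; rw [hc] at this; exact this.symm
    · funext i
      rcases Nat.lt_or_ge (2 * m + 1) i with hi | hi
      · have : 2 * m + 1 - (2 * m + 1 - i) = 2 * m + 1 := by omega
        simp only [this]
        rw [h3 _ (by omega), h3 i (by omega)]
      · simp only [Nat.sub_sub_self hi]

/-! ## Inclusion and exclusion -/

open Classical in
/-- The sum over all moves with codes in `L`. -/
def codeSum {k : ℕ} (L : List (Code k)) : Module.End ℤ (Rows k → ℤ) where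
  toFun f lam := (L.map fun c => if Allowed lam c then f (target lam c) else 0).sum
  map_add' f g := by
    funext lam
    simp only [Pi.add_apply]
    rw [← List.sum_map_add]
    congr 1
    apply List.map_congr_left
    intro c _
    split_ifs <;> simp
  map_smul' r f := by
    funext lam
    simp only [Pi.smul_apply, smul_eq_mul, RingHom.id_apply]
    rw [← List.sum_map_mul_left]
    congr 1
    apply List.map_congr_left
    intro c _
    split_ifs <;> simp

open Classical in
/-- Restriction of functions to shapes. -/
def shapeRestrict (k : ℕ) : Module.End ℤ (Rows k → ℤ) where
  toFun f lam := if Antitone lam then f lam else 0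
  map_add' f g := by
    funext lam
    by_cases h : Antitone lam <;> simp [h]
  map_smul' r f := by
    funext lam
    by_cases h : Antitone lam <;> simp [h]

-- The recursion of `codeCount` is one application of the operator, so its powers, applied to the
-- indicator of the empty shape, count walks.
open Classical in
theorem codeSum_pow_apply {k : ℕ} (L : List (Code k)) (m : ℕ) :
    (codeSum L ^ m) (fun lam => if lam = 0 then 1 else 0) =
      fun lam => (codeCount L m lam : ℤ) := by
  induction m with
  | zero => funext lam; simp [codeCount]
  | succ m ih =>
    rw [pow_succ', Module.End.mul_apply, ih]
    funext lam
    simp only [codeSum, LinearMap.coe_mk, AddHom.coe_mk, codeCount]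
    rw [Nat.cast_list_sum, List.map_map]
    congr 1
    apply List.map_congr_left
    intro c _
    simp only [Function.comp]
    split_ifs <;> simp

theorem codeSum_mul_shapeRestrict {k : ℕ} (L : List (Code k)) :
    codeSum L * shapeRestrict k = codeSum L := by
  apply LinearMap.ext; intro f
  funext lam
  simp only [Module.End.mul_apply, codeSum, shapeRestrict, LinearMap.coe_mk, AddHom.coe_mk]
  congr 1
  apply List.map_congr_left
  intro c _
  split_ifs with h1 h2
  · rfl
  · exact absurd h1.2.2.1 h2
  · rfl

theorem shapeRestrict_mul_codeSum {k : ℕ} (L : List (Code k)) :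
    shapeRestrict k * codeSum L = codeSum L := by
  apply LinearMap.ext; intro f
  funext lam
  simp only [Module.End.mul_apply, codeSum, shapeRestrict, LinearMap.coe_mk, AddHom.coe_mk]
  split_ifs with h
  · rfl
  · symm
    apply List.sum_eq_zero
    intro x hx
    obtain ⟨c, -, rfl⟩ := List.mem_map.mp hx
    exact if_neg fun h' => h h'.1

/-- The single loop code (1,1) leads from every shape back to it, because row 1 can always grow. It
thus contributes the identity on shapes and 0 elsewhere. That row 1 exists needs `2 ≤ k`. -/
theorem codeSum_allCodes {k : ℕ} (hk : 2 ≤ k) :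
    codeSum (allCodes k) = codeSum (moveCodes k) + shapeRestrict k := by
  classical
  apply LinearMap.ext; intro f
  funext lam
  simp only [LinearMap.add_apply, Pi.add_apply, codeSum, shapeRestrict, LinearMap.coe_mk,
    AddHom.coe_mk, allCodes, moveCodes]
  rw [Finset.sum_map_toList, Finset.sum_map_toList,
    ← Finset.sum_filter_add_sum_filter_not Finset.univ (fun c : Code k => ¬ IsLoopCode c)]
  congr 1
  let z : Fin (k - 1) := ⟨0, by omega⟩
  have : (Finset.univ.filter fun c : Code k => ¬ ¬ IsLoopCode c) = {(some z, some z)} := by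
    ext c
    simp only [not_not, Finset.mem_filter, Finset.mem_univ, true_and, Finset.mem_singleton]
    constructor
    · rintro ⟨j, t, rfl, h1, h2⟩
      have e1 : j = z := Fin.ext h1
      have e2 : t = z := Fin.ext h2
      rw [e1, e2]
    · rintro rfl; exact ⟨z, z, rfl, rfl, rfl⟩
  rw [this, Finset.sum_singleton]
  have e : target lam (some z, some z) = lam := by simp [target, obox]
  rw [e]
  refine if_congr ⟨fun h => h.1, fun h => ⟨h, ?_, by rwa [e], by rw [e]⟩⟩ rfl rfl
  intro i j hij
  have := h hij
  simp only [Pi.add_apply, obox, box_apply]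
  rcases hij.eq_or_lt with rfl | hlt
  · rfl
  · have : j ≠ z := fun h => by rw [h] at hlt; exact absurd (Fin.lt_def.mp hlt) (by simp [z])
    simp only [this, if_false]
    omega

/-- Inclusion and exclusion over the loops: the operator of the loop-free codes is the difference of
two commuting operators, and its powers expand binomially. The restriction to shapes fixes the
indicator of the empty shape, so its powers leave only the sign. -/
theorem walkCount_eq {k : ℕ} (hk : 2 ≤ k) (m : ℕ) (lam : Rows k) :
    walkCount k m lam = moveCount m lam := by
  classical
  set f0 : Rows k → ℤ := fun lam => if lam = 0 then 1 else 0 with hf0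
  have hJ : shapeRestrict k f0 = f0 := by
    funext mu
    simp only [shapeRestrict, LinearMap.coe_mk, AddHom.coe_mk, hf0]
    by_cases h : mu = 0
    · subst h
      have h0 : Antitone (0 : Rows k) := fun _ _ _ => le_rfl
      rw [if_pos h0]
    · simp [h]
  have hJn : ∀ n, ((-shapeRestrict k) ^ n) f0 = (-1 : ℤ) ^ n • f0 := by
    intro n
    induction n with
    | zero => simp
    | succ n ih =>
      rw [pow_succ', Module.End.mul_apply, ih, map_smul, LinearMap.neg_apply, hJ, pow_succ]
      simp
  have hT : codeSum (moveCodes k) = -shapeRestrict k + codeSum (allCodes k) := by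
    rw [codeSum_allCodes hk]; abel
  have hc : Commute (-shapeRestrict k) (codeSum (allCodes k)) := by
    apply Commute.neg_left
    rw [commute_iff_eq, codeSum_mul_shapeRestrict, shapeRestrict_mul_codeSum]
  have key := congrFun (codeSum_pow_apply (moveCodes k) m) lam
  rw [← hf0, hT, (hc).add_pow] at key
  simp only [moveCount]
  rw [← key, walkCount, LinearMap.sum_apply, Finset.sum_apply]
  apply Finset.sum_congr rfl
  intro h _
  rw [ncard_partitionWalks, ← congrFun (codeSum_pow_apply (allCodes k) (m - h)) lam, ← hf0]
  have hcc := (hc.pow_pow h (m - h)).eq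
  rw [hcc, Module.End.mul_apply, Module.End.mul_apply]
  have : ((m.choose h : ℕ) : Module.End ℤ (Rows k → ℤ)) f0 = (m.choose h : ℤ) • f0 := by
    simp
  rw [this, map_smul, hJn, map_smul, map_smul]
  simp only [Pi.smul_apply, smul_eq_mul]
  ring

end

noncomputable section

/-! ## Partitions and their arcs -/

/-- One of the two elements is reached from the other along the arcs of `A`. -/
def Linked (A : ℕ → ℕ → Prop) (x y : ℕ) : Prop :=
  Relation.ReflTransGen A x y ∨ Relation.ReflTransGen A y x

/-- Only transitivity needs the uniqueness of arcs: two paths with a common start or a common end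
are comparable, as neither can branch. -/
theorem Linked.equivalence {A : ℕ → ℕ → Prop} (hr : Relator.RightUnique A)
    (hl : Relator.LeftUnique A) : Equivalence (Linked A) where
  refl x := Or.inl .refl
  symm h := h.symm
  trans {x y z} h1 h2 := by
    rcases h1 with h1 | h1 <;> rcases h2 with h2 | h2
    · exact Or.inl (h1.trans h2)
    · have hs : Relator.RightUnique (Function.swap A) := fun a b c hab hac => hl hab hac
      have := Relation.ReflTransGen.total_of_right_unique hs h1.swap h2.swap
      rcases this with h | h
      · exact Or.inr (by simpa [Function.swap] using h.swap)
      · exact Or.inl (by simpa [Function.swap] using h.swap)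
    · exact Relation.ReflTransGen.total_of_right_unique hr h1 h2
    · exact Or.inr (h2.trans h1)

theorem le_of_reflTransGen {A : ℕ → ℕ → Prop} (hA : ∀ i j, A i j → i < j) {x y : ℕ}
    (h : Relation.ReflTransGen A x y) : x ≤ y := by
  induction h with
  | refl => exact le_rfl
  | tail _ h ih => exact ih.trans (hA _ _ h).le

theorem IsArc.lt {N : ℕ} {P : Finpartition (Finset.Icc 1 N)} {i j : ℕ} (h : IsArc P i j) :
    i < j := by
  obtain ⟨_, _, _, _, h, _⟩ := h; exact h

theorem IsArc.mem {N : ℕ} {P : Finpartition (Finset.Icc 1 N)} {i j : ℕ} (h : IsArc P i j) :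
    1 ≤ i ∧ j ≤ N := by
  obtain ⟨B, hB, h1, h2, -, -⟩ := h
  have a1 := Finset.mem_Icc.mp (P.subset hB h1)
  have a2 := Finset.mem_Icc.mp (P.subset hB h2)
  exact ⟨a1.1, a2.2⟩

theorem IsArc.rightUnique {N : ℕ} (P : Finpartition (Finset.Icc 1 N)) :
    Relator.RightUnique (IsArc P) := by
  rintro i j l ⟨B, hB, h1, h2, h3, h4⟩ ⟨B', hB', h1', h2', h3', h4'⟩
  obtain rfl := P.eq_of_mem_parts hB hB' h1 h1'
  have := h4 l h2'
  have := h4' j h2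
  omega

theorem IsArc.leftUnique {N : ℕ} (P : Finpartition (Finset.Icc 1 N)) :
    Relator.LeftUnique (IsArc P) := by
  rintro i l j ⟨B, hB, h1, h2, h3, h4⟩ ⟨B', hB', h1', h2', h3', h4'⟩
  obtain rfl := P.eq_of_mem_parts hB hB' h2 h2'
  have := h4 l h1'
  have := h4' i h1
  omega

/-- The next larger element of the block is joined to `x` by an arc; induction on the distance to
`y`. -/
theorem reflTransGen_isArc {N : ℕ} {P : Finpartition (Finset.Icc 1 N)} {B : Finset ℕ}
    (hB : B ∈ P.parts) {x y : ℕ} (hx : x ∈ B) (hy : y ∈ B) (hxy : x ≤ y) :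
    Relation.ReflTransGen (IsArc P) x y := by
  induction hn : y - x using Nat.strong_induction_on generalizing x with
  | _ n ih =>
    rcases hxy.eq_or_lt with rfl | hlt
    · exact .refl
    · have hne : (B.filter (x < ·)).Nonempty := ⟨y, by simp [hy, hlt]⟩
      have hm := (B.filter (x < ·)).min'_mem hne
      set m := (B.filter (x < ·)).min' hne with hmdef
      rw [Finset.mem_filter] at hm
      have hle : m ≤ y := Finset.min'_le _ _ (by simp [hy, hlt])
      have harc : IsArc P x m := by
        refine ⟨B, hB, hx, hm.1, hm.2, fun l hl h => ?_⟩
        have : m ≤ l := Finset.min'_le _ _ (by simp [hl, h.1])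
        omega
      exact (ih (y - m) (by omega) hm.1 hle rfl).head harc

theorem linked_isArc_iff {N : ℕ} {P : Finpartition (Finset.Icc 1 N)} {x y : ℕ}
    (hx : x ∈ Finset.Icc 1 N) : Linked (IsArc P) x y ↔ ∃ B ∈ P.parts, x ∈ B ∧ y ∈ B := by
  constructor
  · have key : ∀ {x y : ℕ}, Relation.ReflTransGen (IsArc P) x y →
        ∀ B ∈ P.parts, (x ∈ B ↔ y ∈ B) := by
      intro x y h B hB
      induction h with
      | refl => rfl
      | tail _ h ih =>
        rw [ih]
        obtain ⟨B', hB', h1, h2, -, -⟩ := h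
        constructor
        · intro h; rwa [P.eq_of_mem_parts hB hB' h h1]
        · intro h; rwa [P.eq_of_mem_parts hB hB' h h2]
    obtain ⟨B, hB, hxB⟩ := P.exists_mem hx
    rintro (h | h)
    · exact ⟨B, hB, hxB, (key h B hB).mp hxB⟩
    · exact ⟨B, hB, hxB, (key h B hB).mpr hxB⟩
  · rintro ⟨B, hB, h1, h2⟩
    rcases le_total x y with h | h
    · exact Or.inl (reflTransGen_isArc hB h1 h2 h)
    · exact Or.inr (reflTransGen_isArc hB h2 h1 h)

/-- The blocks are the classes of `Linked` in `[N]`, so they can be recovered from the arcs. -/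
theorem eq_of_isArc_iff {N : ℕ} {P Q : Finpartition (Finset.Icc 1 N)}
    (h : ∀ i j, IsArc P i j ↔ IsArc Q i j) : P = Q := by
  have hPQ : IsArc P = IsArc Q := by funext i j; exact propext (h i j)
  have key : ∀ {P Q : Finpartition (Finset.Icc 1 N)}, IsArc P = IsArc Q → P.parts ⊆ Q.parts := by
    intro P Q hPQ B hB
    obtain ⟨x, hx⟩ := P.nonempty_of_mem_parts hB
    have hxN := P.subset hB hx
    obtain ⟨B', hB', hx'⟩ := Q.exists_mem hxN
    have : B = B' := by
      ext y
      have h1 := linked_isArc_iff (P := P) (y := y) hxN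
      have h2 := linked_isArc_iff (P := Q) (y := y) hxN
      rw [hPQ] at h1
      have h3 := h1.symm.trans h2
      constructor
      · intro hy
        obtain ⟨C, hC, c1, c2⟩ := h3.mp ⟨B, hB, hx, hy⟩
        rwa [Q.eq_of_mem_parts hB' hC hx' c1]
      · intro hy
        obtain ⟨C, hC, c1, c2⟩ := h3.mpr ⟨B', hB', hx', hy⟩
        rwa [P.eq_of_mem_parts hB hC hx c1]
    rwa [this]
  ext1
  exact Finset.Subset.antisymm (key hPQ) (key hPQ.symm)

/-- Take the classes of `Linked` as blocks. Arcs increase and do not branch, so a class is an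
increasing chain of arcs, in which consecutive elements are exactly the joined ones. -/
theorem exists_partition_of_arcs {N : ℕ} {A : ℕ → ℕ → Prop} (hlt : ∀ i j, A i j → i < j)
    (hN : ∀ i j, A i j → 1 ≤ i ∧ j ≤ N) (hr : Relator.RightUnique A)
    (hl : Relator.LeftUnique A) : ∃ P : Finpartition (Finset.Icc 1 N), IsArc P = A := by
  classical
  let s : Setoid ℕ := ⟨Linked A, Linked.equivalence hr hl⟩
  let P := Finpartition.ofSetSetoid s (Finset.Icc 1 N)
  have hP : ∀ x y, x ∈ Finset.Icc 1 N → y ∈ Finset.Icc 1 N →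
      ((∃ B ∈ P.parts, x ∈ B ∧ y ∈ B) ↔ Linked A x y) := by
    intro x y hx hy
    rw [← Finpartition.mem_part_iff_exists, P.mem_part_iff_part_eq_part hx hy]
    rw [← P.mem_part_iff_part_eq_part hx hy]
    rw [Finpartition.mem_part_ofSetSetoid_iff_rel]
    constructor
    · rintro ⟨-, -, h⟩; exact s.symm h
    · intro h; exact ⟨hy, hx, s.symm h⟩
  refine ⟨P, ?_⟩
  funext i j
  apply propext
  constructor
  · rintro ⟨B, hB, h1, h2, h3, h4⟩
    have hi := P.subset hB h1
    have hj := P.subset hB h2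
    rcases (hP i j hi hj).mp ⟨B, hB, h1, h2⟩ with h | h
    · rcases Relation.ReflTransGen.cases_head h with rfl | ⟨m, hm, hmj⟩
      · omega
      · have hmj' := le_of_reflTransGen hlt hmj
        have hm' := hlt _ _ hm
        have hmN : m ∈ Finset.Icc 1 N := by
          rw [Finset.mem_Icc] at hi hj ⊢; omega
        obtain ⟨C, hC, c1, c2⟩ := (hP i m hi hmN).mpr (Or.inl (.single hm))
        obtain rfl := P.eq_of_mem_parts hB hC h1 c1
        have := h4 m c2
        have : m = j := by omega
        rwa [← this]
    · have := le_of_reflTransGen hlt h; omega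
  · intro h
    have hij := hlt _ _ h
    have hb := hN _ _ h
    have hi : i ∈ Finset.Icc 1 N := by rw [Finset.mem_Icc]; omega
    have hj : j ∈ Finset.Icc 1 N := by rw [Finset.mem_Icc]; omega
    obtain ⟨B, hB, h1, h2⟩ := (hP i j hi hj).mpr (Or.inl (.single h))
    refine ⟨B, hB, h1, h2, hij, fun m hm hlm => ?_⟩
    rcases (hP i m hi (P.subset hB hm)).mp ⟨B, hB, h1, hm⟩ with h' | h'
    · rcases Relation.ReflTransGen.cases_head h' with rfl | ⟨l, hl', hlm'⟩
      · omega
      · have e := hr h hl'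
        have := le_of_reflTransGen hlt hlm'
        omega
    · have := le_of_reflTransGen hlt h'; omega

theorem isSetRegular_two_iff {N : ℕ} {P : Finpartition (Finset.Icc 1 N)} :
    IsSetRegular 2 P ↔ ∀ i, ¬ IsArc P i (i + 1) := by
  constructor
  · rintro h i ⟨B, hB, h1, h2, h3, -⟩
    have := h B hB i h1 (i + 1) h2 h3
    omega
  · intro h B hB x hx y hy hxy
    by_contra hlt
    have : y = x + 1 := by omega
    subst this
    exact h x ⟨B, hB, hx, hy, hxy, fun m _ => by omega⟩

/-- With right ends lowered by one, i_r < j_s reads i_r ≤ j_s, and a forbidden arc (i, i+1) is a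
loop, so the conditions on both sides are the same. -/
theorem partitionToBraid_bijOn (k N : ℕ) (hN : 1 ≤ N) :
    Set.BijOn partitionToBraid (regularNoncrossing k 2 N) (loopFreeBraids k (N - 1)) := by
  refine ⟨?_, ?_, ?_⟩
  · rintro P ⟨hP, hreg⟩
    rw [isSetRegular_two_iff] at hreg
    refine ⟨⟨?_, ?_, ?_⟩, fun i hi => hreg i hi, ?_⟩
    · rintro ⟨i, j⟩ h
      change IsArc P i (j + 1) at h
      have h1 := h.lt
      have h2 := h.mem
      dsimp only
      omega
    · rintro ⟨i, j⟩ h ⟨i', j'⟩ h' e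
      change IsArc P i (j + 1) at h
      change IsArc P i' (j' + 1) at h'
      dsimp only at e
      subst e
      have := IsArc.rightUnique P h h'
      rw [Nat.add_right_cancel this]
    · rintro ⟨i, j⟩ h ⟨i', j'⟩ h' e
      change IsArc P i (j + 1) at h
      change IsArc P i' (j' + 1) at h'
      dsimp only at e
      subst e
      rw [IsArc.leftUnique P h h']
    · rintro ⟨a, b, ha, hb, hab, h⟩
      refine hP ⟨a, fun r => b r + 1, ha, fun r s hrs => Nat.add_lt_add_right (hb hrs) 1,
        fun r s => Nat.lt_succ_of_le (hab r s), h⟩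
  · rintro P ⟨-, hP⟩ Q ⟨-, hQ⟩ h
    apply eq_of_isArc_iff
    intro i j
    rcases j with _ | j
    · exact ⟨fun h => absurd h.lt (by omega), fun h => absurd h.lt (by omega)⟩
    · exact Set.ext_iff.mp h (i, j)
  · rintro A ⟨⟨hb, hr, hl⟩, hloop, hcross⟩
    obtain ⟨P, hP⟩ := exists_partition_of_arcs (N := N) (A := fun i j => 0 < j ∧ (i, j - 1) ∈ A)
      (by
        rintro i j ⟨h1, h2⟩
        have h3 := hb _ h2
        dsimp only at h3
        have : i ≠ j - 1 := by rintro rfl; exact hloop _ h2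
        omega)
      (by
        rintro i j ⟨h1, h2⟩
        have h3 := hb _ h2
        dsimp only at h3
        omega)
      (by
        rintro i j l ⟨h1, h2⟩ ⟨h3, h4⟩
        have := congrArg Prod.snd (hr _ h2 _ h4 rfl)
        dsimp only at this
        omega)
      (by
        rintro i l j ⟨h1, h2⟩ ⟨h3, h4⟩
        exact congrArg Prod.fst (hl _ h2 _ h4 rfl))
    have hA : ∀ i j, IsArc P i j ↔ 0 < j ∧ (i, j - 1) ∈ A := fun i j => by rw [hP]
    refine ⟨P, ⟨?_, ?_⟩, ?_⟩
    · rintro ⟨a, b, ha, hb', hab, h⟩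
      have hpos : ∀ r, 0 < b r := fun r => ((hA _ _).mp (h r)).1
      refine hcross ⟨a, fun r => b r - 1, ha, fun r s hrs => ?_, fun r s => ?_,
        fun r => ((hA _ _).mp (h r)).2⟩
      · have := hb' hrs
        have := hpos r
        show b r - 1 < b s - 1
        omega
      · exact Nat.le_sub_one_of_lt (hab r s)
    · rw [isSetRegular_two_iff]
      intro i h
      exact hloop i ((hA _ _).mp h).2
    · ext ⟨i, j⟩
      change IsArc P i (j + 1) ↔ _
      rw [hA]
      simp

end

noncomputable section

/-! ## Tableaux -/

/-- The number of elements smaller than `z`. -/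
def below (S : Finset ℕ) (z : ℕ) : ℕ := (S.filter (· < z)).card

theorem below_insert {S : Finset ℕ} {x : ℕ} (hx : x ∉ S) (z : ℕ) :
    below (insert x S) z = below S z + if x < z then 1 else 0 := by
  unfold below
  rw [Finset.filter_insert]
  split_ifs with h
  · rw [Finset.card_insert_of_notMem (by simp [hx])]
  · rfl

theorem below_erase {S : Finset ℕ} {x : ℕ} (hx : x ∈ S) (z : ℕ) :
    below (S.erase x) z + (if x < z then 1 else 0) = below S z := by
  conv_rhs => rw [← Finset.insert_erase hx]
  rw [below_insert (Finset.notMem_erase x S)]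

theorem below_mono {S : Finset ℕ} {a b : ℕ} (h : a ≤ b) : below S a ≤ below S b :=
  Finset.card_le_card fun z hz => by
    rw [Finset.mem_filter] at hz ⊢; exact ⟨hz.1, by omega⟩

theorem below_congr {S : Finset ℕ} {a b : ℕ} (h : ∀ u ∈ S, u < a ↔ u < b) :
    below S a = below S b :=
  congrArg Finset.card (Finset.filter_congr h)

theorem below_eq_card {S : Finset ℕ} {z : ℕ} (h : ∀ u ∈ S, u < z) : below S z = S.card := by
  rw [below, Finset.filter_true_of_mem h]

theorem below_le_card (S : Finset ℕ) (z : ℕ) : below S z ≤ S.card :=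
  Finset.card_le_card (Finset.filter_subset _ _)

theorem below_pos {S : Finset ℕ} {x z : ℕ} (hx : x ∈ S) (h : x < z) : 0 < below S z :=
  Finset.card_pos.mpr ⟨x, by simp [hx, h]⟩

/-- Tableaux with rows `T 1, T 2, …`: the rows are disjoint and the columns increase strictly. -/
structure IsTab (T : ℕ → Finset ℕ) : Prop where
  zero : T 0 = ∅
  disj : ∀ r s z, z ∈ T r → z ∈ T s → r = s
  -- Comparing these counts for all `z` compares the entries column by column: no entry is smaller
  -- than the one above it. Disjointness of the rows makes this strict.
  dom : ∀ r z, below (T (r + 2)) z ≤ below (T (r + 1)) z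

/-- Beyond the largest entry of the lower row, the dominance of counts becomes a comparison of
lengths. -/
theorem IsTab.card_le {T : ℕ → Finset ℕ} (hT : IsTab T) (r : ℕ) :
    (T (r + 2)).card ≤ (T (r + 1)).card := by
  have h := hT.dom r ((T (r + 2)).sup id + 1)
  rw [below_eq_card] at h
  · exact h.trans (below_le_card _ _)
  · intro u hu
    exact Nat.lt_succ_of_le (Finset.le_sup (f := id) hu)

theorem IsTab.dom' {T : ℕ → Finset ℕ} (hT : IsTab T) (r z : ℕ) :
    below (T (r + 1 + 1)) z ≤ below (T (r + 1)) z := hT.dom r z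

theorem isTab_empty : IsTab fun _ => ∅ :=
  ⟨rfl, by simp, fun _ _ => le_rfl⟩

theorem IsTab.update {T : ℕ → Finset ℕ} (hT : IsTab T) {r : ℕ} {S : Finset ℕ}
    (hS : ∀ z ∈ S, z ∈ T (r + 1) ∨ ∀ s, z ∉ T s)
    (h1 : ∀ q, r = q + 1 → ∀ z, below S z ≤ below (T r) z)
    (h2 : ∀ z, below (T (r + 2)) z ≤ below S z) : IsTab (Function.update T (r + 1) S) := by
  refine ⟨?_, ?_, ?_⟩
  · rw [Function.update_of_ne (by omega)]; exact hT.zero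
  · intro a b z ha hb
    rw [Function.update_apply] at ha hb
    split_ifs at ha hb with e1 e2 e2
    · rw [e1, e2]
    · rcases hS z ha with h | h
      · rw [e1]; exact hT.disj _ _ _ h hb
      · exact absurd hb (h _)
    · rcases hS z hb with h | h
      · rw [e2]; exact hT.disj _ _ _ ha h
      · exact absurd ha (h _)
    · exact hT.disj _ _ _ ha hb
  · intro q z
    rw [Function.update_apply, Function.update_apply]
    split_ifs with e1 e2 e2
    · omega
    · have e : r = q + 1 := by omega
      rw [← e]; exact h1 q e z
    · have e : q = r := by omega
      rw [e]; exact h2 z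
    · exact hT.dom' q z

/-- The entry `x`, which is not in the tableau `T`, fits between the rows `r` and `r + 1`. -/
def Gap (r : ℕ) (T : ℕ → Finset ℕ) (x : ℕ) : Prop :=
  (∀ s, x ∉ T s) ∧ ∀ q, r = q + 1 → below (T (r + 1)) x < below (T r) x

/-- The row `A'` arises from the row `A` if `x` replaces `y`, the largest entry smaller than `x`;
then `x` is the smallest entry of `A'` larger than `y`. -/
structure RowSwap (A : Finset ℕ) (x y : ℕ) (A' : Finset ℕ) : Prop where
  notMem : x ∉ A
  mem : y ∈ A
  lt : y < x
  max : ∀ z ∈ A, z < x → z ≤ y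
  eq : A' = insert x (A.erase y)

namespace RowSwap

variable {A A' : Finset ℕ} {x y : ℕ}

theorem mem_right (h : RowSwap A x y A') : x ∈ A' := by simp [h.eq]

theorem notMem_right (h : RowSwap A x y A') : y ∉ A' := by
  have := h.lt
  simp [h.eq]; omega

theorem min (h : RowSwap A x y A') : ∀ z ∈ A', y < z → x ≤ z := by
  intro z hz hyz
  rw [h.eq, Finset.mem_insert, Finset.mem_erase] at hz
  rcases hz with rfl | ⟨h1, h2⟩
  · exact le_rfl
  · by_contra hlt
    have := h.max z h2 (by omega)
    omega

theorem eq_left (h : RowSwap A x y A') : A = insert y (A'.erase x) := by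
  rw [h.eq, Finset.erase_insert (by simp [h.notMem]), Finset.insert_erase h.mem]

theorem of_right (hx : x ∈ A') (hy : y ∉ A') (hlt : y < x) (hmin : ∀ z ∈ A', y < z → x ≤ z)
    (hA : A = insert y (A'.erase x)) : RowSwap A x y A' where
  notMem := by rw [hA]; simp; omega
  mem := by simp [hA]
  lt := hlt
  max z hz hzx := by
    rw [hA, Finset.mem_insert, Finset.mem_erase] at hz
    rcases hz with rfl | ⟨h1, h2⟩
    · exact le_rfl
    · by_contra h
      have := hmin z h2 (by omega)
      omega
  eq := by rw [hA, Finset.erase_insert (by simp [hy]), Finset.insert_erase hx]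

/-- Dominance is checked with this formula: a swap changes the counts only for y < z ≤ x, where by
`below_const` the old count is constant. -/
theorem below_eq (h : RowSwap A x y A') (z : ℕ) :
    below A' z + (if y < z ∧ z ≤ x then 1 else 0) = below A z := by
  have h1 := below_erase h.mem z
  have h2 := below_insert (S := A.erase y) (x := x) (by simp [h.notMem]) z
  rw [h.eq, h2]
  have := h.lt
  split_ifs at * <;> omega

theorem below_const (h : RowSwap A x y A') {z : ℕ} (h1 : y < z) (h2 : z ≤ x) :
    below A z = below A x := by
  apply below_congr
  intro u hu
  have := h.max u hu
  omega

theorem card_eq (h : RowSwap A x y A') : A'.card = A.card := by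
  rw [h.eq, Finset.card_insert_of_notMem (by simp [h.notMem]), Finset.card_erase_of_mem h.mem]
  have := Finset.card_pos.mpr ⟨y, h.mem⟩
  omega

end RowSwap

/-- The entry that `x` replaces in a row under reverse row insertion. -/
def bumped (S : Finset ℕ) (x : ℕ) : ℕ := (S.filter fun z => z < x).sup id

theorem bump_succ (r : ℕ) (T : ℕ → Finset ℕ) (x : ℕ) :
    bump (r + 1) T x = bump r (Function.update T (r + 1)
      (insert x ((T (r + 1)).erase (bumped (T (r + 1)) x)))) (bumped (T (r + 1)) x) := rfl

theorem rowSwap_bumped {S : Finset ℕ} {x : ℕ} (hx : x ∉ S) (h : 0 < below S x) :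
    RowSwap S x (bumped S x) (insert x (S.erase (bumped S x))) := by
  have hne : (S.filter fun z => z < x).Nonempty := Finset.card_pos.mp h
  have hm : bumped S x ∈ S.filter fun z => z < x := by
    obtain ⟨z, hz, e⟩ := Finset.exists_mem_eq_sup _ hne id
    rw [bumped, e]; exact hz
  rw [Finset.mem_filter] at hm
  exact ⟨hx, hm.1, hm.2, fun z hz hzx => Finset.le_sup (f := id) (by simp [hz, hzx]), rfl⟩

theorem bumped_eq {A A' : Finset ℕ} {x y : ℕ} (h : RowSwap A x y A') : bumped A x = y := by
  have h' := rowSwap_bumped h.notMem (below_pos h.mem h.lt)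
  exact le_antisymm (h.max _ h'.mem h'.lt) (h'.max _ h.mem h.lt)

theorem Gap.rowSwap {r : ℕ} {T : ℕ → Finset ℕ} {x : ℕ} (hx : Gap (r + 1) T x) :
    RowSwap (T (r + 1)) x (bumped (T (r + 1)) x)
      (insert x ((T (r + 1)).erase (bumped (T (r + 1)) x))) :=
  rowSwap_bumped (hx.1 _) (by have := hx.2 r rfl; omega)

/-- The swap lowers the counts of row `r + 1` by one for y < z ≤ x. There the old count equals its
value at `x`, and the gap condition leaves exactly this one to spare over the next row. In turn `y`
fits above: it was in row `r + 1` and not in row `r`, so row `r` has more entries below it than the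
new row. -/
theorem IsTab.reverse_step {r : ℕ} {T : ℕ → Finset ℕ} {x y : ℕ} {S : Finset ℕ} (hT : IsTab T)
    (hx : Gap (r + 1) T x) (h : RowSwap (T (r + 1)) x y S) :
    IsTab (Function.update T (r + 1) S) ∧ Gap r (Function.update T (r + 1) S) y := by
  have hyT : ∀ s, s ≠ r + 1 → y ∉ T s := fun s hs hy => hs (hT.disj _ _ _ hy h.mem)
  refine ⟨hT.update ?_ ?_ ?_, ?_, ?_⟩
  · intro z hz
    rw [h.eq, Finset.mem_insert, Finset.mem_erase] at hz
    rcases hz with rfl | hz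
    · exact Or.inr hx.1
    · exact Or.inl hz.2
  · rintro q rfl z
    have := h.below_eq z
    have := hT.dom' q z
    omega
  · intro z
    have h1 := h.below_eq z
    have h2 := hT.dom r z
    have h3 := hx.2 r rfl
    split_ifs at h1 with hz
    · have h4 := h.below_const hz.1 hz.2
      have h5 := below_mono (S := T (r + 2)) hz.2
      simp only [add_assoc, Nat.reduceAdd] at h3
      omega
    · omega
  · intro s
    rw [Function.update_apply]
    split_ifs with e
    · exact h.notMem_right
    · exact hyT s e
  · rintro q rfl
    rw [Function.update_self, Function.update_of_ne (by omega)]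
    have h1 := h.below_eq (y + 1)
    have h2 := h.below_eq y
    have h3 := hT.dom' q (y + 1)
    have h4 : below (T (q + 1)) y = below (T (q + 1)) (y + 1) := by
      apply below_congr
      intro u hu
      have : u ≠ y := by rintro rfl; exact hyT _ (by omega) hu
      omega
    have h5 := below_erase h.mem y
    have h6 := below_erase h.mem (y + 1)
    have := h.lt
    simp only [lt_self_iff_false, false_and, if_false] at h2 h5
    rw [if_pos (by omega)] at h1 h6
    have h7 : below ((T (q + 1 + 1)).erase y) y = below ((T (q + 1 + 1)).erase y) (y + 1) := by
      apply below_congr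
      intro u hu
      have := Finset.ne_of_mem_erase hu
      omega
    omega

/-- The inverse of `IsTab.reverse_step`: `y` comes from above and pushes out `x`. The counts now
grow by one for y < z ≤ x, and the gap condition of `y` says that row `r` allows this. -/
theorem IsTab.forward_step {r : ℕ} {T : ℕ → Finset ℕ} {x y : ℕ} {S : Finset ℕ} (hT : IsTab T)
    (hy : Gap r T y) (h : RowSwap S x y (T (r + 1))) :
    IsTab (Function.update T (r + 1) S) ∧ Gap (r + 1) (Function.update T (r + 1) S) x := by
  have hxT : ∀ s, s ≠ r + 1 → x ∉ T s := fun s hs hx => hs (hT.disj _ _ _ hx h.mem_right)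
  refine ⟨hT.update ?_ ?_ ?_, ?_, ?_⟩
  · intro z hz
    rw [h.eq_left, Finset.mem_insert, Finset.mem_erase] at hz
    rcases hz with rfl | hz
    · exact Or.inr hy.1
    · exact Or.inl hz.2
  · rintro q rfl z
    have h1 := h.below_eq z
    have h2 := hT.dom' q z
    have h3 := hy.2 q rfl
    split_ifs at h1 with hz
    · have h4 := h.below_const hz.1 hz.2
      have h4' : below S (y + 1) = below S x := h.below_const (by omega) h.lt
      have h5 := below_mono (S := T (q + 1)) hz.1.le
      have h6 := h.below_eq y
      have h7 := h.below_eq (y + 1)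
      have h8 : below (T (q + 1 + 1)) y = below (T (q + 1 + 1)) (y + 1) := by
        apply below_congr
        intro u hu
        have : u ≠ y := by rintro rfl; exact hy.1 _ hu
        omega
      have := h.lt
      rw [if_pos (by omega)] at h7
      omega
    · omega
  · intro z
    have h1 := h.below_eq z
    have h2 := hT.dom r z
    omega
  · intro s
    rw [Function.update_apply]
    split_ifs with e
    · exact h.notMem
    · exact hxT s e
  · rintro q e
    rw [Function.update_self, Function.update_of_ne (by omega)]
    have h1 := h.below_eq x
    have h2 := hT.dom r x
    have := h.lt
    rw [if_pos (by omega)] at h1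
    simp only [add_assoc, Nat.reduceAdd]
    omega

/-- Every swap exchanges the carried entry for a smaller one of the row. So all row lengths persist,
as does the set of entries if the carried one is counted. -/
theorem bump_spec {r : ℕ} {T : ℕ → Finset ℕ} {x : ℕ} (hT : IsTab T) (hx : Gap r T x) :
    IsTab (bump r T x).1 ∧ (∀ s, (bump r T x).2 ∉ (bump r T x).1 s) ∧
    (∀ s, ((bump r T x).1 s).card = (T s).card) ∧
    (∀ z, (z = (bump r T x).2 ∨ ∃ s, z ∈ (bump r T x).1 s) ↔ (z = x ∨ ∃ s, z ∈ T s)) ∧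
    (∀ s, r < s → (bump r T x).1 s = T s) ∧ ((bump r T x).2 ≤ x) ∧
    (0 < r → (bump r T x).2 < x) := by
  induction r generalizing T x with
  | zero => exact ⟨hT, hx.1, fun _ => rfl, fun _ => Iff.rfl, fun _ _ => rfl, le_rfl, by omega⟩
  | succ r ih =>
    have hs := hx.rowSwap
    obtain ⟨h1, h2⟩ := hT.reverse_step hx hs
    obtain ⟨a1, a2, a3, a4, a5, a6, a7⟩ := ih h1 h2
    rw [bump_succ]
    refine ⟨a1, a2, fun s => ?_, fun z => ?_, fun s hs' => ?_, a6.trans hs.lt.le,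
      fun _ => lt_of_le_of_lt a6 hs.lt⟩
    · rw [a3 s, Function.update_apply]
      split_ifs with e
      · rw [e]; exact hs.card_eq
      · rfl
    · rw [a4 z]
      have hm := hs.mem
      set y := bumped (T (r + 1)) x
      constructor
      · rintro (rfl | ⟨s, hs'⟩)
        · exact Or.inr ⟨_, hm⟩
        · rw [Function.update_apply] at hs'
          split_ifs at hs' with e
          · rw [Finset.mem_insert, Finset.mem_erase] at hs'
            rcases hs' with h | h
            · exact Or.inl h
            · exact Or.inr ⟨_, h.2⟩
          · exact Or.inr ⟨_, hs'⟩
      · rintro (rfl | ⟨s, hs'⟩)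
        · right; refine ⟨r + 1, ?_⟩
          rw [Function.update_self]; exact Finset.mem_insert_self _ _
        · by_cases hzy : z = y
          · exact Or.inl hzy
          · right; refine ⟨s, ?_⟩
            rw [Function.update_apply]
            split_ifs with e
            · subst e
              exact Finset.mem_insert_of_mem (Finset.mem_erase.mpr ⟨hzy, hs'⟩)
            · exact hs'
    · rw [a5 s (by omega), Function.update_of_ne (by omega)]

/-! ## Removal of a square and row insertion -/

/-- Removal of the last square of row `r + 1` by reverse row insertion. -/
def removeRow (r : ℕ) (T : ℕ → Finset ℕ) : (ℕ → Finset ℕ) × ℕ :=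
  bump r (Function.update T (r + 1) ((T (r + 1)).erase ((T (r + 1)).sup id)))
    ((T (r + 1)).sup id)

theorem sup_id_mem {S : Finset ℕ} (h : S.Nonempty) : S.sup id ∈ S := by
  obtain ⟨z, hz, e⟩ := Finset.exists_mem_eq_sup _ h id
  rw [e]; exact hz

/-- The counts change only beyond the last entry, where they are full lengths, and the next row is
strictly shorter. The entry taken out then fits between the rows `r` and `r + 1`, where reverse
insertion starts. -/
theorem IsTab.erase_last {r : ℕ} {T : ℕ → Finset ℕ} (hT : IsTab T)
    (hc : (T (r + 2)).card < (T (r + 1)).card) :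
    IsTab (Function.update T (r + 1) ((T (r + 1)).erase ((T (r + 1)).sup id))) ∧
    Gap r (Function.update T (r + 1) ((T (r + 1)).erase ((T (r + 1)).sup id)))
      ((T (r + 1)).sup id) := by
  have hm : (T (r + 1)).sup id ∈ T (r + 1) := sup_id_mem (Finset.card_pos.mp (by omega))
  have hmax : ∀ z ∈ T (r + 1), z ≤ (T (r + 1)).sup id := fun z hz => Finset.le_sup (f := id) hz
  set x := (T (r + 1)).sup id
  have hxT : ∀ s, s ≠ r + 1 → x ∉ T s := fun s hs hx => hs (hT.disj _ _ _ hx hm)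
  refine ⟨hT.update (fun z hz => Or.inl (Finset.mem_of_mem_erase hz)) ?_ ?_, ?_, ?_⟩
  · rintro q rfl z
    have := below_erase hm z
    have := hT.dom' q z
    omega
  · intro z
    have h1 := below_erase hm z
    have h2 := hT.dom r z
    split_ifs at h1 with hz
    · have h3 := below_eq_card (S := T (r + 1)) (z := z) (fun u hu => by have := hmax u hu; omega)
      have := below_le_card (T (r + 2)) z
      omega
    · omega
  · intro s
    rw [Function.update_apply]
    split_ifs with e
    · exact Finset.notMem_erase _ _
    · exact hxT s e
  · rintro q rfl
    rw [Function.update_self, Function.update_of_ne (by omega)]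
    have h1 := below_erase hm (x + 1)
    have h2 := hT.dom' q (x + 1)
    have h4 : below (T (q + 1)) x = below (T (q + 1)) (x + 1) := by
      apply below_congr
      intro u hu
      have : u ≠ x := by intro e; rw [e] at hu; exact hxT _ (by omega) hu
      omega
    have h5 := below_mono (S := (T (q + 1 + 1)).erase x) (Nat.le_succ x)
    rw [if_pos (by omega)] at h1
    simp only [Nat.succ_eq_add_one] at h5
    omega

theorem removeRow_spec {r : ℕ} {T : ℕ → Finset ℕ} (hT : IsTab T)
    (hc : (T (r + 2)).card < (T (r + 1)).card) :
    IsTab (removeRow r T).1 ∧ (∀ s, (removeRow r T).2 ∉ (removeRow r T).1 s) ∧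
    (∀ s, ((removeRow r T).1 s).card + (if s = r + 1 then 1 else 0) = (T s).card) ∧
    (∀ z, (z = (removeRow r T).2 ∨ ∃ s, z ∈ (removeRow r T).1 s) ↔ ∃ s, z ∈ T s) ∧
    (removeRow r T).2 ≤ (T (r + 1)).sup id ∧ (0 < r → (removeRow r T).2 < (T (r + 1)).sup id) := by
  have hm : (T (r + 1)).sup id ∈ T (r + 1) := sup_id_mem (Finset.card_pos.mp (by omega))
  obtain ⟨h1, h2⟩ := hT.erase_last hc
  obtain ⟨a1, a2, a3, a4, a5, a6, a7⟩ := bump_spec h1 h2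
  refine ⟨a1, a2, fun s => ?_, fun z => ?_, a6, a7⟩
  · rw [removeRow, a3, Function.update_apply]
    split_ifs with e
    · subst e
      rw [Finset.card_erase_of_mem hm]; omega
    · rfl
  · rw [removeRow, a4]
    constructor
    · rintro (rfl | ⟨s, hs⟩)
      · exact ⟨_, hm⟩
      · rw [Function.update_apply] at hs
        split_ifs at hs with e
        · exact ⟨_, Finset.mem_of_mem_erase hs⟩
        · exact ⟨_, hs⟩
    · rintro ⟨s, hs⟩
      by_cases hz : z = (T (r + 1)).sup id
      · exact Or.inl hz
      · right; refine ⟨s, ?_⟩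
        rw [Function.update_apply]
        split_ifs with e
        · subst e; exact Finset.mem_erase.mpr ⟨hz, hs⟩
        · exact hs

open Classical in
/-- Row insertion of `y` into row `r + 1`, the row below it, and so on, for at most `f + 1` rows;
the second component of the value is the row that becomes longer. -/
def insertRow : ℕ → ℕ → (ℕ → Finset ℕ) → ℕ → (ℕ → Finset ℕ) × ℕ
  | 0, r, T, y => (Function.update T (r + 1) (insert y (T (r + 1))), r + 1)
  | f + 1, r, T, y =>
    if h : ((T (r + 1)).filter (y < ·)).Nonempty then
      let x := ((T (r + 1)).filter (y < ·)).min' h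
      insertRow f (r + 1) (Function.update T (r + 1) (insert y ((T (r + 1)).erase x))) x
    else (Function.update T (r + 1) (insert y (T (r + 1))), r + 1)

theorem insertRow_append (f r : ℕ) (T : ℕ → Finset ℕ) (y : ℕ)
    (h : ∀ z ∈ T (r + 1), ¬ y < z) :
    insertRow f r T y = (Function.update T (r + 1) (insert y (T (r + 1))), r + 1) := by
  cases f with
  | zero => rfl
  | succ f =>
    rw [insertRow, dif_neg]
    rintro ⟨z, hz⟩
    rw [Finset.mem_filter] at hz
    exact h z hz.1 hz.2

theorem insertRow_bump (f r : ℕ) (T : ℕ → Finset ℕ) {x y : ℕ} {S : Finset ℕ}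
    (h : RowSwap S x y (T (r + 1))) :
    insertRow (f + 1) r T y = insertRow f (r + 1) (Function.update T (r + 1) S) x := by
  have hne : ((T (r + 1)).filter (y < ·)).Nonempty := ⟨x, by simp [h.mem_right, h.lt]⟩
  have hx : ((T (r + 1)).filter (y < ·)).min' hne = x := by
    apply le_antisymm
    · exact Finset.min'_le _ _ (by simp [h.mem_right, h.lt])
    · have := Finset.min'_mem _ hne
      rw [Finset.mem_filter] at this
      exact h.min _ this.1 this.2
  rw [insertRow, dif_pos hne]
  simp only [hx]
  rw [h.eq_left]

theorem exists_rowSwap_right {S : Finset ℕ} {y : ℕ} (hy : y ∉ S) (h : ∃ z ∈ S, y < z) :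
    ∃ x, RowSwap (insert y (S.erase x)) x y S := by
  have hne : (S.filter (y < ·)).Nonempty := by
    obtain ⟨z, h1, h2⟩ := h; exact ⟨z, by simp [h1, h2]⟩
  have hm := Finset.min'_mem _ hne
  rw [Finset.mem_filter] at hm
  exact ⟨_, .of_right hm.1 hy hm.2 (fun z hz hyz => Finset.min'_le _ _ (by simp [hz, hyz])) rfl⟩

theorem insertRow_append_spec (f : ℕ) {r : ℕ} {T : ℕ → Finset ℕ} {y : ℕ} (hT : IsTab T)
    (hy : Gap r T y) (h : ∀ z ∈ T (r + 1), ¬ y < z) :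
    ∃ q, (insertRow f r T y).2 = q + 1 ∧ r ≤ q ∧ q ≤ r + f ∧ IsTab (insertRow f r T y).1 ∧
      ((insertRow f r T y).1 (q + 2)).card < ((insertRow f r T y).1 (q + 1)).card ∧
      removeRow q (insertRow f r T y).1 = bump r T y ∧
      ∀ s ≤ r, (insertRow f r T y).1 s = T s := by
  have hlt : ∀ z ∈ T (r + 1), z < y := fun z hz => by
    have := h z hz
    have : z ≠ y := by rintro rfl; exact hy.1 _ hz
    omega
  rw [insertRow_append f r T y h]
  refine ⟨r, rfl, le_rfl, by omega, hT.update ?_ ?_ ?_, ?_, ?_, ?_⟩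
  · intro z hz
    rcases Finset.mem_insert.mp hz with rfl | hz
    · exact Or.inr hy.1
    · exact Or.inl hz
  · rintro q rfl z
    rw [below_insert (hy.1 _)]
    have h1 := hT.dom' q z
    have h2 := hy.2 q rfl
    split_ifs with hz
    · have h3 : below (T (q + 2)) z = below (T (q + 2)) y := by
        apply below_congr
        intro u hu
        have := hlt u hu
        omega
      have h4 := below_mono (S := T (q + 1)) hz.le
      simp only [add_assoc, Nat.reduceAdd] at *
      omega
    · exact h1
  · intro z
    rw [below_insert (hy.1 _)]
    have := hT.dom r z
    omega
  · dsimp only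
    rw [Function.update_self, Function.update_of_ne (by omega),
      Finset.card_insert_of_notMem (hy.1 _)]
    have := hT.card_le r
    omega
  · have hsup : (insert y (T (r + 1))).sup id = y := by
      apply le_antisymm
      · apply Finset.sup_le
        intro z hz
        rcases Finset.mem_insert.mp hz with rfl | hz
        · exact le_rfl
        · exact (hlt z hz).le
      · exact Finset.le_sup (f := id) (Finset.mem_insert_self _ _)
    rw [removeRow]
    simp only [Function.update_self, hsup]
    rw [Finset.erase_insert (hy.1 _), Function.update_idem, Function.update_eq_self]
  · intro s hs
    exact Function.update_of_ne (by omega) _ _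

/-- Removing the square that row insertion has created takes the swaps back down to row `r + 1`.
What remains is the reverse insertion of `y` into the rows above, hence `bump r T y`. The empty row
`r + f + 1` guarantees that the bound `f` on the number of swaps is never the reason to stop. -/
theorem insertRow_spec (f : ℕ) {r : ℕ} {T : ℕ → Finset ℕ} {y : ℕ} (hT : IsTab T)
    (hy : Gap r T y) (hf : T (r + f + 1) = ∅) :
    ∃ q, (insertRow f r T y).2 = q + 1 ∧ r ≤ q ∧ q ≤ r + f ∧ IsTab (insertRow f r T y).1 ∧
      ((insertRow f r T y).1 (q + 2)).card < ((insertRow f r T y).1 (q + 1)).card ∧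
      removeRow q (insertRow f r T y).1 = bump r T y ∧
      ∀ s ≤ r, (insertRow f r T y).1 s = T s := by
  induction f generalizing r T y with
  | zero =>
    apply insertRow_append_spec 0 hT hy
    intro z hz
    rw [add_zero] at hf
    rw [hf] at hz
    exact absurd hz (Finset.notMem_empty _)
  | succ f ih =>
    by_cases hz : ∃ z ∈ T (r + 1), y < z
    · obtain ⟨x, hx⟩ := exists_rowSwap_right (hy.1 _) hz
      obtain ⟨h1, h2⟩ := hT.forward_step hy hx
      rw [insertRow_bump f r T hx]
      set T1 := Function.update T (r + 1) (insert y ((T (r + 1)).erase x)) with hT1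
      have hself : T1 (r + 1) = insert y ((T (r + 1)).erase x) := Function.update_self ..
      obtain ⟨q, a1, a2, a3, a4, a5, a6, a7⟩ := ih h1 h2 (by
        rw [hT1, Function.update_of_ne (by omega), ← hf]; congr 1; omega)
      refine ⟨q, a1, by omega, by omega, a4, a5, ?_, fun s hs => ?_⟩
      · rw [a6, bump_succ]
        have hx' : RowSwap (T1 (r + 1)) x y (T (r + 1)) := by rw [hself]; exact hx
        rw [bumped_eq hx', ← hx'.eq, hT1, Function.update_idem, Function.update_eq_self]
      · rw [a7 s (by omega), hT1, Function.update_of_ne (by omega)]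
    · push Not at hz
      exact insertRow_append_spec _ hT hy fun z h => by have := hz z h; omega

/-- Row insertion of the entry that left repeats the swaps of the reverse insertion in the opposite
order; each of the `r` rows uses up one unit of the bound on the number of rows. -/
theorem insertRow_bump_cancel (f : ℕ) {r : ℕ} {T : ℕ → Finset ℕ} {x : ℕ} (hT : IsTab T)
    (hx : Gap r T x) :
    insertRow (f + r) 0 (bump r T x).1 (bump r T x).2 = insertRow f r T x := by
  induction r generalizing T x f with
  | zero => rfl
  | succ r ih =>
    have hs := hx.rowSwap
    obtain ⟨h1, h2⟩ := hT.reverse_step hx hs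
    rw [bump_succ, show f + (r + 1) = f + 1 + r by ring, ih (f + 1) h1 h2,
      insertRow_bump f r _ (S := T (r + 1)) (x := x) (by rw [Function.update_self]; exact hs),
      Function.update_idem, Function.update_eq_self]

/-- With `removeRow_insertRow` this makes removal of a corner and row insertion inverse to each
other; it is the reason why the tableau algorithm can be run backwards. -/
theorem insertRow_removeRow (f : ℕ) {r : ℕ} {T : ℕ → Finset ℕ} (hT : IsTab T)
    (hc : (T (r + 2)).card < (T (r + 1)).card) (hf : r ≤ f) :
    insertRow f 0 (removeRow r T).1 (removeRow r T).2 = (T, r + 1) := by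
  obtain ⟨h1, h2⟩ := hT.erase_last hc
  have hm : (T (r + 1)).sup id ∈ T (r + 1) := sup_id_mem (Finset.card_pos.mp (by omega))
  obtain ⟨f, rfl⟩ : ∃ g, f = g + r := ⟨f - r, by omega⟩
  rw [removeRow, insertRow_bump_cancel f h1 h2, insertRow_append]
  · rw [Function.update_self, Finset.insert_erase hm, Function.update_idem,
      Function.update_eq_self]
  · intro z hz
    rw [Function.update_self] at hz
    have : z ≤ (T (r + 1)).sup id := Finset.le_sup (f := id) (Finset.mem_of_mem_erase hz)
    omega

theorem removeRow_insertRow (f : ℕ) {T : ℕ → Finset ℕ} {y : ℕ} (hT : IsTab T)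
    (hy : ∀ s, y ∉ T s) (hf : T (f + 1) = ∅) :
    ∃ q, (insertRow f 0 T y).2 = q + 1 ∧ q ≤ f ∧ IsTab (insertRow f 0 T y).1 ∧
      ((insertRow f 0 T y).1 (q + 2)).card < ((insertRow f 0 T y).1 (q + 1)).card ∧
      removeRow q (insertRow f 0 T y).1 = (T, y) := by
  obtain ⟨q, a1, a2, a3, a4, a5, a6, -⟩ :=
    insertRow_spec f (r := 0) hT ⟨hy, fun q hq => by omega⟩ (by rwa [zero_add])
  exact ⟨q, a1, by omega, a4, a5, a6⟩

/-- Deletion of an entry. -/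
def eraseEntry (v : ℕ) (T : ℕ → Finset ℕ) : ℕ → Finset ℕ := fun r => (T r).erase v

/-- Since `v` is an upper bound of the entries, the new count below `z` is the old count below `min
z v`, in every row alike. -/
theorem IsTab.eraseEntry {T : ℕ → Finset ℕ} (hT : IsTab T) {v : ℕ}
    (hv : ∀ r, ∀ z ∈ T r, z ≤ v) : IsTab (eraseEntry v T) := by
  have key : ∀ r z, below ((T r).erase v) z = below (T r) (min z v) := by
    intro r z
    unfold below
    congr 1
    ext u
    simp only [Finset.mem_filter, Finset.mem_erase, lt_min_iff]
    constructor
    · rintro ⟨⟨h1, h2⟩, h3⟩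
      have := hv r u h2
      exact ⟨h2, h3, by omega⟩
    · rintro ⟨h1, h2, h3⟩
      exact ⟨⟨by omega, h1⟩, h2⟩
  refine ⟨by simp [_root_.eraseEntry, hT.zero], fun r s z h1 h2 =>
    hT.disj r s z (Finset.mem_of_mem_erase h1) (Finset.mem_of_mem_erase h2), fun r z => ?_⟩
  simp only [_root_.eraseEntry, key]
  exact hT.dom _ _

theorem IsTab.insert_last {r : ℕ} {T : ℕ → Finset ℕ} (hT : IsTab T) {v : ℕ}
    (hv : ∀ r, ∀ z ∈ T r, z < v) (hr : ∀ q, r = q + 1 → (T (r + 1)).card < (T r).card) :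
    IsTab (Function.update T (r + 1) (insert v (T (r + 1)))) := by
  have hvT : ∀ s, v ∉ T s := fun s hs => by have := hv s v hs; omega
  refine hT.update ?_ ?_ ?_
  · intro z hz
    rcases Finset.mem_insert.mp hz with rfl | hz
    · exact Or.inr hvT
    · exact Or.inl hz
  · rintro q rfl z
    rw [below_insert (hvT _)]
    have h1 := hT.dom' q z
    have h2 := hr q rfl
    split_ifs with h
    · rw [below_eq_card fun u hu => (hv _ u hu).trans h,
        below_eq_card fun u hu => (hv _ u hu).trans h]
      omega
    · exact h1
  · intro z
    rw [below_insert (hvT _)]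
    have := hT.dom r z
    omega

end

noncomputable section

/-! ## The number of rows and decreasing subsequences -/

/-- `b` is a decreasing subsequence of `L`. -/
def DecSub (b L : List ℕ) : Prop := b.Sublist L ∧ b.Pairwise (· > ·)

theorem DecSub.mono {b L : List ℕ} (h : DecSub b L) (x : ℕ) : DecSub b (L ++ [x]) :=
  ⟨h.1.trans (List.sublist_append_left _ _), h.2⟩

theorem pairwise_concat {b : List ℕ} {x : ℕ} (h : b.Pairwise (· > ·)) (hx : ∀ e ∈ b, x < e) :
    (b ++ [x]).Pairwise (· > ·) := by
  rw [List.pairwise_append]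
  exact ⟨h, List.pairwise_singleton _ _, fun e he y hy => by
    rw [List.mem_singleton] at hy; rw [hy]; exact hx e he⟩

theorem DecSub.concat {b L : List ℕ} {x : ℕ} (h : DecSub b L) (hx : ∀ e ∈ b, x < e) :
    DecSub (b ++ [x]) (L ++ [x]) :=
  ⟨h.1.append (List.Sublist.refl _), pairwise_concat h.2 hx⟩

theorem DecSub.of_concat {b L : List ℕ} {z : ℕ} (h : DecSub b (L ++ [z])) :
    DecSub b L ∨ ∃ b', b = b' ++ [z] ∧ DecSub b' L ∧ ∀ e ∈ b', z < e := by
  obtain ⟨hs, hp⟩ := h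
  obtain ⟨l1, l2, rfl, h1, h2⟩ := List.sublist_append_iff.mp hs
  rcases List.sublist_singleton.mp h2 with rfl | rfl
  · left; rw [List.append_nil] at hp ⊢; exact ⟨h1, hp⟩
  · right
    rw [List.pairwise_append] at hp
    exact ⟨l1, rfl, ⟨h1, hp.1⟩, fun e he => hp.2.2 e he z (by simp)⟩

theorem DecSub.lt_of_concat {a L : List ℕ} {l : ℕ} (h : DecSub (a ++ [l]) L) :
    ∀ e ∈ a, l < e := by
  have := h.2
  rw [List.pairwise_append] at this
  exact fun e he => this.2.2 e he l (by simp)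

theorem DecSub.of_erase {b L : List ℕ} {v : ℕ} (h : DecSub b (L.erase v)) : DecSub b L :=
  ⟨h.1.trans List.erase_sublist, h.2⟩

theorem sublist_erase {b L : List ℕ} {v : ℕ} (h : b.Sublist L) (hv : v ∉ b) :
    b.Sublist (L.erase v) := by
  have := h.erase v
  rwa [List.erase_of_not_mem hv] at this

theorem DecSub.erase {b L : List ℕ} {v : ℕ} (h : DecSub b L) (hv : v ∉ b) :
    DecSub b (L.erase v) :=
  ⟨sublist_erase h.1 hv, h.2⟩

theorem DecSub.nil (L : List ℕ) : DecSub [] L := ⟨List.nil_sublist _, List.Pairwise.nil⟩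

theorem DecSub.singleton {L : List ℕ} {z : ℕ} (h : z ∈ L) : DecSub [z] L :=
  ⟨List.singleton_sublist.mpr h, List.pairwise_singleton _ _⟩

/-- `A` is a row of a tableau; `L` lists the entries of this row and of all rows below it, in the
order in which they were inserted into this row, and `L'` the entries of all rows below it, in
the order in which they were inserted into the next row. -/
structure RowLink (A : Finset ℕ) (L L' : List ℕ) : Prop where
  mem : ∀ e, e ∈ L ↔ e ∈ A ∨ e ∈ L'
  disj : ∀ e ∈ A, e ∉ L'
  nodup : L.Nodup
  nodup' : L'.Nodup
  low : ∀ b ∈ L', ∃ y ∈ A, y < b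
  -- Three transfer rules for decreasing subsequences: from the lower list to the upper one without
  -- gain (`keep`) or with one more member (`up`), and back with one less (`down`). The bounds from
  -- below allow a small entry to be appended; the bounds from above keep the largest value out of
  -- the new sequence, so that it may be deleted.
  keep : ∀ b, DecSub b L' → ∃ c, DecSub c L ∧ c.length = b.length ∧
    (∀ e ∈ c, ∃ e' ∈ b, e ≤ e') ∧ ∀ e ∈ c, ∃ e' ∈ b, e' ≤ e
  up : ∀ b y, DecSub b L' → b ≠ [] → y ∈ A → (∀ e ∈ b, y < e) → ∃ c, DecSub c L ∧
    c.length = b.length + 1 ∧ (∀ e ∈ c, ∃ e' ∈ b, e ≤ e') ∧ ∀ e ∈ c, y ≤ e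
  down : ∀ a l, DecSub (a ++ [l]) L → ∃ b, DecSub b L' ∧ b.length = a.length ∧
    (∀ e ∈ b, l < e ∧ ∃ e' ∈ a, e ≤ e') ∧ (l ∈ L' → (b ++ [l]).Sublist L')

theorem rowLink_empty : RowLink ∅ [] [] where
  mem := by simp
  disj := by simp
  nodup := List.nodup_nil
  nodup' := List.nodup_nil
  low := by simp
  keep b hb := by
    obtain rfl := List.sublist_nil.mp hb.1
    exact ⟨[], hb, rfl, by simp, by simp⟩
  up b y hb h := absurd (List.sublist_nil.mp hb.1) h
  down a l h := by
    have := List.sublist_nil.mp h.1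
    simp at this

/-- This is the rule `up` for an entry that has just arrived: it stands at the end of the list, so
it can be appended to what `keep` provides. -/
theorem RowLink.keep_concat {A : Finset ℕ} {L L' : List ℕ} (h : RowLink A L L') {x : ℕ}
    {b : List ℕ} (hb : DecSub b L') (hne : b ≠ []) (hx : ∀ e ∈ b, x < e) :
    ∃ c, DecSub c (L ++ [x]) ∧ c.length = b.length + 1 ∧ (∀ e ∈ c, ∃ e' ∈ b, e ≤ e') ∧
      ∀ e ∈ c, x ≤ e := by
  obtain ⟨c, c1, c2, c3, c4⟩ := h.keep b hb
  have hc : ∀ e ∈ c, x < e := fun e he => by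
    obtain ⟨e', h1, h2⟩ := c4 e he
    exact (hx e' h1).trans_le h2
  obtain ⟨e0, he0⟩ := List.exists_mem_of_ne_nil b hne
  refine ⟨c ++ [x], c1.concat hc, by simp [c2], fun e he => ?_, fun e he => ?_⟩
  · rcases List.mem_append.mp he with he | he
    · exact c3 e he
    · rw [List.mem_singleton.mp he]; exact ⟨e0, he0, (hx e0 he0).le⟩
  · rcases List.mem_append.mp he with he | he
    · exact (hc e he).le
    · rw [List.mem_singleton.mp he]

/-- No entry of the row exceeds `x`. Hence in a decreasing subsequence that ends with `x` the member
before `x` has already left the row, and the last clause of `down` allows it to be kept in the lower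
list. -/
theorem RowLink.append {A : Finset ℕ} {L L' : List ℕ} (h : RowLink A L L') {x : ℕ}
    (hx : x ∉ L) (hA : ∀ z ∈ A, ¬ x < z) : RowLink (insert x A) (L ++ [x]) L' where
  mem e := by
    rw [List.mem_append, h.mem, Finset.mem_insert, List.mem_singleton]; tauto
  disj e he := by
    rcases Finset.mem_insert.mp he with rfl | he
    · exact fun h' => hx ((h.mem _).mpr (Or.inr h'))
    · exact h.disj e he
  nodup := List.nodup_append.mpr ⟨h.nodup, List.nodup_singleton _, fun a ha b hb => by
    rw [List.mem_singleton.mp hb]; rintro rfl; exact hx ha⟩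
  nodup' := h.nodup'
  low b hb := by
    obtain ⟨y, h1, h2⟩ := h.low b hb
    exact ⟨y, Finset.mem_insert_of_mem h1, h2⟩
  keep b hb := by
    obtain ⟨c, c1, c2⟩ := h.keep b hb
    exact ⟨c, c1.mono x, c2⟩
  up b y hb hne hy hyb := by
    rcases Finset.mem_insert.mp hy with rfl | hy
    · exact h.keep_concat hb hne hyb
    · obtain ⟨c, c1, c2⟩ := h.up b y hb hne hy hyb
      exact ⟨c, c1.mono x, c2⟩
  down a l hal := by
    rcases hal.of_concat with hal | ⟨a', e, ha, hxa⟩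
    · exact h.down a l hal
    · obtain ⟨rfl, e'⟩ := List.append_inj' e rfl
      have e' : l = x := by simpa using e'
      subst e'
      have hl : l ∉ L' := fun h' => hx ((h.mem _).mpr (Or.inr h'))
      rcases List.eq_nil_or_concat a with rfl | ⟨a1, a2, rfl⟩
      · exact ⟨[], .nil _, rfl, by simp, fun h' => absurd h' hl⟩
      · rw [List.concat_eq_append] at *
        have ha2 : a2 ∈ L := ha.1.subset (by simp)
        rcases (h.mem _).mp ha2 with h2 | h2
        · exact absurd (hxa a2 (by simp)) (hA a2 h2)
        · obtain ⟨b, b1, b2, b3, b4⟩ := h.down a1 a2 ha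
          refine ⟨b ++ [a2], ⟨b4 h2, pairwise_concat b1.2 fun e he => (b3 e he).1⟩, by simp [b2],
            fun e he => ?_, fun h' => absurd h' hl⟩
          rcases List.mem_append.mp he with he | he
          · obtain ⟨e1, e', he', e2⟩ := b3 e he
            exact ⟨(hxa a2 (by simp)).trans e1, e', by simp [he'], e2⟩
          · rw [List.mem_singleton.mp he]
            exact ⟨hxa a2 (by simp), a2, by simp, le_rfl⟩

/-- A sequence of the lower list that ends with the new member `z` is lifted by `up`, because `z`
was in the row; then `x` may follow, as x < z. Downwards, let `a2` precede `x` in a sequence of the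
upper list. If `a2` is in the row, then z ≤ a2 by the choice of `z`, and `z` replaces it; if not,
`a2` itself is in the lower list. -/
theorem RowLink.bump {A A' : Finset ℕ} {L L' : List ℕ} (h : RowLink A L L') {x z : ℕ}
    (hx : x ∉ L) (hs : RowSwap A' z x A) : RowLink A' (L ++ [x]) (L' ++ [z]) := by
  have hzA := hs.mem_right
  have hzL : z ∈ L := (h.mem z).mpr (Or.inl hzA)
  have hzL' : z ∉ L' := h.disj z hzA
  have hxL' : x ∉ L' := fun h' => hx ((h.mem _).mpr (Or.inr h'))
  have hxz := hs.lt
  have hA' : ∀ e, e ∈ A' ↔ e = x ∨ e ≠ z ∧ e ∈ A := fun e => by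
    rw [hs.eq_left, Finset.mem_insert, Finset.mem_erase]
  have hzup : ∀ b, DecSub b L' → (∀ e ∈ b, z < e) → ∃ c, DecSub c L ∧ c.length = b.length + 1 ∧
      (∀ e ∈ c, ∃ e' ∈ b ++ [z], e ≤ e') ∧ ∀ e ∈ c, z ≤ e := by
    intro b hb hzb
    rcases eq_or_ne b [] with rfl | hne
    · exact ⟨[z], .singleton hzL, rfl, by simp, by simp⟩
    · obtain ⟨c, c1, c2, c3, c4⟩ := h.up b z hb hne hzA hzb
      refine ⟨c, c1, c2, fun e he => ?_, c4⟩
      obtain ⟨e', h1, h2⟩ := c3 e he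
      exact ⟨e', by simp [h1], h2⟩
  refine ⟨fun e => ?_, fun e he => ?_, ?_, ?_, fun b hb => ?_, fun b hb => ?_,
    fun b y hb hne hy hyb => ?_, fun a l hal => ?_⟩
  · rw [List.mem_append, h.mem, hA', List.mem_singleton, List.mem_append, List.mem_singleton]
    by_cases e1 : e = z
    · rw [e1]; tauto
    · tauto
  · rw [List.mem_append, List.mem_singleton]
    rcases (hA' e).mp he with rfl | ⟨h1, h2⟩
    · rintro (h' | h')
      · exact hxL' h'
      · omega
    · rintro (h' | h')
      · exact h.disj e h2 h'
      · exact h1 h'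
  · exact List.nodup_append.mpr ⟨h.nodup, List.nodup_singleton _, fun a ha b hb => by
      rw [List.mem_singleton.mp hb]; rintro rfl; exact hx ha⟩
  · exact List.nodup_append.mpr ⟨h.nodup', List.nodup_singleton _, fun a ha b hb => by
      rw [List.mem_singleton.mp hb]; rintro rfl; exact hzL' ha⟩
  · rcases List.mem_append.mp hb with hb | hb
    · obtain ⟨y, h1, h2⟩ := h.low b hb
      by_cases hy : y = z
      · exact ⟨x, (hA' x).mpr (Or.inl rfl), by omega⟩
      · exact ⟨y, (hA' y).mpr (Or.inr ⟨hy, h1⟩), h2⟩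
    · rw [List.mem_singleton.mp hb]
      exact ⟨x, (hA' x).mpr (Or.inl rfl), hxz⟩
  · rcases hb.of_concat with hb | ⟨b', rfl, hb', hzb⟩
    · obtain ⟨c, c1, c2⟩ := h.keep b hb
      exact ⟨c, c1.mono x, c2⟩
    · obtain ⟨c, c1, c2, c3, c4⟩ := hzup b' hb' hzb
      exact ⟨c, c1.mono x, by simp [c2], c3, fun e he => ⟨z, by simp, c4 e he⟩⟩
  · rcases hb.of_concat with hb | ⟨b', rfl, hb', hzb⟩
    · rcases (hA' y).mp hy with rfl | ⟨h1, h2⟩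
      · exact h.keep_concat hb hne hyb
      · obtain ⟨c, c1, c2⟩ := h.up b y hb hne h2 hyb
        exact ⟨c, c1.mono x, c2⟩
    · have hyx : y ≤ x := hs.max y hy (hyb z (by simp))
      obtain ⟨c, c1, c2, c3, c4⟩ := hzup b' hb' hzb
      refine ⟨c ++ [x], c1.concat fun e he => hxz.trans_le (c4 e he), by simp [c2],
        fun e he => ?_, fun e he => ?_⟩
      · rcases List.mem_append.mp he with he | he
        · exact c3 e he
        · rw [List.mem_singleton.mp he]; exact ⟨z, by simp, hxz.le⟩
      · rcases List.mem_append.mp he with he | he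
        · have := c4 e he; omega
        · rw [List.mem_singleton.mp he]; exact hyx
  · rcases hal.of_concat with hal | ⟨a', e, ha, hxa⟩
    · obtain ⟨b, b1, b2, b3, b4⟩ := h.down a l hal
      refine ⟨b, b1.mono z, b2, b3, fun hl => ?_⟩
      rcases List.mem_append.mp hl with hl | hl
      · exact (b4 hl).trans (List.sublist_append_left _ _)
      · rw [List.mem_singleton.mp hl]
        exact b1.1.append (List.Sublist.refl _)
    · obtain ⟨rfl, e'⟩ := List.append_inj' e rfl
      have e' : l = x := by simpa using e'
      subst e'
      have hl : l ∉ L' ++ [z] := by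
        rw [List.mem_append, List.mem_singleton]
        rintro (h' | h')
        · exact hxL' h'
        · omega
      rcases List.eq_nil_or_concat a with rfl | ⟨a1, a2, rfl⟩
      · exact ⟨[], .nil _, rfl, by simp, fun h' => absurd h' hl⟩
      · rw [List.concat_eq_append] at *
        have ha2 : a2 ∈ L := ha.1.subset (by simp)
        have hxa2 := hxa a2 (by simp)
        obtain ⟨b, b1, b2, b3, b4⟩ := h.down a1 a2 ha
        rcases (h.mem _).mp ha2 with h2 | h2
        · have hz2 := hs.min a2 h2 hxa2
          refine ⟨b ++ [z], b1.concat fun e he => hz2.trans_lt (b3 e he).1, by simp [b2],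
            fun e he => ?_, fun h' => absurd h' hl⟩
          rcases List.mem_append.mp he with he | he
          · obtain ⟨e1, e', he', e2⟩ := b3 e he
            exact ⟨hxa2.trans e1, e', by simp [he'], e2⟩
          · rw [List.mem_singleton.mp he]
            exact ⟨hxz, a2, by simp, hz2⟩
        · refine ⟨b ++ [a2], ⟨(b4 h2).trans (List.sublist_append_left _ _),
            pairwise_concat b1.2 fun e he => (b3 e he).1⟩, by simp [b2],
            fun e he => ?_, fun h' => absurd h' hl⟩
          rcases List.mem_append.mp he with he | he
          · obtain ⟨e1, e', he', e2⟩ := b3 e he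
            exact ⟨hxa2.trans e1, e', by simp [he'], e2⟩
          · rw [List.mem_singleton.mp he]
            exact ⟨hxa2, a2, by simp, le_rfl⟩

/-- The sequences which the rules produce are bounded by members of the given ones, and these are
smaller than `v`; so the rules never use the deleted value. -/
theorem RowLink.erase {A : Finset ℕ} {L L' : List ℕ} (h : RowLink A L L') {v : ℕ}
    (hv : ∀ e ∈ L, e ≤ v) : RowLink (A.erase v) (L.erase v) (L'.erase v) := by
  have hv' : ∀ e ∈ L'.erase v, e < v := fun e he => by
    obtain ⟨h1, h2⟩ := h.nodup'.mem_erase_iff.mp he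
    have := hv e ((h.mem e).mpr (Or.inr h2))
    omega
  have hv1 : ∀ e ∈ L.erase v, e < v := fun e he => by
    obtain ⟨h1, h2⟩ := h.nodup.mem_erase_iff.mp he
    have := hv e h2
    omega
  refine ⟨fun e => ?_, fun e he he' => ?_, h.nodup.erase v, h.nodup'.erase v, fun b hb => ?_,
    fun b hb => ?_, fun b y hb hne hy hyb => ?_, fun a l hal => ?_⟩
  · rw [h.nodup.mem_erase_iff, h.nodup'.mem_erase_iff, Finset.mem_erase, h.mem]; tauto
  · exact h.disj e (Finset.mem_of_mem_erase he) (List.mem_of_mem_erase he')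
  · obtain ⟨y, h1, h2⟩ := h.low b (List.mem_of_mem_erase hb)
    have := hv' b hb
    exact ⟨y, Finset.mem_erase.mpr ⟨by omega, h1⟩, h2⟩
  · obtain ⟨c, c1, c2, c3, c4⟩ := h.keep b hb.of_erase
    refine ⟨c, c1.erase fun hc => ?_, c2, c3, c4⟩
    obtain ⟨e', h1, h2⟩ := c3 v hc
    have := hv' e' (hb.1.subset h1)
    omega
  · obtain ⟨c, c1, c2, c3, c4⟩ := h.up b y hb.of_erase hne (Finset.mem_of_mem_erase hy) hyb
    refine ⟨c, c1.erase fun hc => ?_, c2, c3, c4⟩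
    obtain ⟨e', h1, h2⟩ := c3 v hc
    have := hv' e' (hb.1.subset h1)
    omega
  · obtain ⟨b, b1, b2, b3, b4⟩ := h.down a l hal.of_erase
    have hvb : v ∉ b := fun hb => by
      obtain ⟨-, e', h1, h2⟩ := b3 v hb
      have := hv1 e' (hal.1.subset (by simp [h1]))
      omega
    refine ⟨b, b1.erase hvb, b2, b3, fun hl => ?_⟩
    apply sublist_erase (b4 (List.mem_of_mem_erase hl))
    rw [List.mem_append, List.mem_singleton]
    rintro (h' | h')
    · exact hvb h'
    · have := hv' l hl; omega

/-- `T` is the tableau of the word `w`: it arises by inserting the members of `w` one by one and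
by deleting largest entries. -/
def IsTabOf (T : ℕ → Finset ℕ) (w : List ℕ) : Prop :=
  ∃ H : ℕ → List ℕ, H 1 = w ∧ ∀ r, RowLink (T (r + 1)) (H (r + 1)) (H (r + 2))

theorem isTabOf_empty : IsTabOf (fun _ => ∅) [] := ⟨fun _ => [], rfl, fun _ => rowLink_empty⟩

theorem insertRow_of_le (f r : ℕ) (T : ℕ → Finset ℕ) (y s : ℕ) (hs : s ≤ r) :
    (insertRow f r T y).1 s = T s := by
  induction f generalizing r T y with
  | zero => exact Function.update_of_ne (by omega) _ _
  | succ f ih =>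
    rw [insertRow]
    split_ifs
    · rw [ih _ _ _ (by omega), Function.update_of_ne (by omega)]
    · exact Function.update_of_ne (by omega) _ _

theorem rowLink_insertRow_append (f : ℕ) {r : ℕ} {T : ℕ → Finset ℕ} {y : ℕ} {H : ℕ → List ℕ}
    (hH : ∀ s, r ≤ s → RowLink (T (s + 1)) (H (s + 1)) (H (s + 2))) (hy : y ∉ H (r + 1))
    (h : ∀ z ∈ T (r + 1), ¬ y < z) :
    ∃ H' : ℕ → List ℕ, H' (r + 1) = H (r + 1) ++ [y] ∧ ∀ s, r ≤ s →
      RowLink ((insertRow f r T y).1 (s + 1)) (H' (s + 1)) (H' (s + 2)) := by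
  rw [insertRow_append f r T y h]
  refine ⟨Function.update H (r + 1) (H (r + 1) ++ [y]), Function.update_self .., fun s hs => ?_⟩
  dsimp only
  rcases hs.eq_or_lt with rfl | hlt
  · rw [Function.update_self, Function.update_self, Function.update_of_ne (by omega)]
    exact (hH r le_rfl).append hy h
  · rw [Function.update_of_ne (by omega), Function.update_of_ne (by omega),
      Function.update_of_ne (by omega)]
    exact hH s hs

/-- Each row that the insertion visits gets one new last member of its list: `y` for row `r + 1`,
and the entry pushed out for the next row. -/
theorem rowLink_insertRow (f : ℕ) {r : ℕ} {T : ℕ → Finset ℕ} {y : ℕ} {H : ℕ → List ℕ}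
    (hH : ∀ s, r ≤ s → RowLink (T (s + 1)) (H (s + 1)) (H (s + 2))) (hy : y ∉ H (r + 1))
    (hf : T (r + f + 1) = ∅) :
    ∃ H' : ℕ → List ℕ, H' (r + 1) = H (r + 1) ++ [y] ∧ ∀ s, r ≤ s →
      RowLink ((insertRow f r T y).1 (s + 1)) (H' (s + 1)) (H' (s + 2)) := by
  induction f generalizing r T y H with
  | zero =>
    apply rowLink_insertRow_append 0 hH hy
    rw [add_zero] at hf
    simp [hf]
  | succ f ih =>
    by_cases hz : ∃ z ∈ T (r + 1), y < z
    · have hyT : y ∉ T (r + 1) := fun h => hy (((hH r le_rfl).mem y).mpr (Or.inl h))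
      obtain ⟨x, hx⟩ := exists_rowSwap_right hyT hz
      rw [insertRow_bump f r T hx]
      set T1 := Function.update T (r + 1) (insert y ((T (r + 1)).erase x)) with hT1
      have hself : T1 (r + 1) = insert y ((T (r + 1)).erase x) := Function.update_self ..
      have hlink : ∀ s, r + 1 ≤ s → RowLink (T1 (s + 1)) (H (s + 1)) (H (s + 2)) := by
        intro s hs
        rw [hT1, Function.update_of_ne (by omega)]
        exact hH s (by omega)
      have hx' : x ∉ H (r + 1 + 1) := (hH r le_rfl).disj x hx.mem_right
      have hf' : T1 (r + 1 + f + 1) = ∅ := by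
        rw [hT1, Function.update_of_ne (by omega), ← hf]; congr 1; omega
      obtain ⟨H', e, h'⟩ := ih hlink hx' hf'
      refine ⟨Function.update H' (r + 1) (H (r + 1) ++ [y]), Function.update_self .., fun s hs => ?_⟩
      rcases hs.eq_or_lt with rfl | hlt
      · rw [Function.update_self, Function.update_of_ne (by omega),
          insertRow_of_le _ _ _ _ _ le_rfl, hself, e]
        exact (hH r le_rfl).bump hy hx
      · rw [Function.update_of_ne (by omega), Function.update_of_ne (by omega)]
        exact h' s hlt
    · push Not at hz
      exact rowLink_insertRow_append _ hH hy fun z h => by have := hz z h; omega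

theorem IsTabOf.insertRow {T : ℕ → Finset ℕ} {w : List ℕ} (h : IsTabOf T w) {f y : ℕ}
    (hy : y ∉ w) (hf : T (f + 1) = ∅) : IsTabOf (insertRow f 0 T y).1 (w ++ [y]) := by
  obtain ⟨H, rfl, hH⟩ := h
  obtain ⟨H', e, h'⟩ := rowLink_insertRow f (r := 0) (fun s _ => hH s) hy (by rwa [zero_add])
  exact ⟨H', e, fun s => h' s (Nat.zero_le s)⟩

theorem IsTabOf.eraseEntry {T : ℕ → Finset ℕ} {w : List ℕ} (h : IsTabOf T w) {v : ℕ}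
    (hv : ∀ e ∈ w, e ≤ v) : IsTabOf (eraseEntry v T) (w.erase v) := by
  obtain ⟨H, rfl, hH⟩ := h
  refine ⟨fun r => (H r).erase v, rfl, fun r => (hH r).erase ?_⟩
  induction r with
  | zero => exact hv
  | succ r ih => exact fun e he => ih e (((hH r).mem e).mpr (Or.inr he))

/-- Schensted's theorem, for the number of rows only. Starting with one entry of row `r + 1`, every
row upwards adds a member by `low` and `up`. Conversely every row downwards costs one member by
`down`, and one member remains in the list of row `r + 1`. -/
theorem IsTabOf.row_nonempty_iff {T : ℕ → Finset ℕ} {w : List ℕ} (h : IsTabOf T w) (r : ℕ) :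
    (T (r + 1)).Nonempty ↔ ∃ b, DecSub b w ∧ b.length = r + 1 := by
  obtain ⟨H, rfl, hH⟩ := h
  constructor
  · have climb : ∀ s b, DecSub b (H (s + 1)) → b ≠ [] →
        ∃ c, DecSub c (H 1) ∧ c.length = b.length + s := by
      intro s
      induction s with
      | zero => exact fun b hb _ => ⟨b, hb, rfl⟩
      | succ s ih =>
        intro b hb hne
        have hlast : ∃ y ∈ T (s + 1), ∀ e ∈ b, y < e := by
          rcases List.eq_nil_or_concat b with rfl | ⟨b1, b2, rfl⟩
          · exact absurd rfl hne
          · rw [List.concat_eq_append] at *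
            obtain ⟨y, h1, h2⟩ := (hH s).low b2 (hb.1.subset (by simp))
            refine ⟨y, h1, fun e he => ?_⟩
            rcases List.mem_append.mp he with he | he
            · exact h2.trans (hb.lt_of_concat e he)
            · rwa [List.mem_singleton.mp he]
        obtain ⟨y, h1, h2⟩ := hlast
        obtain ⟨c, c1, c2, -, -⟩ := (hH s).up b y hb hne h1 h2
        obtain ⟨d, d1, d2⟩ := ih c c1 (by rintro rfl; simp at c2)
        exact ⟨d, d1, by omega⟩
    rintro ⟨e, he⟩
    obtain ⟨c, c1, c2⟩ := climb r [e] (.singleton (((hH r).mem e).mpr (Or.inl he))) (by simp)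
    exact ⟨c, c1, by rw [c2, List.length_singleton]; ring⟩
  · have descend : ∀ s n b, DecSub b (H 1) → b.length = n + 1 + s →
        ∃ c, DecSub c (H (s + 1)) ∧ c.length = n + 1 := by
      intro s
      induction s with
      | zero => exact fun n b hb hn => ⟨b, hb, hn⟩
      | succ s ih =>
        intro n b hb hn
        obtain ⟨c, c1, c2⟩ := ih (n + 1) b hb (by omega)
        rcases List.eq_nil_or_concat c with rfl | ⟨a, l, rfl⟩
        · simp at c2
        · rw [List.concat_eq_append] at *
          obtain ⟨d, d1, d2, -, -⟩ := (hH s).down a l c1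
          refine ⟨d, d1, ?_⟩
          rw [List.length_append, List.length_singleton] at c2
          omega
    rintro ⟨b, hb, hlen⟩
    obtain ⟨c, c1, c2⟩ := descend r 0 b hb (by omega)
    obtain ⟨e, he⟩ := List.exists_mem_of_ne_nil c (by rintro rfl; simp at c2)
    rcases ((hH r).mem e).mp (c1.1.subset he) with h | h
    · exact ⟨e, h⟩
    · obtain ⟨y, hy, -⟩ := (hH r).low e h
      exact ⟨y, hy⟩

end

noncomputable section

/-! ## Steps of tableaux -/

theorem shrinkingRow_eq_zero {k : ℕ} {lam mu : Rows k} (h : ∀ r, lam r ≤ mu r) :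
    shrinkingRow lam mu = 0 := by
  unfold shrinkingRow
  rw [← Nat.le_zero]
  apply Finset.sup_le
  intro r _
  rw [if_neg (by have := h r; omega)]

theorem shrinkingRow_box {k : ℕ} (mu : Rows k) (j : Fin (k - 1)) :
    shrinkingRow (mu + box j) mu = j + 1 := by
  unfold shrinkingRow
  apply le_antisymm
  · apply Finset.sup_le
    intro r _
    simp only [Pi.add_apply, box_apply]
    by_cases h : r = j
    · simp [h]
    · simp [h]
  · have := Finset.le_sup (f := fun r : Fin (k - 1) =>
      if mu r < (mu + box j) r then (r : ℕ) + 1 else 0) (Finset.mem_univ j)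
    refine le_trans ?_ this
    simp [box_apply]

theorem tableauStep_stay {k : ℕ} (v : ℕ) (lam : Rows k) (T : ℕ → Finset ℕ) :
    tableauStep v lam lam T = (T, none) := by
  have h := shrinkingRow_eq_zero (lam := lam) (mu := lam) fun _ => le_rfl
  simp only [tableauStep, h]
  congr 1
  funext i
  rw [if_neg (by omega)]

theorem tableauStep_add {k : ℕ} (v : ℕ) (lam : Rows k) (j : Fin (k - 1)) (T : ℕ → Finset ℕ) :
    tableauStep v lam (lam + box j) T =
      (Function.update T (j + 1) (insert v (T (j + 1))), none) := by
  have h := shrinkingRow_eq_zero (lam := lam) (mu := lam + box j) fun r => by simp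
  simp only [tableauStep, h, shrinkingRow_box]
  congr 1
  funext i
  rw [Function.update_apply]
  split_ifs with h1 h2 h2
  · rw [h2]
  · omega
  · omega
  · rfl

theorem tableauStep_remove {k : ℕ} (v : ℕ) (mu : Rows k) (j : Fin (k - 1))
    (T : ℕ → Finset ℕ) :
    tableauStep v (mu + box j) mu T = ((removeRow j T).1, some (removeRow j T).2) := by
  simp only [tableauStep, shrinkingRow_box]
  rfl

/-- The shape of a tableau. -/
def shapeOf (k : ℕ) (T : ℕ → Finset ℕ) : Rows k := fun r => (T (r + 1)).card

/-- The tableau has at most `k - 1` rows. -/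
def FewRows (k : ℕ) (T : ℕ → Finset ℕ) : Prop := ∀ s, k ≤ s → T s = ∅

theorem IsTab.antitone_shapeOf {T : ℕ → Finset ℕ} (hT : IsTab T) (k : ℕ) :
    Antitone (shapeOf k T) := by
  have h : Antitone fun r : ℕ => (T (r + 1)).card := antitone_nat_of_succ_le hT.card_le
  exact fun i j hij => h hij

theorem IsTab.fewRows {T : ℕ → Finset ℕ} (hT : IsTab T) {k : ℕ} (hk : T (k + 1) = ∅) :
    FewRows (k + 1) T := by
  have h : Antitone fun r : ℕ => (T (r + 1)).card := antitone_nat_of_succ_le hT.card_le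
  intro s hs
  obtain ⟨r, rfl⟩ : ∃ r, s = r + 1 := ⟨s - 1, by omega⟩
  have := h (show k ≤ r by omega)
  simpa [hk] using this

theorem shapeOf_update {k : ℕ} {T : ℕ → Finset ℕ} {v : ℕ} (j : Fin (k - 1))
    (hv : v ∉ T (j + 1)) :
    shapeOf k (Function.update T (j + 1) (insert v (T (j + 1)))) = shapeOf k T + box j := by
  funext r
  simp only [shapeOf, Pi.add_apply, box_apply, Function.update_apply]
  by_cases h : r = j
  · subst h; simp [hv]
  · have : (r : ℕ) ≠ j := fun e => h (Fin.ext e)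
    simp [h, this]

theorem FewRows.update {k : ℕ} {T : ℕ → Finset ℕ} (hT : FewRows k T) {r : ℕ} (hr : r < k)
    (S : Finset ℕ) : FewRows k (Function.update T r S) := by
  intro s hs
  rw [Function.update_of_ne (by omega)]
  exact hT s hs

theorem corner_of_antitone {k : ℕ} {T : ℕ → Finset ℕ} (hT : FewRows k T) {mu : Rows k}
    (hmu : Antitone mu) {j : Fin (k - 1)} (h : shapeOf k T = mu + box j) :
    (T (j + 2)).card < (T (j + 1)).card := by
  have h1 : (T (j + 1)).card = mu j + 1 := by
    have := congrFun h j
    simpa [shapeOf, box_apply] using this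
  by_cases hj : (j : ℕ) + 1 < k - 1
  · have h2 := congrFun h ⟨j + 1, hj⟩
    have h3 : mu ⟨j + 1, hj⟩ ≤ mu j := hmu (Fin.le_def.mpr (by simp))
    have h4 : (⟨j + 1, hj⟩ : Fin (k - 1)) ≠ j := fun e => by
      have := congrArg Fin.val e; simp at this
    simp only [shapeOf, Pi.add_apply, box_apply, h4, if_false, add_zero] at h2
    simp only [add_assoc, Nat.reduceAdd] at h2
    omega
  · rw [hT (j + 2) (by omega), h1]; simp

theorem shapeOf_removeRow {k : ℕ} {T : ℕ → Finset ℕ} (hT : IsTab T) {j : Fin (k - 1)}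
    (hc : (T (j + 2)).card < (T (j + 1)).card) :
    shapeOf k T = shapeOf k (removeRow j T).1 + box j := by
  obtain ⟨-, -, h3, -⟩ := removeRow_spec hT hc
  funext r
  have := h3 (r + 1)
  simp only [shapeOf, Pi.add_apply, box_apply]
  by_cases h : r = j
  · subst h; simp at this ⊢; omega
  · have : (r : ℕ) ≠ j := fun e => h (Fin.ext e)
    simp_all

theorem FewRows.removeRow {k : ℕ} {T : ℕ → Finset ℕ} (hF : FewRows k T) (hT : IsTab T) {j : ℕ}
    (hc : (T (j + 2)).card < (T (j + 1)).card) : FewRows k (removeRow j T).1 := by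
  obtain ⟨-, -, h3, -⟩ := removeRow_spec hT hc
  intro s hs
  have := h3 s
  rw [hF s hs, Finset.card_empty] at this
  rw [← Finset.card_eq_zero]
  omega

theorem eraseEntry_of_notMem {T : ℕ → Finset ℕ} {v : ℕ} (h : ∀ s, v ∉ T s) :
    eraseEntry v T = T := funext fun s => Finset.erase_eq_of_notMem (h s)

theorem eraseEntry_update {T : ℕ → Finset ℕ} {v r : ℕ} (h : ∀ s, v ∉ T s) :
    eraseEntry v (Function.update T r (insert v (T r))) = T := by
  funext s
  rw [eraseEntry, Function.update_apply]
  split_ifs with e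
  · rw [e, Finset.erase_insert (h r)]
  · exact Finset.erase_eq_of_notMem (h s)

theorem update_eraseEntry {T : ℕ → Finset ℕ} (hT : IsTab T) {v r : ℕ} (h : v ∈ T r) :
    Function.update (eraseEntry v T) r (insert v (eraseEntry v T r)) = T := by
  funext s
  rw [Function.update_apply]
  split_ifs with e
  · rw [e, eraseEntry, Finset.insert_erase h]
  · exact Finset.erase_eq_of_notMem fun hs => e (hT.disj _ _ _ hs h)

/-- The tableau before a possible removal at the vertex `v`, if `o` is the removed entry. -/
def undoRemoval (F : ℕ) (o : Option ℕ) (T : ℕ → Finset ℕ) : ℕ → Finset ℕ :=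
  match o with
  | some y => (insertRow F 0 T y).1
  | none => T

open Classical in
/-- The tableau between the two steps at the vertex `v`, if `o` is the entry that is removed at
this vertex, and `T` is the tableau after these steps. -/
def midTab (F v : ℕ) (o : Option ℕ) (T : ℕ → Finset ℕ) : ℕ → Finset ℕ :=
  match o with
  | some y => if ∃ s, v ∈ T s then (insertRow F 0 T y).1 else T
  | none => eraseEntry v T

/-- How the tableaux before, between, and after the two steps at the vertex `v` are related;
`o` is the entry that is removed. -/
structure VertexStep (k F v : ℕ) (T0 T1 T2 : ℕ → Finset ℕ) (o : Option ℕ) : Prop where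
  isTab : IsTab T2
  few : FewRows k T2
  isTab_mid : IsTab T1
  few_mid : FewRows k T1
  new_mid : ∀ s z, z ∈ T1 s → z = v ∨ ∃ r, z ∈ T0 r
  new : ∀ s z, z ∈ T2 s → z = v ∨ ∃ r, z ∈ T0 r
  old : ∀ y, o = some y → (∃ r, y ∈ T0 r) ∧ ∀ s, y ∉ T2 s
  back : T0 = eraseEntry v (undoRemoval F o T2)
  undo : undoRemoval F o T2 = T0 ∨ undoRemoval F o T2 = T1 ∨ undoRemoval F o T2 = T2
  mid : T1 = midTab F v o T2

/-- The point is that both steps at `v` can be undone from the tableau after them and the removed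
entry: insert this entry again, then delete `v`. If an entry was removed, the presence of `v`
afterwards tells an addition followed by a removal from a mere removal, so the tableau in the middle
is known as well. -/
theorem vertexStep_of_move {k F v : ℕ} (hF : k ≤ F) {lam mu nu : Rows k} (hmu : Antitone mu)
    (hnu : Antitone nu) (hm : LoopFreeMove lam mu nu) {T : ℕ → Finset ℕ} (hT : IsTab T)
    (hf : FewRows k T) (hs : shapeOf k T = lam) (hv : ∀ r, ∀ z ∈ T r, z < v) :
    ∃ T1 T2 o1 o2, tableauStep v lam mu T = (T1, o1) ∧ tableauStep v mu nu T1 = (T2, o2) ∧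
      (o1 = none ∨ o2 = none) ∧ shapeOf k T1 = mu ∧ shapeOf k T2 = nu ∧
      VertexStep k F v T T1 T2 (o1 <|> o2) := by
  have hvT : ∀ s, v ∉ T s := fun s h => by have := hv s v h; omega
  rcases hm with ⟨j, rfl, rfl⟩ | ⟨rfl, j, rfl⟩ | ⟨rfl, rfl⟩ | ⟨j, t, rfl, h, hl⟩
  · have hc := corner_of_antitone hf hmu hs
    obtain ⟨a1, a2, a3, a4, a5, -⟩ := removeRow_spec hT hc
    have hvR : ∀ s, v ∉ (removeRow j T).1 s := fun s h => by
      obtain ⟨r, hr⟩ := (a4 v).mp (Or.inr ⟨s, h⟩)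
      exact hvT r hr
    have hi := insertRow_removeRow F hT hc (by omega)
    have hshape : shapeOf k (removeRow j T).1 = nu := by
      have := shapeOf_removeRow hT hc
      rw [hs] at this
      exact (add_right_cancel this).symm
    have hfew := hf.removeRow hT hc
    refine ⟨_, _, _, _, tableauStep_remove v nu j T, tableauStep_stay v nu _, Or.inr rfl, hshape,
      hshape, a1, hfew, a1, hfew, fun s z hz => Or.inr ((a4 z).mp (Or.inr ⟨s, hz⟩)),
      fun s z hz => Or.inr ((a4 z).mp (Or.inr ⟨s, hz⟩)), fun y hy => ?_,
      ?_, Or.inl ?_, ?_⟩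
    · have hy : (removeRow j T).2 = y := by simpa using hy
      rw [← hy]
      exact ⟨(a4 _).mp (Or.inl rfl), a2⟩
    · simp only [Option.orElse_eq_orElse, Option.orElse_some, undoRemoval, hi]
      exact (eraseEntry_of_notMem hvT).symm
    · simp only [Option.orElse_eq_orElse, Option.orElse_some, undoRemoval, hi]
    · simp only [Option.orElse_eq_orElse, Option.orElse_some, midTab]
      rw [if_neg (by rintro ⟨s, h⟩; exact hvR s h)]
  · have hr : ∀ q, (j : ℕ) = q + 1 → (T (j + 1)).card < (T j).card := by
      intro q hq
      have h1 := congrFun hs j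
      have h2 := congrFun hs ⟨q, by omega⟩
      have h3 := hnu (show (⟨q, by omega⟩ : Fin (k - 1)) ≤ j from Fin.le_def.mpr (by simp; omega))
      have h4 : (⟨q, by omega⟩ : Fin (k - 1)) ≠ j := fun e => by
        have := congrArg Fin.val e; simp at this; omega
      simp only [Pi.add_apply, box_apply, if_true, h4, if_false, shapeOf] at h1 h2 h3
      rw [← hq] at h2
      omega
    have h1 := hT.insert_last hv hr
    have hsh := shapeOf_update j (hvT (j + 1))
    rw [hs] at hsh
    refine ⟨_, _, _, _, tableauStep_stay v _ T, tableauStep_add v _ j T, Or.inl rfl, hs, hsh, h1,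
      hf.update (by omega) _, hT, hf, fun s z hz => Or.inr ⟨s, hz⟩, fun s z hz => ?_, fun y hy => by simp at hy, ?_,
      Or.inr (Or.inr rfl), ?_⟩
    · rw [Function.update_apply] at hz
      split_ifs at hz with e
      · rcases Finset.mem_insert.mp hz with h | h
        · exact Or.inl h
        · exact Or.inr ⟨_, h⟩
      · exact Or.inr ⟨_, hz⟩
    · exact (eraseEntry_update hvT).symm
    · exact (eraseEntry_update hvT).symm
  · refine ⟨_, _, _, _, tableauStep_stay v _ T, tableauStep_stay v _ T, Or.inl rfl, hs, hs, hT, hf,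
      hT, hf, fun s z hz => Or.inr ⟨s, hz⟩, fun s z hz => Or.inr ⟨s, hz⟩, fun y hy => by simp at hy, ?_, Or.inl rfl, ?_⟩
    · exact (eraseEntry_of_notMem hvT).symm
    · exact (eraseEntry_of_notMem hvT).symm
  · have hr : ∀ q, (j : ℕ) = q + 1 → (T (j + 1)).card < (T j).card := by
      intro q hq
      have h1 := congrFun hs j
      have h2 := congrFun hs ⟨q, by omega⟩
      have h3 := hmu (show (⟨q, by omega⟩ : Fin (k - 1)) ≤ j from Fin.le_def.mpr (by simp; omega))
      have h4 : (⟨q, by omega⟩ : Fin (k - 1)) ≠ j := fun e => by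
        have := congrArg Fin.val e; simp at this; omega
      simp only [Pi.add_apply, box_apply, if_true, h4, if_false, shapeOf] at h1 h2 h3
      rw [← hq] at h2
      omega
    have h1 := hT.insert_last hv hr
    have hsh := shapeOf_update j (hvT (j + 1))
    rw [hs] at hsh
    have hstep := tableauStep_add v lam j T
    set T1 := Function.update T ((j : ℕ) + 1) (insert v (T (j + 1))) with hT1
    have hf1 : FewRows k T1 := hf.update (by omega) _
    have hc := corner_of_antitone hf1 hnu (hsh.trans h)
    obtain ⟨a1, a2, a3, a4, a5, a6⟩ := removeRow_spec h1 hc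
    have hi := insertRow_removeRow F h1 hc (by omega)
    have hshape : shapeOf k (removeRow t T1).1 = nu := by
      have := shapeOf_removeRow h1 hc
      rw [hsh, h] at this
      exact (add_right_cancel this).symm
    have hfew := hf1.removeRow h1 hc
    have hvj : v ∈ T1 (j + 1) := by rw [hT1, Function.update_self]; exact Finset.mem_insert_self _ _
    have hm1 : ∀ s z, z ∈ T1 s → z = v ∨ ∃ r, z ∈ T r := fun s z hz => by
      rw [hT1, Function.update_apply] at hz
      split_ifs at hz with e
      · rcases Finset.mem_insert.mp hz with h | h
        · exact Or.inl h
        · exact Or.inr ⟨_, h⟩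
      · exact Or.inr ⟨_, hz⟩
    have hle1 : ∀ s z, z ∈ T1 s → z ≤ v := fun s z hz => by
      rcases hm1 s z hz with h | ⟨r, h⟩
      · exact h.le
      · exact (hv r z h).le
    have hsup : (T1 (t + 1)).sup id ∈ T1 (t + 1) := sup_id_mem (Finset.card_pos.mp (by omega))
    -- From a row below the first, the entry that leaves is strictly smaller than the one taken out,
    -- hence smaller than `v`. From the first row `v` leaves only if it was added there, which is
    -- the excluded loop.
    have hyv : (removeRow t T1).2 ≠ v := by
      intro hy
      rcases Nat.eq_zero_or_pos (t : ℕ) with ht | ht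
      · have h5 := hle1 _ _ hsup
        have h6 : (T1 (t + 1)).sup id = v := by omega
        rw [h6] at hsup
        have := h1.disj _ _ _ hsup hvj
        exact hl ⟨by omega, ht⟩
      · have h5 := hle1 _ _ hsup
        have := a6 ht
        omega
    have hv2 : ∃ s, v ∈ (removeRow t T1).1 s := by
      rcases (a4 v).mpr ⟨_, hvj⟩ with h | h
      · exact absurd h.symm hyv
      · exact h
    have hrem := tableauStep_remove v nu t T1
    rw [← h] at hrem
    refine ⟨_, _, _, _, hstep, hrem, Or.inl rfl, hsh, hshape, a1, hfew, h1, hf1, hm1, fun s z hz => ?_,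
      fun y hy => ?_, ?_, Or.inr (Or.inl ?_), ?_⟩
    · obtain ⟨r, hr⟩ := (a4 z).mp (Or.inr ⟨s, hz⟩)
      exact hm1 r z hr
    · have hy : (removeRow t T1).2 = y := by simpa using hy
      rw [← hy]
      refine ⟨?_, a2⟩
      obtain ⟨r, hr⟩ := (a4 _).mp (Or.inl rfl)
      rcases hm1 r _ hr with h | h
      · exact absurd h hyv
      · exact h
    · simp only [Option.orElse_eq_orElse, Option.orElse_none, undoRemoval, hi]
      exact (eraseEntry_update hvT).symm
    · simp only [Option.orElse_eq_orElse, Option.orElse_none, undoRemoval, hi]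
    · simp only [Option.orElse_eq_orElse, Option.orElse_none, midTab, hi]
      rw [if_pos hv2]

/-! ## The sequence of tableaux of a braid -/

open Classical in
/-- The left end of the arc with right end `v`. -/
def leftEnd (A : Set (ℕ × ℕ)) (v : ℕ) : Option ℕ :=
  if h : ∃ y, (y, v) ∈ A then some h.choose else none

theorem leftEnd_eq_some {n : ℕ} {A : Set (ℕ × ℕ)} (hA : IsBraid n A) {y v : ℕ} :
    leftEnd A v = some y ↔ (y, v) ∈ A := by
  unfold leftEnd
  split_ifs with h
  · rw [Option.some_inj]
    constructor
    · rintro rfl; exact h.choose_spec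
    · intro hy
      exact congrArg Prod.fst (hA.2.2 _ h.choose_spec _ hy rfl)
  · exact ⟨by simp, fun hy => absurd ⟨y, hy⟩ h⟩

/-- The tableaux of a braid over `[n]`, at the even times from the last to the first. -/
def backTab (A : Set (ℕ × ℕ)) (F n : ℕ) : ℕ → ℕ → Finset ℕ
  | 0 => fun _ => ∅
  | j + 1 => eraseEntry (n - j) (undoRemoval F (leftEnd A (n - j)) (backTab A F n j))

/-- The tableau `T` contains the left ends of the arcs of `A` with property `p`, and it is the
tableau of the word that lists them by decreasing right ends. -/
def Tracks (A : Set (ℕ × ℕ)) (T : ℕ → Finset ℕ) (p : ℕ → ℕ → Prop) : Prop :=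
  IsTab T ∧ ∃ w : List ℕ, IsTabOf T w ∧ w.Nodup ∧ (∀ e, e ∈ w ↔ ∃ c, (e, c) ∈ A ∧ p e c) ∧
    w.Pairwise (fun e e' => ∀ c c', (e, c) ∈ A → (e', c') ∈ A → c' < c) ∧
    ∀ e, (∃ s, e ∈ T s) ↔ e ∈ w

/-- In the word the right ends decrease. A decreasing subsequence, read backwards with `Fin.rev`,
therefore has increasing left ends and increasing right ends. -/
theorem Tracks.exists_crossing {A : Set (ℕ × ℕ)} {T : ℕ → Finset ℕ} {p : ℕ → ℕ → Prop}
    (h : Tracks A T p) {r : ℕ} (hr : (T (r + 1)).Nonempty) :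
    ∃ a b : Fin (r + 1) → ℕ, StrictMono a ∧ StrictMono b ∧
      ∀ i, (a i, b i) ∈ A ∧ p (a i) (b i) := by
  obtain ⟨-, w, h1, h2, h3, h4, -⟩ := h
  obtain ⟨l, hl, hlen⟩ := (h1.row_nonempty_iff r).mp hr
  have hmem : ∀ i : Fin (r + 1), l.get (Fin.cast hlen.symm i.rev) ∈ w := fun i =>
    hl.1.subset (List.get_mem _ _)
  choose b hb using fun i => (h3 _).mp (hmem i)
  refine ⟨fun i => l.get (Fin.cast hlen.symm i.rev), b, fun i j hij => ?_, fun i j hij => ?_, hb⟩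
  · have := List.pairwise_iff_get.mp hl.2 (Fin.cast hlen.symm j.rev) (Fin.cast hlen.symm i.rev)
      (by rw [Fin.lt_def] at hij ⊢; simp; omega)
    exact this
  · have := List.pairwise_iff_get.mp (h4.sublist hl.1) (Fin.cast hlen.symm j.rev)
      (Fin.cast hlen.symm i.rev) (by rw [Fin.lt_def] at hij ⊢; simp; omega)
    exact this _ _ (hb j).1 (hb i).1

theorem Tracks.nonempty {A : Set (ℕ × ℕ)} {T : ℕ → Finset ℕ} {p : ℕ → ℕ → Prop}
    (h : Tracks A T p) {r : ℕ} {a b : Fin (r + 1) → ℕ} (ha : StrictMono a) (hb : StrictMono b)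
    (hab : ∀ i, (a i, b i) ∈ A ∧ p (a i) (b i)) : (T (r + 1)).Nonempty := by
  classical
  obtain ⟨-, w, h1, h2, h3, h4, -⟩ := h
  refine (h1.row_nonempty_iff r).mpr ⟨w.filter fun e => e ∈ Set.range a,
    ⟨List.filter_sublist, ?_⟩, ?_⟩
  · refine ((h4.filter _).imp_of_mem ?_)
    intro e e' he he' hlt
    rw [List.mem_filter, decide_eq_true_eq] at he he'
    obtain ⟨-, i, rfl⟩ := he
    obtain ⟨-, j, rfl⟩ := he'
    have := hlt _ _ (hab i).1 (hab j).1
    exact ha (hb.lt_iff_lt.mp this)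
  · rw [← List.toFinset_card_of_nodup (h2.filter _)]
    have : (w.filter fun e => e ∈ Set.range a).toFinset = Finset.univ.image a := by
      ext e
      simp only [List.mem_toFinset, List.mem_filter, decide_eq_true_eq, Finset.mem_image,
        Finset.mem_univ, true_and, Set.mem_range]
      constructor
      · exact fun h => h.2
      · rintro ⟨i, rfl⟩
        exact ⟨(h3 _).mpr ⟨b i, hab i⟩, i, rfl⟩
    rw [this, Finset.card_image_of_injective _ ha.injective, Finset.card_univ, Fintype.card_fin]

/-- Otherwise there would be `F + 1` distinct left ends in `[n]`. This supplies the empty row that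
row insertion with bound `F` needs. -/
theorem Tracks.row_eq_empty {n : ℕ} {A : Set (ℕ × ℕ)} (hA : IsBraid n A) {T : ℕ → Finset ℕ}
    {p : ℕ → ℕ → Prop} (h : Tracks A T p) {F : ℕ} (hF : n ≤ F) : T (F + 1) = ∅ := by
  by_contra hne
  obtain ⟨a, b, ha, -, hab⟩ := h.exists_crossing (Finset.nonempty_iff_ne_empty.mpr hne)
  have hc : (Finset.univ.image a).card ≤ (Finset.Icc 1 n).card := by
    apply Finset.card_le_card
    intro e he
    obtain ⟨i, -, rfl⟩ := Finset.mem_image.mp he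
    have := hA.1 _ (hab i).1
    dsimp only at this
    rw [Finset.mem_Icc]; omega
  rw [Finset.card_image_of_injective _ ha.injective, Finset.card_univ, Fintype.card_fin,
    Nat.card_Icc] at hc
  omega

/-- The arc that ends at `v` has a smaller right end than all arcs listed so far, so its left end
belongs at the end of the word, which is where row insertion puts it. -/
theorem Tracks.undoRemoval {n : ℕ} {A : Set (ℕ × ℕ)} (hA : IsBraid n A) {T : ℕ → Finset ℕ}
    {v F : ℕ} (h : Tracks A T fun e c => e ≤ v ∧ v < c) (hF : n ≤ F) :
    Tracks A (undoRemoval F (leftEnd A v) T) fun e c => e ≤ v ∧ v ≤ c := by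
  have hE := h.row_eq_empty hA hF
  obtain ⟨hT, w, h1, h2, h3, h4, h5⟩ := h
  cases ho : leftEnd A v with
  | none =>
    refine ⟨hT, w, h1, h2, fun e => ?_, h4, h5⟩
    rw [h3]
    constructor
    · rintro ⟨c, hc, h6, h7⟩; exact ⟨c, hc, h6, h7.le⟩
    · rintro ⟨c, hc, h6, h7⟩
      refine ⟨c, hc, h6, lt_of_le_of_ne h7 ?_⟩
      rintro rfl
      rw [(leftEnd_eq_some hA).mpr hc] at ho
      simp at ho
  | some y =>
    have hy := (leftEnd_eq_some hA).mp ho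
    have hyw : y ∉ w := fun hyw => by
      obtain ⟨c, hc, -, h6⟩ := (h3 y).mp hyw
      have := congrArg Prod.snd (hA.2.1 _ hc _ hy rfl)
      dsimp only at this
      omega
    have hyT : ∀ s, y ∉ T s := fun s hs => hyw ((h5 y).mp ⟨s, hs⟩)
    obtain ⟨q, -, -, a3, a4, a5⟩ := removeRow_insertRow F hT hyT hE
    obtain ⟨-, -, -, a6, -⟩ := removeRow_spec a3 a4
    rw [a5] at a6
    refine ⟨a3, w ++ [y], h1.insertRow hyw hE, ?_, fun e => ?_, ?_, fun e => ?_⟩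
    · exact List.nodup_append.mpr ⟨h2, List.nodup_singleton _, fun a ha b hb => by
        rw [List.mem_singleton.mp hb]; rintro rfl; exact hyw ha⟩
    · rw [List.mem_append, h3, List.mem_singleton]
      constructor
      · rintro (⟨c, hc, h6, h7⟩ | rfl)
        · exact ⟨c, hc, h6, h7.le⟩
        · exact ⟨v, hy, (hA.1 _ hy).2.1, le_rfl⟩
      · rintro ⟨c, hc, h6, h7⟩
        rcases h7.eq_or_lt with rfl | h7
        · exact Or.inr (congrArg Prod.fst (hA.2.2 _ hc _ hy rfl))
        · exact Or.inl ⟨c, hc, h6, h7⟩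
    · rw [List.pairwise_append]
      refine ⟨h4, List.pairwise_singleton _ _, fun e he e' he' c c' hc hc' => ?_⟩
      rw [List.mem_singleton.mp he'] at hc'
      have e1 := congrArg Prod.snd (hA.2.1 _ hc' _ hy rfl)
      obtain ⟨d, hd, -, h6⟩ := (h3 e).mp he
      have e2 := congrArg Prod.snd (hA.2.1 _ hc _ hd rfl)
      dsimp only at e1 e2
      omega
    · have := a6 e
      rw [h5] at this
      rw [List.mem_append, List.mem_singleton]
      change (∃ s, e ∈ (insertRow F 0 T y).1 s) ↔ _
      rw [← this]
      tauto

/-- All listed left ends are at most `v + 1`, so this deletes the largest entry of the tableau and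
of the word; the arc that starts at `v + 1` is not over `v`. -/
theorem Tracks.eraseEntry {A : Set (ℕ × ℕ)} {T : ℕ → Finset ℕ} {v : ℕ}
    (h : Tracks A T fun e c => e ≤ v + 1 ∧ v + 1 ≤ c) :
    Tracks A (eraseEntry (v + 1) T) fun e c => e ≤ v ∧ v < c := by
  obtain ⟨hT, w, h1, h2, h3, h4, h5⟩ := h
  have hle : ∀ e ∈ w, e ≤ v + 1 := fun e he => by
    obtain ⟨c, -, h6, -⟩ := (h3 e).mp he; exact h6
  refine ⟨hT.eraseEntry fun r z hz => hle z ((h5 z).mp ⟨r, hz⟩), w.erase (v + 1),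
    h1.eraseEntry hle, h2.erase _, fun e => ?_, h4.sublist List.erase_sublist, fun e => ?_⟩
  · rw [h2.mem_erase_iff, h3]
    constructor
    · rintro ⟨hne, c, hc, h6, h7⟩; exact ⟨c, hc, by omega, by omega⟩
    · rintro ⟨c, hc, h6, h7⟩; exact ⟨by omega, c, hc, by omega, by omega⟩
  · rw [h2.mem_erase_iff, ← h5]
    simp only [_root_.eraseEntry, Finset.mem_erase]
    constructor
    · rintro ⟨s, h6, h7⟩; exact ⟨h6, s, h7⟩
    · rintro ⟨h6, s, h7⟩; exact ⟨s, h6, h7⟩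

theorem tracks_backTab {n : ℕ} {A : Set (ℕ × ℕ)} (hA : IsBraid n A)
    {F : ℕ} (hF : n ≤ F) {j v : ℕ} (hv : v + j = n) :
    Tracks A (backTab A F n j) fun e c => e ≤ v ∧ v < c := by
  induction j generalizing v with
  | zero =>
    refine ⟨isTab_empty, [], isTabOf_empty, List.nodup_nil, fun e => ?_, List.Pairwise.nil,
      fun e => by simp [backTab]⟩
    simp only [List.not_mem_nil, false_iff]
    rintro ⟨c, hc, -, h⟩
    have := hA.1 _ hc
    dsimp only at this
    omega
  | succ j ih =>
    have e : n - j = v + 1 := by omega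
    rw [backTab, e]
    exact ((ih (v := v + 1) (by omega)).undoRemoval hA hF).eraseEntry

end

noncomputable section

/-! ## The braid of a walk -/

/-- The entry that is removed at the vertex `v + 1` of a walk. -/
def removedAt {k : ℕ} (X : ℕ → Rows k) (v : ℕ) : Option ℕ :=
  (tableauStep (v + 1) (X (2 * v)) (X (2 * v + 1)) (tableauAt X (2 * v))).2 <|>
    (tableauStep (v + 1) (X (2 * v + 1)) (X (2 * v + 2)) (tableauAt X (2 * v + 1))).2

theorem tableauAt_odd {k : ℕ} (X : ℕ → Rows k) (v : ℕ) : tableauAt X (2 * v + 1) =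
    (tableauStep (v + 1) (X (2 * v)) (X (2 * v + 1)) (tableauAt X (2 * v))).1 := by
  rw [tableauAt, show 2 * v / 2 = v by omega]

theorem tableauAt_even {k : ℕ} (X : ℕ → Rows k) (v : ℕ) : tableauAt X (2 * v + 2) =
    (tableauStep (v + 1) (X (2 * v + 1)) (X (2 * v + 2)) (tableauAt X (2 * v + 1))).1 := by
  rw [tableauAt, show (2 * v + 1) / 2 = v by omega]

/-- The tableaux of a walk up to the vertex `v` have the shapes of the walk. -/
structure WalkTab {k : ℕ} (X : ℕ → Rows k) (v : ℕ) : Prop where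
  isTab : IsTab (tableauAt X (2 * v))
  few : FewRows k (tableauAt X (2 * v))
  shape : shapeOf k (tableauAt X (2 * v)) = X (2 * v)
  entries : ∀ r, ∀ z ∈ tableauAt X (2 * v) r, 1 ≤ z ∧ z ≤ v

theorem WalkTab.step {k n F : ℕ} (hF : k ≤ F) {X : ℕ → Rows k} {lam nu : Rows k}
    (hX : X ∈ loopFreeWalks k n lam nu) {v : ℕ} (hv : v < n) (h : WalkTab X v) :
    VertexStep k F (v + 1) (tableauAt X (2 * v)) (tableauAt X (2 * v + 1))
      (tableauAt X (2 * v + 2)) (removedAt X v) ∧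
    ((tableauStep (v + 1) (X (2 * v)) (X (2 * v + 1)) (tableauAt X (2 * v))).2 = none ∨
      (tableauStep (v + 1) (X (2 * v + 1)) (X (2 * v + 2)) (tableauAt X (2 * v + 1))).2 = none) ∧
    shapeOf k (tableauAt X (2 * v + 1)) = X (2 * v + 1) ∧ WalkTab X (v + 1) := by
  obtain ⟨-, -, ha, -, hm⟩ := hX
  obtain ⟨T1, T2, o1, o2, e1, e2, ho, s1, s2, hs⟩ := vertexStep_of_move hF (ha _) (ha _) (hm v hv)
    h.isTab h.few h.shape (v := v + 1) fun r z hz => by have := h.entries r z hz; omega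
  have f1 : tableauAt X (2 * v + 1) = T1 := by rw [tableauAt_odd, e1]
  have f2 : tableauAt X (2 * v + 2) = T2 := by rw [tableauAt_even, f1, e2]
  have f3 : removedAt X v = (o1 <|> o2) := by rw [removedAt, f1, e1, e2]
  refine ⟨by rw [f1, f2, f3]; exact hs, by rw [f1, e1, e2]; exact ho, by rw [f1, s1], ?_⟩
  have f4 : tableauAt X (2 * (v + 1)) = T2 := f2
  refine ⟨by rw [f4]; exact hs.isTab, by rw [f4]; exact hs.few, by rw [f4, s2]; rfl, ?_⟩
  rw [f4]
  intro r z hz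
  rcases hs.new r z hz with rfl | ⟨q, hq⟩
  · omega
  · have := h.entries q z hq; omega

theorem walkTab {k n : ℕ} {X : ℕ → Rows k} {nu : Rows k} (hX : X ∈ loopFreeWalks k n 0 nu)
    {v : ℕ} (hv : v ≤ n) : WalkTab X v := by
  induction v with
  | zero =>
    refine ⟨isTab_empty, fun _ _ => rfl, ?_, fun r z hz => by simp [tableauAt] at hz⟩
    rw [hX.1]
    funext r
    simp [shapeOf, tableauAt]
  | succ v ih => exact ((ih (by omega)).step le_rfl hX (by omega)).2.2.2

theorem mem_walkToBraid {k n : ℕ} {X : ℕ → Rows k} {nu : Rows k}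
    (hX : X ∈ loopFreeWalks k n 0 nu) {y c : ℕ} :
    (y, c) ∈ walkToBraid n X ↔ ∃ v < n, c = v + 1 ∧ removedAt X v = some y := by
  constructor
  · rintro ⟨i, hi, hc, hy⟩
    refine ⟨i / 2, by omega, hc, ?_⟩
    have hstep := ((walkTab hX (v := i / 2) (by omega)).step le_rfl hX (by omega)).2.1
    rcases Nat.even_or_odd' i with ⟨v, rfl | rfl⟩
    · rw [show 2 * v / 2 = v by omega] at *
      rw [removedAt, hy]; rfl
    · rw [show (2 * v + 1) / 2 = v by omega] at *
      rcases hstep with h | h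
      · rw [removedAt, h, hy]; rfl
      · rw [hy] at h; simp at h
  · rintro ⟨v, hv, rfl, hy⟩
    rw [removedAt] at hy
    cases h1 : (tableauStep (v + 1) (X (2 * v)) (X (2 * v + 1)) (tableauAt X (2 * v))).2 with
    | some z =>
      rw [h1] at hy
      refine ⟨2 * v, by omega, by dsimp only; omega, ?_⟩
      rw [show 2 * v / 2 = v by omega, h1]
      exact hy
    | none =>
      rw [h1] at hy
      refine ⟨2 * v + 1, by omega, by dsimp only; omega, ?_⟩
      rw [show (2 * v + 1) / 2 = v by omega]
      exact hy

theorem isBraid_walkToBraid {k n : ℕ} {X : ℕ → Rows k} {nu : Rows k}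
    (hX : X ∈ loopFreeWalks k n 0 nu) :
    IsBraid n (walkToBraid n X) ∧ ∀ a ∈ walkToBraid n X, a.1 < a.2 := by
  have hstep := fun v (hv : v < n) => ((walkTab hX hv.le).step le_rfl hX hv).1
  -- A removed entry never returns: entries come in as numbers of vertices, and all later vertices
  -- exceed it.
  have gone : ∀ y v, v < n → removedAt X v = some y → ∀ u, v < u → u ≤ n →
      ∀ s, y ∉ tableauAt X (2 * u) s := by
    intro y v hv hy u hu
    induction u, hu using Nat.le_induction with
    | base => exact fun _ => ((hstep v hv).old y hy).2
    | succ u hu ih =>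
      intro hun s hs
      have h1 := ih (by omega)
      rcases (hstep u (by omega)).new s y hs with rfl | ⟨r, hr⟩
      · obtain ⟨⟨r, hr⟩, -⟩ := (hstep v hv).old _ hy
        have := (walkTab hX hv.le).entries r _ hr
        omega
      · exact h1 r hr
  have bound : ∀ y v, v < n → removedAt X v = some y → 1 ≤ y ∧ y ≤ v := by
    intro y v hv hy
    obtain ⟨⟨r, hr⟩, -⟩ := (hstep v hv).old _ hy
    exact (walkTab hX hv.le).entries r _ hr
  refine ⟨⟨?_, ?_, ?_⟩, ?_⟩
  · rintro ⟨y, c⟩ h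
    obtain ⟨v, hv, rfl, hy⟩ := (mem_walkToBraid hX).mp h
    have := bound y v hv hy
    dsimp only
    omega
  · rintro ⟨y, c⟩ h ⟨y', c'⟩ h' e
    dsimp only at e
    subst e
    obtain ⟨v, hv, rfl, hy⟩ := (mem_walkToBraid hX).mp h
    obtain ⟨v', hv', rfl, hy'⟩ := (mem_walkToBraid hX).mp h'
    rcases lt_trichotomy v v' with hlt | rfl | hlt
    · obtain ⟨⟨r, hr⟩, -⟩ := (hstep v' hv').old _ hy'
      exact absurd hr (gone y v hv hy v' hlt hv'.le r)
    · rfl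
    · obtain ⟨⟨r, hr⟩, -⟩ := (hstep v hv).old _ hy
      exact absurd hr (gone y v' hv' hy' v hlt hv.le r)
  · rintro ⟨y, c⟩ h ⟨y', c'⟩ h' e
    dsimp only at e
    subst e
    obtain ⟨v, hv, rfl, hy⟩ := (mem_walkToBraid hX).mp h
    obtain ⟨v', hv', e, hy'⟩ := (mem_walkToBraid hX).mp h'
    have e : v = v' := by omega
    subst e
    rw [hy] at hy'
    rw [Option.some_inj.mp hy']
  · rintro ⟨y, c⟩ h
    obtain ⟨v, hv, rfl, hy⟩ := (mem_walkToBraid hX).mp h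
    have := bound y v hv hy
    dsimp only
    omega

theorem leftEnd_walkToBraid {k n : ℕ} {X : ℕ → Rows k} {nu : Rows k}
    (hX : X ∈ loopFreeWalks k n 0 nu) {v : ℕ} (hv : v < n) :
    leftEnd (walkToBraid n X) (v + 1) = removedAt X v := by
  apply Option.ext
  intro y
  rw [leftEnd_eq_some (isBraid_walkToBraid hX).1, mem_walkToBraid hX]
  constructor
  · rintro ⟨v', -, e, h⟩
    rw [Nat.add_right_cancel e]; exact h
  · exact fun h => ⟨v, hv, rfl, h⟩

/-- Induction from the end, where the shape and hence the tableau is empty: the braid tells what was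
removed at each vertex, and `VertexStep.back` undoes the vertex. The tableaux of a walk thus depend
on its braid only. -/
theorem tableauAt_eq_backTab {k n F : ℕ} (hF : k ≤ F) {X : ℕ → Rows k}
    (hX : X ∈ loopFreeWalks k n 0 0) {j v : ℕ} (hv : v + j = n) :
    tableauAt X (2 * v) = backTab (walkToBraid n X) F n j := by
  induction j generalizing v with
  | zero =>
    obtain rfl : v = n := by omega
    have h := walkTab hX le_rfl
    have hs := h.shape
    rw [hX.2.1] at hs
    funext s
    rcases Nat.eq_zero_or_pos s with rfl | hpos
    · exact h.isTab.zero
    · by_cases hk : s < k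
      · have := congrFun hs ⟨s - 1, by omega⟩
        simp only [shapeOf, Nat.sub_add_cancel hpos] at this
        exact Finset.card_eq_zero.mp this
      · exact h.few s (by omega)
  | succ j ih =>
    have h1 := ((walkTab hX (v := v) (by omega)).step hF hX (by omega)).1.back
    rw [h1, backTab, show n - j = v + 1 by omega, leftEnd_walkToBraid hX (by omega),
      ← ih (v := v + 1) (by omega)]
    rfl

/-- At the smallest right end `b 0` of a crossing, all its arcs satisfy a i ≤ b 0 ≤ b j. The tableau
after the insertion at this vertex, before the deletion, would have `k` rows; but it is one of the
tableaux of the walk. -/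
theorem walkToBraid_mem {k n : ℕ} (hk : 2 ≤ k) {X : ℕ → Rows k}
    (hX : X ∈ loopFreeWalks k n 0 0) : walkToBraid n X ∈ loopFreeBraids k n := by
  obtain ⟨hA, hlt⟩ := isBraid_walkToBraid hX
  refine ⟨hA, fun i hi => lt_irrefl _ (hlt _ hi), ?_⟩
  rintro ⟨a, b, ha, hb, hab, h⟩
  obtain ⟨r, rfl⟩ : ∃ r, k = r + 1 := ⟨k - 1, by omega⟩
  have hb0 := hA.1 _ (h 0)
  dsimp only at hb0
  obtain ⟨v, hv⟩ : ∃ v, b 0 = v + 1 := ⟨b 0 - 1, by omega⟩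
  have hvn : v < n := by omega
  have hT := (tracks_backTab hA (F := n + (r + 1)) (by omega) (j := n - (v + 1)) (v := v + 1)
    (by omega)).undoRemoval hA (F := n + (r + 1)) (by omega)
  have hne := hT.nonempty ha hb fun i => ⟨h i, hv ▸ hab i 0,
    hv ▸ hb.monotone (Fin.zero_le i)⟩
  rw [leftEnd_walkToBraid hX hvn, ← tableauAt_eq_backTab (F := n + (r + 1)) (by omega) hX
    (j := n - (v + 1)) (v := v + 1) (by omega)] at hne
  have hw := walkTab hX (v := v) (by omega)
  have hs := (hw.step (F := n + (r + 1)) (by omega) hX (by omega)).1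
  have : undoRemoval (n + (r + 1)) (removedAt X v) (tableauAt X (2 * (v + 1))) (r + 1) = ∅ := by
    rcases hs.undo with e | e | e
    · exact (congrFun e _).trans (hw.few _ le_rfl)
    · exact (congrFun e _).trans (hs.few_mid _ le_rfl)
    · exact (congrFun e _).trans (hs.few _ le_rfl)
  rw [this] at hne
  exact Finset.not_nonempty_empty hne

theorem walkToBraid_injOn (k n : ℕ) :
    Set.InjOn (walkToBraid n) (loopFreeWalks k n 0 0) := by
  intro X hX Y hY h
  have even : ∀ v ≤ n, tableauAt X (2 * v) = tableauAt Y (2 * v) := fun v hv => by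
    rw [tableauAt_eq_backTab le_rfl hX (Nat.add_sub_cancel' hv),
      tableauAt_eq_backTab le_rfl hY (Nat.add_sub_cancel' hv), h]
  have evenX : ∀ v ≤ n, X (2 * v) = Y (2 * v) := fun v hv => by
    rw [← (walkTab hX hv).shape, ← (walkTab hY hv).shape, even v hv]
  funext i
  rcases Nat.lt_or_ge i (2 * n) with hi | hi
  · rcases Nat.even_or_odd' i with ⟨v, rfl | rfl⟩
    · exact evenX v (by omega)
    · obtain ⟨x1, -, x2, -⟩ := (walkTab hX (v := v) (by omega)).step le_rfl hX (by omega)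
      obtain ⟨y1, -, y2, -⟩ := (walkTab hY (v := v) (by omega)).step le_rfl hY (by omega)
      rw [← x2, ← y2, x1.mid, y1.mid, ← leftEnd_walkToBraid hX (by omega),
        ← leftEnd_walkToBraid hY (by omega), h]
      have := even (v + 1) (by omega)
      rw [show 2 * (v + 1) = 2 * v + 2 by ring] at this
      rw [this]
  · rw [hX.2.2.2.1 i hi, hY.2.2.2.1 i hi]
    exact evenX n le_rfl

/-- Converse of `vertexStep_of_move`: the tableaux that are computed backwards from a braid are
joined by an allowed move, and the forward algorithm passes through them and reports the left end
again. -/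
theorem move_of_undoRemoval {k F n v : ℕ} {A : Set (ℕ × ℕ)} (hA : IsBraid n A)
    (hl : ∀ i, (i, i) ∉ A) {T : ℕ → Finset ℕ} (hF : n ≤ F)
    (hT : Tracks A T fun e c => e ≤ v ∧ v < c) (hf : FewRows k T)
    (hfu : FewRows k (undoRemoval F (leftEnd A v) T)) :
    let T0 := eraseEntry v (undoRemoval F (leftEnd A v) T)
    let T1 := midTab F v (leftEnd A v) T
    IsTab T1 ∧ LoopFreeMove (shapeOf k T0) (shapeOf k T1) (shapeOf k T) ∧
      ∃ o1 o2, tableauStep v (shapeOf k T0) (shapeOf k T1) T0 = (T1, o1) ∧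
        tableauStep v (shapeOf k T1) (shapeOf k T) T1 = (T, o2) ∧ (o1 <|> o2) = leftEnd A v := by
  have hE := hT.row_eq_empty hA hF
  have hU := hT.undoRemoval hA hF
  obtain ⟨hTab, w, -, -, h3, -, h5⟩ := hT
  obtain ⟨hUTab, w', -, -, h3', -, h5'⟩ := hU
  have hle : ∀ s z, z ∈ undoRemoval F (leftEnd A v) T s → z ≤ v := fun s z hz => by
    obtain ⟨c, -, h, -⟩ := (h3' z).mp ((h5' z).mp ⟨s, hz⟩); exact h
  have hzero : ∀ (S : ℕ → Finset ℕ), IsTab S → FewRows k S → ∀ s, v ∈ S s →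
      ∃ j : Fin (k - 1), s = j + 1 := by
    intro S hS hfS s hs
    have h1 : s ≠ 0 := by rintro rfl; rw [hS.zero] at hs; simp at hs
    have h2 : s < k := by
      by_contra h; rw [hfS s (by omega)] at hs; simp at hs
    exact ⟨⟨s - 1, by omega⟩, by simp; omega⟩
  have hadd : ∀ (S : ℕ → Finset ℕ), IsTab S → ∀ j : Fin (k - 1), v ∈ S (j + 1) →
      shapeOf k S = shapeOf k (eraseEntry v S) + box j ∧
        tableauStep v (shapeOf k (eraseEntry v S)) (shapeOf k S) (eraseEntry v S) = (S, none) := by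
    intro S hS j hj
    have e := update_eraseEntry hS hj
    have h1 := shapeOf_update (k := k) (v := v) (T := eraseEntry v S) j (by simp [eraseEntry])
    rw [e] at h1
    refine ⟨h1, ?_⟩
    conv_lhs => rw [h1, tableauStep_add, e]
  cases ho : leftEnd A v with
  | none =>
    rw [ho] at hle hUTab
    simp only [undoRemoval, midTab] at *
    by_cases hv : ∃ s, v ∈ T s
    · obtain ⟨s, hs⟩ := hv
      obtain ⟨j, rfl⟩ := hzero T hTab hf s hs
      obtain ⟨e1, e2⟩ := hadd T hTab j hs
      exact ⟨hTab.eraseEntry hle, Or.inr (Or.inl ⟨rfl, j, e1⟩), none, none,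
        tableauStep_stay .., e2, rfl⟩
    · push Not at hv
      rw [eraseEntry_of_notMem hv]
      exact ⟨hTab, Or.inr (Or.inr (Or.inl ⟨rfl, rfl⟩)), none, none, tableauStep_stay ..,
        tableauStep_stay .., rfl⟩
  | some y =>
    rw [ho] at hle hUTab hfu h5'
    have hy := (leftEnd_eq_some hA).mp ho
    have hyv : y < v := lt_of_le_of_ne (hA.1 _ hy).2.1 (by rintro rfl; exact hl _ hy)
    have hyT : ∀ s, y ∉ T s := fun s hs => by
      obtain ⟨c, hc, -, h6⟩ := (h3 y).mp ((h5 y).mp ⟨s, hs⟩)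
      have := congrArg Prod.snd (hA.2.1 _ hc _ hy rfl)
      dsimp only at this
      omega
    obtain ⟨q, -, -, a3, a4, a5⟩ := removeRow_insertRow F hTab hyT hE
    obtain ⟨-, -, -, a6, a7, a8⟩ := removeRow_spec a3 a4
    simp only [undoRemoval, midTab] at *
    set U := (insertRow F 0 T y).1 with hU
    have hq : q < k - 1 := by
      by_contra h
      rw [hfu (q + 1) (by omega)] at a4
      simp at a4
    have hsh := shapeOf_removeRow (k := k) a3 (j := ⟨q, hq⟩) a4
    have hst := tableauStep_remove v (shapeOf k T) ⟨q, hq⟩ U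
    simp only [a5] at hsh hst a6
    rw [← hsh] at hst
    by_cases hv : ∃ s, v ∈ T s
    · rw [if_pos hv]
      obtain ⟨s, hs⟩ : ∃ s, v ∈ U s := (a6 v).mp (Or.inr hv)
      obtain ⟨j, rfl⟩ := hzero U a3 hfu s hs
      obtain ⟨e1, e2⟩ := hadd U a3 j hs
      refine ⟨a3, Or.inr (Or.inr (Or.inr ⟨j, ⟨q, hq⟩, e1, hsh, ?_⟩)), none, some y, e2, hst, rfl⟩
      -- If both squares were in row 1, its last entry would be `v` and would be the one that
      -- leaves; but the entry that leaves is y < v, as the braid has no loops.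
      rintro ⟨hj, hq0⟩
      dsimp only at hq0
      subst hq0
      have hsup : (U 1).sup id = v := by
        rw [hj] at hs
        exact le_antisymm (Finset.sup_le fun z hz => hle _ z hz) (Finset.le_sup (f := id) hs)
      have : removeRow 0 U = (_, (U 1).sup id) := rfl
      rw [a5, hsup] at this
      have := congrArg Prod.snd this
      dsimp only at this
      omega
    · rw [if_neg hv]
      have hvU : ∀ s, v ∉ U s := fun s hs => by
        rcases (a6 v).mpr ⟨s, hs⟩ with h | h
        · omega
        · exact hv h
      rw [eraseEntry_of_notMem hvU]
      exact ⟨hTab, Or.inl ⟨_, hsh, rfl⟩, some y, none, hst, tableauStep_stay .., rfl⟩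

/-- The walk consists of the shapes of the tableaux computed backwards from the braid. A `k`-th row
would be a `k`-crossing over some vertex, so these are shapes with at most `k - 1` rows. A forward
induction shows that the algorithm meets the same tableaux and reports the arcs of the braid. -/
theorem walkToBraid_surjOn {k : ℕ} (hk : 2 ≤ k) (n : ℕ) :
    Set.SurjOn (walkToBraid n) (loopFreeWalks k n 0 0) (loopFreeBraids k n) := by
  rintro A ⟨hA, hl, hcross⟩
  set F := n + k with hF
  have hfew : ∀ (T : ℕ → Finset ℕ) (p : ℕ → ℕ → Prop) (v : ℕ), Tracks A T p →
      (∀ e c, p e c → e ≤ v ∧ v ≤ c) → FewRows k T := by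
    intro T p v hT hp
    obtain ⟨r, rfl⟩ : ∃ r, k = r + 1 := ⟨k - 1, by omega⟩
    apply hT.1.fewRows
    by_contra hne
    obtain ⟨a, b, ha, hb, h⟩ := hT.exists_crossing (Finset.nonempty_iff_ne_empty.mpr hne)
    exact hcross ⟨a, b, ha, hb, fun i j => (hp _ _ (h i).2).1.trans (hp _ _ (h j).2).2,
      fun i => (h i).1⟩
  set E : ℕ → ℕ → Finset ℕ := fun v => backTab A F n (n - v) with hEdef
  have hE : ∀ v ≤ n, Tracks A (E v) fun e c => e ≤ v ∧ v < c := fun v hv =>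
    tracks_backTab hA (by omega) (by omega)
  have hEf : ∀ v ≤ n, FewRows k (E v) := fun v hv =>
    hfew _ _ v (hE v hv) fun e c h => ⟨h.1, h.2.le⟩
  have hU : ∀ v ≤ n, FewRows k (undoRemoval F (leftEnd A v) (E v)) := fun v hv =>
    hfew _ _ v ((hE v hv).undoRemoval hA (by omega)) fun e c h => h
  have hback : ∀ v < n, E v = eraseEntry (v + 1) (undoRemoval F (leftEnd A (v + 1)) (E (v + 1))) := by
    intro v hv
    simp only [hEdef]
    rw [show n - v = (n - (v + 1)) + 1 by omega, backTab, show n - (n - (v + 1)) = v + 1 by omega]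
  have hmove := fun v (hv : v < n) => move_of_undoRemoval (k := k) hA hl (F := F) (by omega)
    (hE (v + 1) hv) (hEf (v + 1) hv) (hU (v + 1) hv)
  have hE0 : E 0 = fun _ => ∅ := by
    obtain ⟨-, w, -, -, h3, -, h5⟩ := hE 0 (Nat.zero_le n)
    funext s
    rw [Finset.eq_empty_iff_forall_notMem]
    intro z hz
    obtain ⟨c, hc, h, -⟩ := (h3 z).mp ((h5 z).mp ⟨s, hz⟩)
    have := hA.1 _ hc
    dsimp only at this
    omega
  have hEn : ∀ v, n ≤ v → E v = fun _ => ∅ := fun v hv => by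
    simp only [hEdef, Nat.sub_eq_zero_of_le hv]; rfl
  -- Even times carry the tableaux of the braid, odd times those in the middle of a vertex. From
  -- time `2 * n` on everything is empty, because walks have to be constant there.
  set T : ℕ → ℕ → Finset ℕ := fun i => if i % 2 = 0 ∨ 2 * n ≤ i then E (i / 2) else
    midTab F (i / 2 + 1) (leftEnd A (i / 2 + 1)) (E (i / 2 + 1)) with hTdef
  have hT0 : ∀ v, T (2 * v) = E v := fun v => by
    simp only [hTdef]
    rw [if_pos (Or.inl (by omega))]; congr 1; omega
  have hT2 : ∀ v, T (2 * v + 2) = E (v + 1) := fun v => hT0 (v + 1)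
  have hT1 : ∀ v < n, T (2 * v + 1) = midTab F (v + 1) (leftEnd A (v + 1)) (E (v + 1)) :=
    fun v hv => by
    simp only [hTdef]
    rw [if_neg (by omega), show (2 * v + 1) / 2 = v by omega]
  have hTn : ∀ i, 2 * n ≤ i → T i = fun _ => ∅ := fun i hi => by
    simp only [hTdef]
    rw [if_pos (Or.inr hi)]; exact hEn _ (by omega)
  have hTab : ∀ i, IsTab (T i) := fun i => by
    rcases Nat.lt_or_ge i (2 * n) with hi | hi
    · rcases Nat.even_or_odd' i with ⟨v, rfl | rfl⟩
      · rw [hT0]; exact (hE v (by omega)).1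
      · rw [hT1 v (by omega)]; exact (hmove v (by omega)).1
    · rw [hTn i hi]; exact isTab_empty
  set X : ℕ → Rows k := fun i => shapeOf k (T i) with hXdef
  have hempty : shapeOf k (fun _ => ∅) = 0 := by funext r; simp [shapeOf]
  have hX : X ∈ loopFreeWalks k n 0 0 := by
    refine ⟨?_, ?_, fun i => (hTab i).antitone_shapeOf k, fun i hi => ?_, fun v hv => ?_⟩
    · simp only [hXdef]
      rw [show T 0 = E 0 from hT0 0, hE0, hempty]
    · simp only [hXdef]
      rw [hTn _ le_rfl, hempty]
    · simp only [hXdef]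
      rw [hTn _ le_rfl, hTn _ hi]
    · have := (hmove v hv).2.1
      rw [← hback v hv] at this
      simp only [hXdef]
      rw [hT0, hT1 v hv, hT2]
      exact this
  have hsteps := fun v (hv : v < n) => (hmove v hv).2.2
  have htab : ∀ v ≤ n, tableauAt X (2 * v) = E v := by
    intro v
    induction v with
    | zero => exact fun _ => hE0.symm
    | succ v ih =>
      intro hv
      obtain ⟨o1, o2, e1, e2, -⟩ := hsteps v (by omega)
      rw [← hback v (by omega), ← hT1 v (by omega), ← hT0 v] at e1
      rw [← hT1 v (by omega), ← hT2 v] at e2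
      have f1 : tableauAt X (2 * v + 1) = T (2 * v + 1) := by
        rw [tableauAt_odd, ih (by omega), ← hT0 v, e1]
      change tableauAt X (2 * v + 2) = _
      rw [tableauAt_even, f1, e2, hT2]
  have hrem : ∀ v < n, removedAt X v = leftEnd A (v + 1) := by
    intro v hv
    obtain ⟨o1, o2, e1, e2, e3⟩ := hsteps v hv
    rw [← hback v hv, ← hT1 v hv, ← hT0 v] at e1
    rw [← hT1 v hv, ← hT2 v] at e2
    have f1 : tableauAt X (2 * v + 1) = T (2 * v + 1) := by
      rw [tableauAt_odd, htab v hv.le, ← hT0 v, e1]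
    rw [removedAt, f1, htab v hv.le, ← hT0 v, e1, e2]
    exact e3
  refine ⟨X, hX, ?_⟩
  ext ⟨y, c⟩
  rw [mem_walkToBraid hX]
  constructor
  · rintro ⟨v, hv, rfl, h⟩
    rw [hrem v hv] at h
    exact (leftEnd_eq_some hA).mp h
  · intro h
    have h1 := hA.1 _ h
    dsimp only at h1
    refine ⟨c - 1, by omega, by omega, ?_⟩
    rw [hrem _ (by omega), leftEnd_eq_some hA, Nat.sub_add_cancel (by omega)]
    exact h

theorem walkToBraid_bijOn {k : ℕ} (hk : 2 ≤ k) (n : ℕ) :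
    Set.BijOn (walkToBraid n) (loopFreeWalks k n 0 0) (loopFreeBraids k n) :=
  ⟨fun _ hX => walkToBraid_mem hk hX, walkToBraid_injOn k n, walkToBraid_surjOn hk n⟩

end

noncomputable section

/-! ## Running programs -/

/-- The memory after writing to a register. -/
def Memory.set (M : Memory) (x v : ℕ) : Memory := { M with reg := Function.update M.reg x v }

/-- The memory after writing to an array. -/
def Memory.put (M : Memory) (a i v : ℕ) : Memory :=
  { M with arr := Function.update M.arr a (Function.update (M.arr a) i v) }

@[simp] theorem Memory.set_reg (M : Memory) (x v y : ℕ) :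
    (M.set x v).reg y = if y = x then v else M.reg y := by
  simp [Memory.set, Function.update_apply]

@[simp] theorem Memory.set_arr (M : Memory) (x v : ℕ) : (M.set x v).arr = M.arr := rfl

@[simp] theorem Memory.put_reg (M : Memory) (a i v : ℕ) : (M.put a i v).reg = M.reg := rfl

theorem Memory.put_arr (M : Memory) (a i v b j : ℕ) :
    (M.put a i v).arr b j = if b = a ∧ j = i then v else M.arr b j := by
  simp only [Memory.put, Function.update_apply]
  by_cases h : b = a
  · subst h; by_cases h' : j = i <;> simp [h']
  · simp [h]

/-- The program `p` takes the memory `M` to `M'` in exactly `t` steps, without random draws. -/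
def Runs (S w : ℕ) (tab : ℕ → ℕ → ℕ) (p : Program) (M : Memory) (t : ℕ) (M' : Memory) : Prop :=
  ∀ rest n, runSteps S w tab (t + n) (some (p :: rest, M)) =
    runSteps S w tab n (some (rest, M'))

/-- The program `p` takes the memory `M` within `t` steps to one with the property `Q`. -/
def Reaches (S w : ℕ) (tab : ℕ → ℕ → ℕ) (p : Program) (t : ℕ) (Q : Memory → Prop)
    (M : Memory) : Prop :=
  ∃ s ≤ t, ∃ M', Runs S w tab p M s M' ∧ Q M'

/-- A sufficient condition for `Q` to hold after a run of a program without loops and random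
draws. -/
def Ensures (S w : ℕ) (tab : ℕ → ℕ → ℕ) : Program → (Memory → Prop) → Memory → Prop
  | .skip, Q, M => Q M
  | .const x c, Q, M => c < 2 ^ w ∧ Q (M.set x c)
  | .arith o x y z, Q, M =>
    o.eval (M.reg y) (M.reg z) < 2 ^ w ∧ Q (M.set x (o.eval (M.reg y) (M.reg z)))
  | .load x a y, Q, M =>
    M.reg y < S ∧ M.arr a (M.reg y) < 2 ^ w ∧ Q (M.set x (M.arr a (M.reg y)))
  | .fetch x a y, Q, M => tab a (M.reg y) < 2 ^ w ∧ Q (M.set x (tab a (M.reg y)))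
  | .store a y x, Q, M => M.reg y < S ∧ Q (M.put a (M.reg y) (M.reg x))
  | .random _ _, _, _ => False
  | .seq p q, Q, M => Ensures S w tab p (Ensures S w tab q Q) M
  | .cond x p q, Q, M => (M.reg x ≠ 0 → Ensures S w tab p Q M) ∧
      (M.reg x = 0 → Ensures S w tab q Q M)
  | .loop _ _, _, _ => False

/-- A bound for the running time of a program without loops. -/
def Program.cost : Program → ℕ
  | .seq p q => 1 + p.cost + q.cost
  | .cond _ p q => 1 + max p.cost q.cost
  | _ => 1

section

variable {S w : ℕ} {tab : ℕ → ℕ → ℕ}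

theorem runs_of_step {p : Program} {M M' : Memory} {t : ℕ} {l : List Program}
    (h : ∀ rest, stepProgram S w tab p rest M = PMF.pure (some (l ++ rest, M)))
    (hl : ∀ rest n, runSteps S w tab (t + n) (some (l ++ rest, M)) =
      runSteps S w tab n (some (rest, M'))) : Runs S w tab p M (1 + t) M' := by
  intro rest n
  rw [show 1 + t + n = (t + n) + 1 by ring, runSteps, stepConfig, h, PMF.pure_bind, hl]

theorem runs_of_step_one {p : Program} {M M' : Memory}
    (h : ∀ rest, stepProgram S w tab p rest M = PMF.pure (some (rest, M'))) :
    Runs S w tab p M 1 M' := by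
  intro rest n
  rw [show 1 + n = n + 1 by ring, runSteps, stepConfig, h, PMF.pure_bind]

theorem Reaches.mono {p : Program} {t t' : ℕ} {Q Q' : Memory → Prop} {M : Memory}
    (h : Reaches S w tab p t Q M) (ht : t ≤ t') (hQ : ∀ M', Q M' → Q' M') :
    Reaches S w tab p t' Q' M := by
  obtain ⟨s, hs, M', h1, h2⟩ := h
  exact ⟨s, hs.trans ht, M', h1, hQ _ h2⟩

theorem Reaches.seq {p q : Program} {t1 t2 : ℕ} {Q : Memory → Prop} {M : Memory}
    (h : Reaches S w tab p t1 (Reaches S w tab q t2 Q) M) :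
    Reaches S w tab (.seq p q) (1 + t1 + t2) Q M := by
  obtain ⟨s1, h1, M1, r1, s2, h2, M2, r2, hQ⟩ := h
  refine ⟨1 + (s1 + s2), by omega, M2, runs_of_step (l := [p, q]) (fun _ => rfl) ?_, hQ⟩
  intro rest n
  rw [add_assoc]
  exact (r1 _ _).trans (r2 _ _)

theorem Reaches.cond {x : ℕ} {p q : Program} {t : ℕ} {Q : Memory → Prop} {M : Memory}
    (h1 : M.reg x ≠ 0 → Reaches S w tab p t Q M) (h2 : M.reg x = 0 → Reaches S w tab q t Q M) :
    Reaches S w tab (.cond x p q) (1 + t) Q M := by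
  by_cases h : M.reg x = 0
  · obtain ⟨s, hs, M', r, hQ⟩ := h2 h
    exact ⟨1 + s, by omega, M', runs_of_step (l := [q]) (fun _ => by simp [stepProgram, h]) r, hQ⟩
  · obtain ⟨s, hs, M', r, hQ⟩ := h1 h
    exact ⟨1 + s, by omega, M', runs_of_step (l := [p]) (fun _ => by simp [stepProgram, h]) r, hQ⟩

/-- The invariant is indexed by the number of rounds that remain, which bounds the time as well: a
test and the body for each round, and the final test. -/
theorem Reaches.loop {x : ℕ} {p : Program} {t : ℕ} {Q : Memory → Prop} (I : ℕ → Memory → Prop)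
    (h1 : ∀ n M, I (n + 1) M → M.reg x ≠ 0 ∧ Reaches S w tab p t (I n) M)
    (h0 : ∀ M, I 0 M → M.reg x = 0 ∧ Q M) {n : ℕ} {M : Memory} (h : I n M) :
    Reaches S w tab (.loop x p) (n * (t + 1) + 1) Q M := by
  induction n generalizing M with
  | zero =>
    obtain ⟨e, hQ⟩ := h0 M h
    exact ⟨1, by omega, M, runs_of_step_one fun _ => by simp [stepProgram, e], hQ⟩
  | succ n ih =>
    obtain ⟨e, s1, h1, M1, r1, hI⟩ := h1 n M h
    obtain ⟨s2, h2, M2, r2, hQ⟩ := ih hI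
    refine ⟨1 + (s1 + s2), by nlinarith, M2, runs_of_step (l := [p, .loop x p])
      (fun _ => by simp [stepProgram, e]) ?_, hQ⟩
    intro rest n
    rw [add_assoc]
    exact (r1 _ _).trans (r2 _ _)

/-- `Ensures` is a precondition computed by recursion on the program, so a straight-line program is
verified by unfolding; a run takes at most `Program.cost` steps from any memory. -/
theorem Ensures.reaches {p : Program} {Q : Memory → Prop} {M : Memory}
    (h : Ensures S w tab p Q M) : Reaches S w tab p p.cost Q M := by
  induction p generalizing Q M with
  | skip => exact ⟨1, le_rfl, M, runs_of_step_one fun _ => rfl, h⟩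
  | const x c =>
    exact ⟨1, le_rfl, _, runs_of_step_one fun _ => by
      simp only [stepProgram, writeReg, if_pos h.1]; rfl, h.2⟩
  | arith o x y z =>
    exact ⟨1, le_rfl, _, runs_of_step_one fun _ => by
      simp only [stepProgram, writeReg, if_pos h.1]; rfl, h.2⟩
  | load x a y =>
    exact ⟨1, le_rfl, _, runs_of_step_one fun _ => by
      simp only [stepProgram, writeReg, if_pos h.1, if_pos h.2.1]; rfl, h.2.2⟩
  | fetch x a y =>
    exact ⟨1, le_rfl, _, runs_of_step_one fun _ => by
      simp only [stepProgram, writeReg, if_pos h.1]; rfl, h.2⟩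
  | store a y x =>
    exact ⟨1, le_rfl, _, runs_of_step_one fun _ => by
      simp only [stepProgram, if_pos h.1]; rfl, h.2⟩
  | random x y => exact h.elim
  | seq p q ihp ihq =>
    exact ((ihp h).mono le_rfl fun _ h' => ihq h').seq
  | cond x p q ihp ihq =>
    exact Reaches.cond (fun e => (ihp (h.1 e)).mono (le_max_left _ _) fun _ h => h)
      fun e => (ihq (h.2 e)).mono (le_max_right _ _) fun _ h => h
  | loop x p => exact h.elim

theorem runSteps_halted (n : ℕ) (M : Memory) :
    runSteps S w tab n (some ([], M)) = PMF.pure (some ([], M)) := by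
  induction n with
  | zero => rfl
  | succ n ih => rw [runSteps, stepConfig, PMF.pure_bind, ih]

theorem Reaches.execute {p : Program} {t N : ℕ} {Q : Memory → Prop}
    (h : Reaches S w tab p t Q (inputMemory N)) :
    ∃ M, Q M ∧ execute t S w tab p N = PMF.pure (some M) := by
  obtain ⟨s, hs, M, r, hQ⟩ := h
  refine ⟨M, hQ, ?_⟩
  rw [_root_.execute, ← Nat.add_sub_cancel' hs, r, runSteps_halted, PMF.pure_map]
  rfl

/-- Before and after the only draw everything is deterministic, so the result is the image of a
uniform distribution. The three additional steps are the two compositions and the draw. -/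
theorem execute_random {p q : Program} {x y t1 t2 t N n : ℕ} {M : Memory}
    (hp : Reaches S w tab p t1 (fun M' => M' = M) (inputMemory N)) (hn : M.reg y = n + 1)
    (hw : n < 2 ^ w) (Q : ℕ → Memory → Prop)
    (hq : ∀ u ≤ n, Reaches S w tab q t2 (Q u) (M.set x u)) (ht : t1 + t2 + 3 ≤ t) :
    ∃ R : Fin (n + 1) → Memory, (∀ u : Fin (n + 1), Q u (R u)) ∧
      execute t S w tab (.seq p (.seq (.random x y) q)) N =
        (PMF.uniformOfFintype (Fin (n + 1))).map fun u => some (R u) := by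
  obtain ⟨s1, h1, M', r1, rfl⟩ := hp
  have hq' : ∀ u : Fin (n + 1), ∃ M2, Q u M2 ∧ ∀ m, t2 ≤ m →
      runSteps S w tab m (some ([q], M'.set x u)) = PMF.pure (some ([], M2)) := by
    intro u
    obtain ⟨s2, h2, M2, r2, hQ⟩ := hq u (by omega)
    refine ⟨M2, hQ, fun m hm => ?_⟩
    rw [← Nat.add_sub_cancel' (h2.trans hm), r2, runSteps_halted]
  choose R hR hrun using hq'
  refine ⟨R, hR, ?_⟩
  obtain ⟨d, rfl⟩ : ∃ d, t = (s1 + ((t2 + d + 1) + 1)) + 1 := ⟨t - s1 - t2 - 3, by omega⟩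
  rw [execute, runSteps]
  simp only [stepConfig, stepProgram, PMF.pure_bind]
  rw [r1, runSteps]
  simp only [stepConfig, stepProgram, PMF.pure_bind]
  rw [runSteps]
  simp only [stepConfig, stepProgram, hn]
  rw [PMF.bind_map, PMF.map_bind]
  conv_rhs => rw [← PMF.bind_pure_comp]
  change ((PMF.uniformOfFintype (Fin (n + 1))).bind fun a => PMF.pure (a : ℕ)).bind _ = _
  rw [PMF.bind_bind]
  simp only [PMF.pure_bind]
  congr 1
  funext u
  have hu : (u : ℕ) < 2 ^ w := lt_of_le_of_lt (Nat.lt_succ_iff.mp u.2) hw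
  simp only [Function.comp, writeReg, if_pos hu]
  have := hrun u (t2 + d) (by omega)
  rw [Memory.set] at this
  rw [this, PMF.pure_map]
  rfl

end

end

noncomputable section

/-! ## Addresses of shapes -/

/-- The address of a shape in the layer `m` of the table. -/
def address {k : ℕ} (N m : ℕ) (lam : Rows k) : ℕ := m * N ^ (k - 1) + ∑ r, lam r * N ^ (r : ℕ)

theorem digits_succ {K N : ℕ} (f : Fin (K + 1) → ℕ) (m : ℕ) :
    m * N ^ (K + 1) + ∑ r, f r * N ^ (r : ℕ) =
      f 0 + N * (m * N ^ K + ∑ r : Fin K, f r.succ * N ^ (r : ℕ)) := by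
  rw [Fin.sum_univ_succ, mul_add, Finset.mul_sum]
  simp only [Fin.val_zero, pow_zero, mul_one, Fin.val_succ, pow_succ]
  have : ∀ r : Fin K, f r.succ * (N ^ (r : ℕ) * N) = N * (f r.succ * N ^ (r : ℕ)) :=
    fun r => by ring
  simp only [this]
  ring

theorem digits_div_mod {K N : ℕ} (f : Fin K → ℕ) (hf : ∀ r, f r < N) (m : ℕ) (r : Fin K) :
    (m * N ^ K + ∑ r, f r * N ^ (r : ℕ)) / N ^ (r : ℕ) % N = f r := by
  induction K with
  | zero => exact r.elim0
  | succ K ih =>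
    rw [digits_succ]
    have hN : 0 < N := (Nat.zero_le _).trans_lt (hf r)
    refine Fin.cases ?_ (fun r => ?_) r
    · simp [Nat.mod_eq_of_lt (hf 0)]
    · rw [Fin.val_succ, pow_succ', ← Nat.div_div_eq_div_mul, Nat.add_mul_div_left _ _ hN,
        Nat.div_eq_of_lt (hf 0), zero_add]
      exact ih (fun r => f r.succ) (fun r => hf _) r

theorem digits_lt {K N : ℕ} (f : Fin K → ℕ) (hf : ∀ r, f r < N) :
    ∑ r, f r * N ^ (r : ℕ) < N ^ K := by
  induction K with
  | zero => simp
  | succ K ih =>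
    have h := digits_succ (N := N) f 0
    have h1 := ih (fun r => f r.succ) fun r => hf _
    have h2 := hf 0
    simp only [zero_mul, zero_add] at h
    rw [h, pow_succ']
    have := Nat.mul_le_mul_left N (Nat.succ_le_of_lt h1)
    rw [Nat.succ_eq_add_one, mul_add, mul_one] at this
    omega

theorem exists_digits {K N : ℕ} (hN : 0 < N) (i : ℕ) :
    ∃ f : Fin K → ℕ, (∀ r, f r < N) ∧ i = i / N ^ K * N ^ K + ∑ r, f r * N ^ (r : ℕ) := by
  induction K generalizing i with
  | zero => exact ⟨fun _ => 0, fun r => r.elim0, by simp⟩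
  | succ K ih =>
    obtain ⟨f, hf, e⟩ := ih (i / N)
    refine ⟨Fin.cons (i % N) f, fun r => ?_, ?_⟩
    · refine Fin.cases ?_ (fun r => ?_) r
      · exact Nat.mod_lt _ hN
      · exact hf r
    · rw [digits_succ]
      simp only [Fin.cons_zero, Fin.cons_succ]
      rw [pow_succ', ← Nat.div_div_eq_div_mul, ← e]
      exact (Nat.mod_add_div i N).symm

section

variable {k N m : ℕ} {lam : Rows k}

theorem address_digit (h : ∀ r, lam r < N) (r : Fin (k - 1)) :
    address N m lam / N ^ (r : ℕ) % N = lam r := digits_div_mod lam h m r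

theorem address_lt (h : ∀ r, lam r < N) : address N m lam < (m + 1) * N ^ (k - 1) := by
  have := digits_lt lam h
  rw [address, add_mul, one_mul]
  omega

theorem address_lt_pow (hk : 2 ≤ k) (h : ∀ r, lam r < N) (hm : m < N) :
    address N m lam < N ^ k := by
  refine (address_lt h).trans_le ?_
  calc (m + 1) * N ^ (k - 1) ≤ N * N ^ (k - 1) := Nat.mul_le_mul_right _ hm
    _ = N ^ k := by rw [← pow_succ', Nat.sub_add_cancel (by omega)]

theorem address_add_box (j : Fin (k - 1)) :
    address N m (lam + box j) = address N m lam + N ^ (j : ℕ) := by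
  simp only [address, Pi.add_apply, box_apply, add_mul, Finset.sum_add_distrib, ite_mul, one_mul,
    zero_mul, Finset.sum_ite_eq', Finset.mem_univ, if_true]
  ring

theorem address_succ : address N (m + 1) lam = address N m lam + N ^ (k - 1) := by
  simp only [address]; ring

theorem exists_address (hN : 0 < N) (i : ℕ) :
    ∃ lam : Rows k, (∀ r, lam r < N) ∧ i = address N (i / N ^ (k - 1)) lam :=
  exists_digits hN i

theorem address_div (h : ∀ r, lam r < N) : address N m lam / N ^ (k - 1) = m := by
  have h1 := digits_lt lam h
  rw [address, mul_comm, Nat.mul_add_div (by omega), Nat.div_eq_of_lt h1, add_zero]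

theorem address_inj {m' : ℕ} {mu : Rows k} (h : ∀ r, lam r < N) (h' : ∀ r, mu r < N)
    (e : address N m lam = address N m' mu) : m = m' ∧ lam = mu := by
  refine ⟨?_, ?_⟩
  · rw [← address_div (m := m) h, e, address_div h']
  · funext r
    rw [← address_digit (m := m) h r, e, address_digit h']

/-! ## Bounds for the numbers of walks -/

/-- A move removes at most one square. Together with `m < N` this confines the relevant shapes to
rows shorter than `N`, which are the digits available in an address. -/
theorem codeCount_eq_zero_of_lt {L : List (Code k)} {r : Fin (k - 1)} (h : m < lam r) :
    codeCount L m lam = 0 := by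
  induction m generalizing lam with
  | zero =>
    rw [codeCount, if_neg]
    rintro rfl
    simp at h
  | succ m ih =>
    rw [codeCount_succ]
    apply List.sum_eq_zero
    intro x hx
    obtain ⟨c, -, rfl⟩ := List.mem_map.mp hx
    rw [codeWeight]
    split_ifs
    · apply ih
      have : obox c.2 r ≤ 1 := by
        cases c.2 with
        | none => simp [obox]
        | some b => simp only [obox, box_apply]; split_ifs <;> simp
      simp only [target, Pi.sub_apply, Pi.add_apply]
      omega
    · rfl

theorem codeCount_of_not_antitone {L : List (Code k)} (h : ¬ Antitone lam) :
    codeCount L m lam = 0 := by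
  cases m with
  | zero =>
    rw [codeCount, if_neg]
    rintro rfl
    exact h fun _ _ _ => le_rfl
  | succ m =>
    rw [codeCount_succ]
    apply List.sum_eq_zero
    intro x hx
    obtain ⟨c, -, rfl⟩ := List.mem_map.mp hx
    rw [codeWeight, if_neg fun h' => h h'.1]

theorem codeCount_le (L : List (Code k)) (m : ℕ) (lam : Rows k) :
    codeCount L m lam ≤ L.length ^ m := by
  induction m generalizing lam with
  | zero => rw [codeCount]; split_ifs <;> simp
  | succ m ih =>
    rw [codeCount_succ, pow_succ']
    refine (List.sum_le_card_nsmul _ (L.length ^ m) ?_).trans ?_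
    · intro x hx
      obtain ⟨c, -, rfl⟩ := List.mem_map.mp hx
      rw [codeWeight]
      split_ifs
      · exact ih _
      · exact Nat.zero_le _
    · simp

/-! ## Tests for the possible moves -/

/-- The length that bounds row `a`. -/
def upper (N : ℕ) (lam : Rows k) (a : Fin (k - 1)) : ℕ :=
  if (a : ℕ) = 0 then N - 1 else lam ⟨a - 1, by omega⟩

/-- The length of the row after row `b`. -/
def lower (lam : Rows k) (b : Fin (k - 1)) : ℕ :=
  if h : (b : ℕ) + 1 < k - 1 then lam ⟨b + 1, h⟩ else 0

/-- For row 1 the bound `N - 1` keeps the digit below `N`; for the other rows the row above bounds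
both the shape and the digit. So a single comparison suffices. -/
theorem lt_upper_iff (hlam : Antitone lam) (h : ∀ r, lam r < N) (a : Fin (k - 1)) :
    lam a < upper N lam a ↔ Antitone (lam + box a) ∧ ∀ r, (lam + box a) r < N := by
  unfold upper
  constructor
  · intro ha
    have hlt : ∀ i < a, lam a + 1 ≤ lam i := by
      intro i hi
      have h0 : (a : ℕ) ≠ 0 := by have := Fin.lt_def.mp hi; omega
      rw [if_neg h0] at ha
      have := hlam (show i ≤ ⟨a - 1, by omega⟩ from by
        rw [Fin.le_def]; have := Fin.lt_def.mp hi; simp; omega)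
      omega
    refine ⟨fun i j hij => ?_, fun r => ?_⟩
    · have := hlam hij
      simp only [Pi.add_apply, box_apply]
      by_cases hj : j = a
      · subst hj
        by_cases hi : i = j
        · simp [hi]
        · have := hlt i (lt_of_le_of_ne hij hi)
          simp [hi]; omega
      · simp [hj]; omega
    · have := h r
      simp only [Pi.add_apply, box_apply]
      by_cases hr : r = a
      · subst hr
        rw [if_pos rfl]
        split_ifs at ha with h0
        · omega
        · have := h ⟨r - 1, by omega⟩
          omega
      · simp [hr]; omega
  · rintro ⟨h1, h2⟩
    split_ifs with h0
    · have := h2 a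
      simp [box_apply] at this
      omega
    · have h3 := h1 (show (⟨a - 1, by omega⟩ : Fin (k - 1)) ≤ a from by rw [Fin.le_def]; simp)
      have h4 : (⟨a - 1, by omega⟩ : Fin (k - 1)) ≠ a := fun e => by
        have := congrArg Fin.val e; simp at this; omega
      simp only [Pi.add_apply, box_apply, if_true, h4, if_false] at h3
      omega

theorem lower_lt_iff (hlam : Antitone lam) (b : Fin (k - 1)) :
    lower lam b < lam b ↔ Antitone (lam - box b) ∧ lam - box b + box b = lam := by
  unfold lower
  constructor
  · intro hb
    have hpos : 0 < lam b := by omega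
    refine ⟨fun i j hij => ?_, ?_⟩
    · have h1 := hlam hij
      simp only [Pi.sub_apply, box_apply]
      by_cases hi : i = b
      · subst hi
        by_cases hj : j = i
        · simp [hj]
        · have hlt : i < j := lt_of_le_of_ne hij (Ne.symm hj)
          have hv := Fin.lt_def.mp hlt
          rw [dif_pos (by omega)] at hb
          have := hlam (show (⟨i + 1, by omega⟩ : Fin (k - 1)) ≤ j from by
            rw [Fin.le_def]; simp; omega)
          simp [hj]; omega
      · simp [hi]; omega
    · funext r
      simp only [Pi.add_apply, Pi.sub_apply, box_apply]
      by_cases hr : r = b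
      · subst hr; simp; omega
      · simp [hr]
  · rintro ⟨h1, h2⟩
    have h3 := congrFun h2 b
    simp only [Pi.add_apply, Pi.sub_apply, box_apply, if_true] at h3
    split_ifs with h0
    · have h4 := h1 (show b ≤ ⟨b + 1, h0⟩ from by rw [Fin.le_def]; simp)
      have h5 : (⟨b + 1, h0⟩ : Fin (k - 1)) ≠ b := fun e => by
        have := congrArg Fin.val e; simp at this
      simp only [Pi.sub_apply, box_apply, if_true, h5, if_false] at h4
      omega
    · omega

/-- A square can be added as the code prescribes, within `N - 1` columns. -/
def CanAdd (N : ℕ) (lam : Rows k) : Option (Fin (k - 1)) → Prop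
  | none => True
  | some a => lam a < upper N lam a

/-- A square can be removed as the code prescribes. -/
def CanRemove (lam : Rows k) : Option (Fin (k - 1)) → Prop
  | none => True
  | some b => lower lam b < lam b

theorem canAdd_iff (hlam : Antitone lam) (h : ∀ r, lam r < N) (a : Option (Fin (k - 1))) :
    CanAdd N lam a ↔ Antitone (lam + obox a) ∧ ∀ r, (lam + obox a) r < N := by
  cases a with
  | none => simp only [CanAdd, obox, add_zero, true_iff]; exact ⟨hlam, h⟩
  | some a => exact lt_upper_iff hlam h a

theorem canRemove_iff (hlam : Antitone lam) (b : Option (Fin (k - 1))) :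
    CanRemove lam b ↔ Antitone (lam - obox b) ∧ lam - obox b + obox b = lam := by
  cases b with
  | none => simp only [CanRemove, obox, tsub_zero, add_zero, and_true, true_iff]; exact hlam
  | some b => exact lower_lt_iff hlam b

/-- The number of loop-free braid walks of `m + 1` moves with first move `c`. -/
def moveWeight (m : ℕ) (lam : Rows k) (c : Code k) : ℕ := codeWeight (moveCodes k) m lam c

theorem moveCount_succ : moveCount (m + 1) lam = ((moveCodes k).map (moveWeight m lam)).sum := rfl

/-- The danger is that the shape with the added square has no address. The rows of the target are at
most `m`. Row 1 exceeds the target only if the code removes its square there; then, as loops are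
excluded, the code does not add in row 1, which still has its old length. A lower row is bounded by
the row above it, unless that one has grown; but then the row itself has not. -/
theorem bounds_of_moveWeight_pos (h : ∀ r, lam r < N) (hm : m < N) {c : Code k}
    (hc : c ∈ moveCodes k) (hw : 0 < moveWeight m lam c) :
    Allowed lam c ∧ (∀ r, (lam + obox c.1) r < N) ∧ ∀ r, target lam c r < N := by
  rw [moveWeight, codeWeight] at hw
  split_ifs at hw with ha
  · have ht : ∀ r, target lam c r ≤ m := fun r => by
      by_contra hlt
      rw [codeCount_eq_zero_of_lt (r := r) (by omega)] at hw
      omega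
    refine ⟨ha, fun r => ?_, fun r => (ht r).trans_lt hm⟩
    obtain ⟨h1, h2, h3, h4⟩ := ha
    by_cases hr : (r : ℕ) = 0
    · have h5 := congrFun h4 r
      have h6 := ht r
      have h7 := h r
      rw [← h5]
      rw [mem_moveCodes] at hc
      obtain ⟨a, b⟩ := c
      simp only [Pi.add_apply] at h5 ⊢
      cases b with
      | none => simp [obox]; omega
      | some b =>
        by_cases hb : r = b
        · subst hb
          cases a with
          | none => simp [obox] at h5 ⊢; omega
          | some a =>
            have ha : r ≠ a := by
              rintro rfl; exact hc ⟨r, r, rfl, hr, hr⟩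
            simp only [obox, box_apply, ha, if_false, if_true] at h5 ⊢
            omega
        · simp only [obox, box_apply, hb, if_false]; omega
    · let q : Fin (k - 1) := ⟨r - 1, by omega⟩
      have h5 := h2 (show q ≤ r from by rw [Fin.le_def]; simp [q])
      have h6 := h q
      by_cases hq : obox c.1 q = 0
      · simp only [Pi.add_apply] at h5 ⊢
        omega
      · have h7 := h r
        have : obox c.1 r = 0 := by
          cases hc1 : c.1 with
          | none => simp [obox]
          | some a =>
            rw [hc1] at hq
            simp only [obox, box_apply] at hq ⊢
            have : q = a := by by_contra h; simp [h] at hq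
            rw [if_neg]
            rintro rfl
            have := congrArg Fin.val this
            simp [q] at this; omega
        simp only [Pi.add_apply, this]; omega
  · omega

-- The tests of the program also reject squares beyond column `N - 1`. By `bounds_of_moveWeight_pos`
-- the codes rejected for this reason have weight 0.
open Classical in
theorem moveWeight_eq (hlam : Antitone lam) (h : ∀ r, lam r < N) (hm : m < N) {c : Code k}
    (hc : c ∈ moveCodes k) : moveWeight m lam c =
      if CanAdd N lam c.1 ∧ CanRemove (lam + obox c.1) c.2 then moveCount m (target lam c)
      else 0 := by
  split_ifs with hif
  · obtain ⟨h1, h2⟩ := hif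
    obtain ⟨h3, -⟩ := (canAdd_iff hlam h _).mp h1
    obtain ⟨h4, h5⟩ := (canRemove_iff h3 _).mp h2
    exact if_pos ⟨hlam, h3, h4, h5⟩
  · by_contra hne
    obtain ⟨⟨h1, h2, h3, h4⟩, h5, -⟩ := bounds_of_moveWeight_pos h hm hc (Nat.pos_of_ne_zero hne)
    exact hif ⟨(canAdd_iff hlam h _).mpr ⟨h2, h5⟩, (canRemove_iff h2 _).mpr ⟨h3, h4⟩⟩

end

end

noncomputable section

/-! ## Straight-line programs -/

/-- Programs one after the other. -/
def block : List Program → Program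
  | [] => .skip
  | p :: ps => .seq p (block ps)

/-- The memories agree except for the registers `1, …, n - 1`. -/
def Frame (n : ℕ) (M M' : Memory) : Prop :=
  M'.arr = M.arr ∧ ∀ x, x = 0 ∨ n ≤ x → M'.reg x = M.reg x

theorem Frame.refl (n : ℕ) (M : Memory) : Frame n M M := ⟨rfl, fun _ _ => rfl⟩

theorem Frame.trans {a b n : ℕ} {M M' M'' : Memory} (h : Frame a M M') (h' : Frame b M' M'')
    (ha : a ≤ n) (hb : b ≤ n) : Frame n M M'' :=
  ⟨h'.1.trans h.1, fun x hx => (h'.2 x (by omega)).trans (h.2 x (by omega))⟩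

theorem Frame.mono {a n : ℕ} {M M' : Memory} (h : Frame a M M') (ha : a ≤ n) : Frame n M M' :=
  ⟨h.1, fun x hx => h.2 x (by omega)⟩

theorem Frame.set {a n : ℕ} {M M' : Memory} (h : Frame a M M') {x : ℕ} (ha : a ≤ n) (h0 : 0 < x)
    (hx : x < n) (v : ℕ) : Frame n M (M'.set x v) := by
  refine ⟨h.1, fun y hy => ?_⟩
  rw [Memory.set_reg, if_neg (by omega)]
  exact h.2 y (by omega)

theorem frame_set (M : Memory) {x n : ℕ} (h0 : 0 < x) (hx : x < n) (v : ℕ) :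
    Frame n M (M.set x v) := (Frame.refl n M).set le_rfl h0 hx v

/-- Registers `0`, `12`, `17`, `18` and `20, 22, …` contain `N`, `N - 1`, `1`, `0` and the powers
of `N`. -/
structure BaseRegs (k N : ℕ) (M : Memory) : Prop where
  input : M.reg 0 = N
  pred : M.reg 12 = N - 1
  one : M.reg 17 = 1
  zero : M.reg 18 = 0
  pow : ∀ r ≤ k - 1, M.reg (2 * r + 20) = N ^ r

theorem BaseRegs.congr {k N : ℕ} {M M' : Memory} (h : BaseRegs k N M)
    (hM : ∀ x, x = 0 ∨ x = 12 ∨ x = 17 ∨ x = 18 ∨ (20 ≤ x ∧ x % 2 = 0) →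
      M'.reg x = M.reg x) : BaseRegs k N M' where
  input := (hM _ (by omega)).trans h.input
  pred := (hM _ (by omega)).trans h.pred
  one := (hM _ (by omega)).trans h.one
  zero := (hM _ (by omega)).trans h.zero
  pow r hr := (hM _ (by omega)).trans (h.pow r hr)

theorem BaseRegs.frame {k N n : ℕ} {M M' : Memory} (h : BaseRegs k N M) (hM : Frame n M M')
    (hn : n ≤ 12) : BaseRegs k N M' := h.congr fun x hx => hM.2 x (by omega)

/-- Register `x` gets the digit `r` of register `1`. -/
def digitProg (x r : ℕ) : Program :=
  block [.arith .quot x 1 (2 * r + 20), .arith .rest x x 0]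

/-- Register `4` is not `0` if a square can be added. -/
def addTest {k : ℕ} : Option (Fin (k - 1)) → Program
  | none => .const 4 1
  | some a => block [digitProg 2 a,
      if (a : ℕ) = 0 then .arith .plus 3 12 18 else digitProg 3 (a - 1), .arith .minus 4 3 2]

/-- Register `4` is not `0` if a square can be removed. -/
def removeTest {k : ℕ} : Option (Fin (k - 1)) → Program
  | none => .const 4 1
  | some b => block [digitProg 2 b,
      if (b : ℕ) + 1 < k - 1 then digitProg 3 (b + 1) else .const 3 0, .arith .minus 4 2 3]

/-- Change the address in register `1` by a square. -/
def shiftProg {k : ℕ} (o : ArithOp) : Option (Fin (k - 1)) → Program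
  | none => .skip
  | some a => .arith o 1 1 (2 * a + 20)

/-- If register `10` contains the address of a shape, register `5` gets the number of walks that
start with the move `c`, where the program `get` reads the table. -/
def codeValue {k : ℕ} (get : Program) (c : Code k) : Program :=
  block [.arith .plus 1 10 18, addTest c.1, .cond 4
    (block [shiftProg .plus c.1, removeTest c.2, .cond 4
      (block [shiftProg .minus c.2, .arith .minus 1 1 (2 * (k - 1) + 20), get])
      (.const 5 0)])
    (.const 5 0)]

section

variable {S w k N m : ℕ} {tab : ℕ → ℕ → ℕ} {lam : Rows k} {M : Memory} {Q : Memory → Prop}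

theorem ensures_digitProg {x : ℕ} (h0 : 0 < x) (hM : BaseRegs k N M)
    {m : ℕ} (ha : M.reg 1 = address N m lam) (hlam : ∀ r, lam r < N) (hw : M.reg 1 < 2 ^ w)
    (r : Fin (k - 1)) (hQ : Q ((M.set x (M.reg 1 / N ^ (r : ℕ))).set x (lam r))) :
    Ensures S w tab (digitProg x r) Q M := by
  have h2 : M.reg (2 * r + 20) = N ^ (r : ℕ) := hM.pow r (by omega)
  have h3 : M.reg 1 / N ^ (r : ℕ) ≤ M.reg 1 := Nat.div_le_self _ _
  have h4 : M.reg 1 / N ^ (r : ℕ) % N = lam r := by rw [ha]; exact address_digit hlam r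
  have h5 := Nat.mod_le (M.reg 1 / N ^ (r : ℕ)) N
  simp only [digitProg, block, Ensures, ArithOp.eval, h2, Memory.set_reg, if_true,
    if_neg h0.ne, hM.input, h4]
  exact ⟨by omega, by omega, hQ⟩

open Classical in
theorem ensures_addTest (hM : BaseRegs k N M) {m : ℕ} (ha : M.reg 1 = address N m lam)
    (hlam : ∀ r, lam r < N) (hw : M.reg 1 < 2 ^ w) (hN : N < 2 ^ w) (hw0 : 1 < 2 ^ w)
    (a : Option (Fin (k - 1)))
    (hQ : ∀ M', Frame 5 M M' → M'.reg 1 = M.reg 1 → (M'.reg 4 ≠ 0 ↔ CanAdd N lam a) → Q M') :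
    Ensures S w tab (addTest a) Q M := by
  cases a with
  | none =>
    exact ⟨hw0, hQ _ (frame_set M (by omega) (by omega) _) (by simp) (by simp [CanAdd])⟩
  | some a =>
    refine ensures_digitProg (by omega) hM ha hlam hw a ?_
    have hlt := hlam a
    have f1 := ((frame_set M (x := 2) (n := 3) (by omega) (by omega)
      (M.reg 1 / N ^ (a : ℕ))).set le_rfl (x := 2) (by omega) (by omega) (lam a))
    have e1 : ((M.set 2 (M.reg 1 / N ^ (a : ℕ))).set 2 (lam a)).reg 1 = M.reg 1 := by simp
    have e2 : ((M.set 2 (M.reg 1 / N ^ (a : ℕ))).set 2 (lam a)).reg 2 = lam a := by simp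
    generalize (M.set 2 (M.reg 1 / N ^ (a : ℕ))).set 2 (lam a) = M1 at *
    have hM1 := hM.frame f1 (by omega)
    by_cases h0 : (a : ℕ) = 0
    · simp only [h0, if_true, block, Ensures, ArithOp.eval, hM1.pred, hM1.zero, Memory.set_reg,
        e2]
      refine ⟨by omega, by simp; omega, hQ _ ?_ (by simp [e1]) ?_⟩
      · exact ((f1.set (n := 4) (x := 3) (by omega) (by omega) (by omega) _).set
          (by omega) (by omega) (by omega) _)
      · simp [CanAdd, upper, h0]; omega
    · rw [if_neg h0]
      refine ensures_digitProg (by omega) hM1 (e1.trans ha) hlam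
        (by rwa [e1]) (⟨a - 1, by omega⟩ : Fin (k - 1)) ?_
      have := hlam ⟨a - 1, by omega⟩
      simp only [block, Ensures, ArithOp.eval, Memory.set_reg, e2]
      refine ⟨by simp; omega, hQ _ ?_ (by simp [e1]) ?_⟩
      · exact (((f1.set (n := 4) (x := 3) (by omega) (by omega) (by omega) _).set (n := 4)
          (x := 3) (by omega) (by omega) (by omega) _).set (by omega) (by omega) (by omega) _)
      · simp [CanAdd, upper, h0]; omega

open Classical in
theorem ensures_removeTest (hM : BaseRegs k N M) {m : ℕ} (ha : M.reg 1 = address N m lam)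
    (hlam : ∀ r, lam r < N) (hw : M.reg 1 < 2 ^ w) (hN : N < 2 ^ w) (hw0 : 1 < 2 ^ w)
    (b : Option (Fin (k - 1)))
    (hQ : ∀ M', Frame 5 M M' → M'.reg 1 = M.reg 1 → (M'.reg 4 ≠ 0 ↔ CanRemove lam b) → Q M') :
    Ensures S w tab (removeTest b) Q M := by
  cases b with
  | none =>
    exact ⟨hw0, hQ _ (frame_set M (by omega) (by omega) _) (by simp) (by simp [CanRemove])⟩
  | some a =>
    refine ensures_digitProg (by omega) hM ha hlam hw a ?_
    have hlt := hlam a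
    have f1 := ((frame_set M (x := 2) (n := 3) (by omega) (by omega)
      (M.reg 1 / N ^ (a : ℕ))).set le_rfl (x := 2) (by omega) (by omega) (lam a))
    have e1 : ((M.set 2 (M.reg 1 / N ^ (a : ℕ))).set 2 (lam a)).reg 1 = M.reg 1 := by simp
    have e2 : ((M.set 2 (M.reg 1 / N ^ (a : ℕ))).set 2 (lam a)).reg 2 = lam a := by simp
    generalize (M.set 2 (M.reg 1 / N ^ (a : ℕ))).set 2 (lam a) = M1 at *
    have hM1 := hM.frame f1 (by omega)
    by_cases h0 : (a : ℕ) + 1 < k - 1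
    · rw [if_pos h0]
      refine ensures_digitProg (by omega) hM1 (e1.trans ha) hlam
        (by rwa [e1]) (⟨a + 1, h0⟩ : Fin (k - 1)) ?_
      simp only [block, Ensures, ArithOp.eval, Memory.set_reg, e2]
      refine ⟨by simp; omega, hQ _ ?_ (by simp [e1]) ?_⟩
      · exact (((f1.set (n := 4) (x := 3) (by omega) (by omega) (by omega) _).set (n := 4)
          (x := 3) (by omega) (by omega) (by omega) _).set (by omega) (by omega) (by omega) _)
      · simp [CanRemove, lower, h0]; omega
    · rw [if_neg h0]
      simp only [block, Ensures, ArithOp.eval, Memory.set_reg, e2]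
      refine ⟨by omega, by simp; omega, hQ _ ?_ (by simp [e1]) ?_⟩
      · exact ((f1.set (n := 4) (x := 3) (by omega) (by omega) (by omega) _).set
          (by omega) (by omega) (by omega) _)
      · simp [CanRemove, lower, h0]

/-- The change of the address by a square. -/
def oaddress {k : ℕ} (N : ℕ) : Option (Fin (k - 1)) → ℕ
  | none => 0
  | some a => N ^ (a : ℕ)

theorem address_add_obox (a : Option (Fin (k - 1))) :
    address N m (lam + obox a) = address N m lam + oaddress N a := by
  cases a with
  | none => simp [obox, oaddress]
  | some a => exact address_add_box a

theorem ensures_shiftProg (hM : BaseRegs k N M) (o : ArithOp) (a : Option (Fin (k - 1)))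
    (hw : o.eval (M.reg 1) (oaddress N a) < 2 ^ w) (ho : ∀ x, o.eval x 0 = x)
    (hQ : Q (M.set 1 (o.eval (M.reg 1) (oaddress N a)))) :
    Ensures S w tab (shiftProg o a) Q M := by
  cases a with
  | none =>
    rw [oaddress, ho] at hQ
    have : M.set 1 (M.reg 1) = M := by simp [Memory.set]
    rw [this] at hQ
    exact hQ
  | some a =>
    have h2 : M.reg (2 * a + 20) = N ^ (a : ℕ) := hM.pow a (by omega)
    simp only [shiftProg, Ensures, h2]
    exact ⟨hw, hQ⟩

/-- The program `get` is left open because the table is read in two ways: the preprocessing loads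
from its own array, the sampler fetches from the read-only table. -/
theorem ensures_codeValue {get : Program} (hk : 2 ≤ k) (hM : BaseRegs k N M)
    (ha : M.reg 10 = address N (m + 1) lam) (hanti : Antitone lam) (hlam : ∀ r, lam r < N)
    (hm : m + 1 < N) (hw : N ^ k ≤ 2 ^ w)
    (hget : ∀ M' (nu : Rows k), Frame 6 M M' → (∀ r, nu r < N) → Antitone nu → M'.reg 1 = address N m nu →
      ∀ Q : Memory → Prop, Q (M'.set 5 (moveCount m nu)) → Ensures S w tab get Q M')
    {c : Code k} (hc : c ∈ moveCodes k)
    (hQ : ∀ M', Frame 6 M M' → M'.reg 5 = moveWeight m lam c → Q M') :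
    Ensures S w tab (codeValue get c) Q M := by
  classical
  have hNk : N ≤ N ^ k := Nat.le_self_pow (by omega) N
  have hN : N < 2 ^ w := by
    have : N ^ 1 < N ^ k := Nat.pow_lt_pow_right (by omega) (by omega)
    rw [pow_one] at this
    omega
  have hadr : ∀ mu : Rows k, (∀ r, mu r < N) → address N (m + 1) mu < 2 ^ w := fun mu hmu =>
    (address_lt_pow hk hmu hm).trans_le hw
  simp only [codeValue, block, Ensures, ArithOp.eval, hM.zero, add_zero, ha]
  refine ⟨hadr _ hlam, ?_⟩
  have f1 := frame_set M (x := 1) (n := 2) (by omega) (by omega) (address N (m + 1) lam)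
  have e1 : (M.set 1 (address N (m + 1) lam)).reg 1 = address N (m + 1) lam := by simp
  generalize M.set 1 (address N (m + 1) lam) = M1 at *
  have hM1 := hM.frame f1 (by omega)
  refine ensures_addTest hM1 e1 hlam (by rw [e1]; exact hadr _ hlam) hN (by omega) c.1 ?_
  intro M2 f2 e2 t2
  have hM2 := hM1.frame f2 (by omega)
  have g2 : Frame 6 M M2 := f1.trans f2 (by omega) (by omega)
  rw [moveWeight_eq hanti hlam (by omega) hc] at hQ
  refine ⟨fun h4 => ?_, fun h4 => ?_⟩
  · have hadd := t2.mp h4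
    obtain ⟨hanti', hlam'⟩ := (canAdd_iff hanti hlam _).mp hadd
    have hs : M2.reg 1 + oaddress N c.1 = address N (m + 1) (lam + obox c.1) := by
      rw [e2, e1, address_add_obox]
    refine ensures_shiftProg hM2 .plus c.1 (by rw [ArithOp.eval, hs]; exact hadr _ hlam')
      (fun _ => rfl) ?_
    rw [ArithOp.eval, hs]
    have g3 := g2.set (n := 6) le_rfl (x := 1) (by omega) (by omega)
      (address N (m + 1) (lam + obox c.1))
    have e3 : (M2.set 1 (address N (m + 1) (lam + obox c.1))).reg 1 =
      address N (m + 1) (lam + obox c.1) := by simp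
    generalize M2.set 1 (address N (m + 1) (lam + obox c.1)) = M3 at *
    have hM3 := hM.frame g3 (by omega)
    refine ensures_removeTest hM3 e3 hlam' (by rw [e3]; exact hadr _ hlam') hN (by omega) c.2 ?_
    intro M4 f4 e4 t4
    have g4 : Frame 6 M M4 := g3.trans f4 (by omega) (by omega)
    have hM4 := hM.frame g4 (by omega)
    refine ⟨fun h4 => ?_, fun h4 => ?_⟩
    · have hrem := t4.mp h4
      obtain ⟨hanti2, heq⟩ := (canRemove_iff hanti' _).mp hrem
      change Antitone (target lam c) at hanti2
      change target lam c + obox c.2 = _ at heq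
      have hlt : ∀ r, target lam c r < N := fun r =>
        (show target lam c r ≤ (lam + obox c.1) r by
          rw [← heq, Pi.add_apply]; exact Nat.le_add_right _ _).trans_lt (hlam' r)
      have hs : M4.reg 1 - oaddress N c.2 = address N (m + 1) (target lam c) := by
        rw [e4, e3, ← heq, address_add_obox, Nat.add_sub_cancel]
      refine ensures_shiftProg hM4 .minus c.2 (by rw [ArithOp.eval, hs]; exact hadr _ hlt)
        (fun _ => rfl) ?_
      rw [ArithOp.eval, hs]
      have g5 := g4.set (n := 6) le_rfl (x := 1) (by omega) (by omega)
        (address N (m + 1) (target lam c))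
      have e5 : (M4.set 1 (address N (m + 1) (target lam c))).reg 1 =
        address N (m + 1) (target lam c) := by simp
      generalize M4.set 1 (address N (m + 1) (target lam c)) = M5 at *
      have hM5 := hM.frame g5 (by omega)
      -- Subtracting the power `k - 1` of `N` keeps the shape and passes to the layer with one move
      -- less.
      have hp := hM5.pow (k - 1) le_rfl
      have hb := hadr _ hlt
      rw [address_succ] at hb e5
      have hs : M5.reg 1 - N ^ (k - 1) = address N m (target lam c) := by omega
      simp only [hp, hs]
      refine ⟨by omega, hget _ (target lam c) (g5.set le_rfl (by omega) (by omega) _) hlt hanti2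
        (by simp) _ ?_⟩
      exact hQ _ ((g5.set (n := 6) le_rfl (by omega) (by omega) _).set le_rfl (by omega)
        (by omega) _) (by simp [hadd, hrem])
    · have hrem : ¬ CanRemove (lam + obox c.1) c.2 := fun h => t4.mpr h h4
      exact ⟨by omega, hQ _ (g4.set le_rfl (by omega) (by omega) _) (by simp [hrem])⟩
  · have hadd : ¬ CanAdd N lam c.1 := fun h => t2.mpr h h4
    exact ⟨by omega, hQ _ (g2.set le_rfl (by omega) (by omega) _) (by simp [hadd])⟩

end

end

noncomputable section

/-! ## The preprocessing -/

/-- Registers `20, 22, …, 2 * r + 20` get the powers of `N`. -/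
def powersProg : ℕ → Program
  | 0 => .const 20 1
  | r + 1 => .seq (powersProg r) (.arith .times (2 * (r + 1) + 20) (2 * r + 20) 0)

/-- Fill the registers whose contents remain the same. -/
def baseProg (k : ℕ) : Program :=
  block [.const 17 1, .arith .minus 12 0 17, powersProg (k - 1)]

/-- Execute `p` if the first `r + 1` digits of register `1` are weakly decreasing. -/
def guardProg (p : Program) : ℕ → Program
  | 0 => p
  | r + 1 => block [digitProg 2 (r + 1), digitProg 3 r, .arith .minus 4 2 3,
      .cond 4 .skip (guardProg p r)]

/-- Add the numbers of walks with given first moves to register `6`. -/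
def sumProg {k : ℕ} (get : Program) : List (Code k) → Program
  | [] => .skip
  | c :: cs => block [codeValue get c, .arith .plus 6 6 5, sumProg get cs]

/-- Compute one entry of the table. -/
def entryProg (k : ℕ) : Program :=
  block [.arith .plus 1 10 18,
    guardProg (block [.const 6 0, sumProg (.load 5 0 1) (moveCodes k), .store 0 10 6]) (k - 2),
    .arith .plus 10 10 17, .arith .minus 11 11 17]

/-- The table for `0` remaining moves, and the first address thereafter. -/
def tableStart (k : ℕ) : Program :=
  block [baseProg k, .store 0 18 17, .arith .plus 10 (2 * (k - 1) + 20) 18,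
    .arith .times 11 (2 * (k - 1) + 20) 0, .arith .minus 11 11 (2 * (k - 1) + 20)]

/-- The program that computes the table. -/
def tableProg (k : ℕ) : Program := .seq (tableStart k) (.loop 11 (entryProg k))

section

variable {S w k N m : ℕ} {tab : ℕ → ℕ → ℕ} {lam : Rows k} {M : Memory} {Q : Memory → Prop}

theorem ensures_powersProg {r : ℕ} (h0 : M.reg 0 = N) (hw : ∀ s ≤ r, N ^ s < 2 ^ w)
    (hQ : ∀ M', M'.arr = M.arr → (∀ x, (∀ s ≤ r, x ≠ 2 * s + 20) → M'.reg x = M.reg x) →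
      (∀ s ≤ r, M'.reg (2 * s + 20) = N ^ s) → Q M') :
    Ensures S w tab (powersProg r) Q M := by
  induction r generalizing Q with
  | zero =>
    refine ⟨hw 0 le_rfl, hQ _ rfl (fun x hx => ?_) fun s hs => ?_⟩
    · have := hx 0 le_rfl
      simp at this
      simp [this]
    · obtain rfl : s = 0 := by omega
      simp
  | succ r ih =>
    refine ih (fun s hs => hw s (by omega)) fun M1 a1 b1 c1 => ?_
    have h1 : M1.reg 0 = N := (b1 0 fun s _ => by omega).trans h0
    have h2 := c1 r le_rfl
    have h3 := hw (r + 1) le_rfl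
    rw [pow_succ] at h3
    simp only [Ensures, ArithOp.eval, h1, h2]
    refine ⟨h3, hQ _ a1 (fun x hx => ?_) fun s hs => ?_⟩
    · rw [Memory.set_reg, if_neg (hx (r + 1) le_rfl)]
      exact b1 x fun s hs => hx s (by omega)
    · rw [Memory.set_reg]
      split_ifs with h
      · obtain rfl : s = r + 1 := by omega
        rw [pow_succ]
      · exact c1 s (by omega)

theorem ensures_baseProg (hw1 : 1 < 2 ^ w) (hN : N < 2 ^ w) (hw : ∀ s ≤ k - 1, N ^ s < 2 ^ w)
    (hQ : ∀ M', M'.arr = (fun _ _ => 0) → BaseRegs k N M' →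
      (∀ x, x ≠ 0 → x ≠ 12 → x ≠ 17 → (∀ s, x ≠ 2 * s + 20) → M'.reg x = 0) → Q M') :
    Ensures S w tab (baseProg k) Q (inputMemory N) := by
  simp only [baseProg, block, Ensures, ArithOp.eval]
  refine ⟨hw1, by simp [inputMemory]; omega, ?_⟩
  refine ensures_powersProg (by simp [inputMemory]) hw fun M' a b c => hQ _ a ?_ ?_
  · refine ⟨?_, ?_, ?_, ?_, c⟩ <;> rw [b _ fun s hs => by omega] <;> simp [inputMemory]
  · intro x h0 h1 h2 h3
    rw [b _ fun s _ => h3 s]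
    simp [inputMemory, h0, h1, h2]

theorem antitone_of_succ (h : ∀ s (hs : s + 1 < k - 1),
    lam ⟨s + 1, hs⟩ ≤ lam ⟨s, by omega⟩) : Antitone lam := by
  intro i j hij
  obtain ⟨i, hi⟩ := i
  obtain ⟨j, hj⟩ := j
  have hij' : i ≤ j := hij
  clear hij
  induction j, hij' using Nat.le_induction with
  | base => exact le_rfl
  | succ j hij ih => exact (h j hj).trans (ih (by omega))

/-- Addresses run through all sequences of digits, shapes or not. Adjacent digits are compared, and
`p` is skipped at the first ascent. -/
theorem ensures_guardProg {p : Program} (hM : BaseRegs k N M) {m : ℕ}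
    (ha : M.reg 1 = address N m lam) (hlam : ∀ r, lam r < N) (hw : M.reg 1 < 2 ^ w)
    (hN : N < 2 ^ w) {r : ℕ} (hr : r ≤ k - 2)
    (h1 : ∀ M', Frame 5 M M' → (∀ s (hs : s + 1 < k - 1), s < r →
      lam ⟨s + 1, hs⟩ ≤ lam ⟨s, by omega⟩) → M'.reg 1 = M.reg 1 → Ensures S w tab p Q M')
    (h2 : ∀ M', Frame 5 M M' → ¬ Antitone lam → Q M') :
    Ensures S w tab (guardProg p r) Q M := by
  induction r generalizing M with
  | zero => exact h1 M (Frame.refl _ _) (fun s _ hs => by omega) rfl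
  | succ r ih =>
    refine ensures_digitProg (by omega) hM ha hlam hw (⟨r + 1, by omega⟩ : Fin (k - 1)) ?_
    have hlt := hlam ⟨r + 1, by omega⟩
    set M1 := (M.set 2 (M.reg 1 / N ^ (r + 1))).set 2 (lam ⟨r + 1, by omega⟩) with hM1
    have f1 : Frame 3 M M1 := (frame_set M (by omega) (by omega) _).set le_rfl (by omega)
      (by omega) _
    have e1 : M1.reg 1 = M.reg 1 := by simp [M1]
    have e2 : M1.reg 2 = lam ⟨r + 1, by omega⟩ := by simp [M1]
    clear_value M1
    refine ensures_digitProg (by omega) (hM.frame f1 (by omega)) (e1.trans ha) hlam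
      (by rwa [e1]) (⟨r, by omega⟩ : Fin (k - 1)) ?_
    set M2 := (M1.set 3 (M1.reg 1 / N ^ r)).set 3 (lam ⟨r, by omega⟩) with hM2
    have f2 : Frame 5 M M2 := (f1.set (n := 4) (by omega) (by omega) (by omega) _).set (by omega)
      (by omega) (by omega) _
    have e3 : M2.reg 1 = M.reg 1 := by simp [M2, e1]
    have e4 : M2.reg 2 = lam ⟨r + 1, by omega⟩ := by simp [M2, e2]
    have e5 : M2.reg 3 = lam ⟨r, by omega⟩ := by simp [M2]
    clear_value M2
    simp only [block, Ensures, ArithOp.eval, e4, e5, Memory.set_reg, if_true]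
    have f3 := f2.set (n := 5) (x := 4) le_rfl (by omega) (by omega)
      (lam ⟨r + 1, by omega⟩ - lam ⟨r, by omega⟩)
    refine ⟨by omega, fun h => h2 _ f3 fun hanti => ?_, fun h => ?_⟩
    · have := hanti (show (⟨r, by omega⟩ : Fin (k - 1)) ≤ ⟨r + 1, by omega⟩ from by
        rw [Fin.le_def]; simp)
      omega
    · refine ih (hM.frame f3 (by omega)) (by simp [e3, ha]) (by simp [e3, hw]) (by omega) ?_ ?_
      · intro M' f hs e
        refine h1 M' (f3.trans f le_rfl le_rfl) (fun s hs1 hs2 => ?_) (by simp [e, e3])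
        rcases Nat.lt_succ_iff_lt_or_eq.mp hs2 with h' | rfl
        · exact hs s hs1 h'
        · omega
      · exact fun M' f => h2 M' (f3.trans f le_rfl le_rfl)

theorem ensures_sumProg (hk : 2 ≤ k) (hM : BaseRegs k N M)
    (ha : M.reg 10 = address N (m + 1) lam) (hanti : Antitone lam) (hlam : ∀ r, lam r < N)
    (hm : m + 1 < N) (hw : N ^ k ≤ 2 ^ w) (hS : N ^ k ≤ S)
    (htab : ∀ nu : Rows k, (∀ r, nu r < N) → M.arr 0 (address N m nu) = moveCount m nu)
    (hcount : ∀ nu : Rows k, moveCount m nu < 2 ^ w) {L : List (Code k)}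
    (hL : ∀ c ∈ L, c ∈ moveCodes k) (hsum : M.reg 6 + (L.map (moveWeight m lam)).sum < 2 ^ w)
    (hQ : ∀ M', Frame 7 M M' → M'.reg 6 = M.reg 6 + (L.map (moveWeight m lam)).sum → Q M') :
    Ensures S w tab (sumProg (.load 5 0 1) L) Q M := by
  induction L generalizing M with
  | nil => exact hQ M (Frame.refl _ _) (by simp)
  | cons c cs ih =>
    rw [List.map_cons, List.sum_cons] at hsum hQ
    refine ensures_codeValue hk hM ha hanti hlam hm hw ?_ (hL c (by simp)) ?_
    · intro M' nu f h1 h2 h3 Q' hQ'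
      have e : M'.arr 0 (M'.reg 1) = moveCount m nu := by rw [h3, f.1, htab nu h1]
      simp only [Ensures, e]
      exact ⟨h3 ▸ (address_lt_pow hk h1 (by omega)).trans_le hS, hcount nu, hQ'⟩
    · intro M1 f1 e1
      have e2 := f1.2 6 (by omega)
      simp only [Ensures, block, ArithOp.eval, e1, e2]
      refine ⟨by omega, ?_⟩
      have f2 := f1.set (n := 7) (by omega) (x := 6) (by omega) (by omega)
        (M.reg 6 + moveWeight m lam c)
      refine ih (hM.frame f2 (by omega)) ((f2.2 _ (by omega)).trans ha) ?_
        (fun c hc => hL c (by simp [hc])) ?_ ?_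
      · rw [f2.1]; exact htab
      · simp only [Memory.set_reg, if_true]; omega
      · intro M' f e
        refine hQ M' (f2.trans f le_rfl le_rfl) ?_
        rw [e]
        simp only [Memory.set_reg, if_true]; omega

/-- The table is complete below the address `i`, and `0` from there on. -/
def TableBelow (k N i : ℕ) (M : Memory) : Prop :=
  ∀ m < N, ∀ lam : Rows k, (∀ r, lam r < N) →
    M.arr 0 (address N m lam) = if address N m lam < i then moveCount m lam else 0

theorem TableBelow.put {i : ℕ} (hT : TableBelow k N i M) (hi : i = address N m lam)
    (hlam : ∀ r, lam r < N) : TableBelow k N (i + 1) (M.put 0 i (moveCount m lam)) := by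
  intro m' hm' lam' hlam'
  rw [Memory.put_arr]
  by_cases h : address N m' lam' = i
  · obtain ⟨rfl, rfl⟩ := address_inj hlam' hlam (h.trans hi)
    simp [h]
  · rw [if_neg (by simp [h]), hT m' hm' lam' hlam']
    by_cases h' : address N m' lam' < i
    · rw [if_pos h', if_pos (by omega)]
    · rw [if_neg h', if_neg (by omega)]

theorem TableBelow.skip {i : ℕ} (hT : TableBelow k N i M) (hi : i = address N m lam)
    (hlam : ∀ r, lam r < N) (h0 : moveCount m lam = 0) : TableBelow k N (i + 1) M := by
  intro m' hm' lam' hlam'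
  rw [hT m' hm' lam' hlam']
  by_cases h : address N m' lam' = i
  · obtain ⟨rfl, rfl⟩ := address_inj hlam' hlam (h.trans hi)
    simp [h0]
  · by_cases h' : address N m' lam' < i
    · rw [if_pos h', if_pos (by omega)]
    · rw [if_neg h', if_neg (by omega)]

/-- Addresses increase with the layer, so the layer below is complete when an entry is computed. At
an address without a shape nothing is written: the initial 0 is the right count. -/
theorem ensures_entryProg (hk : 2 ≤ k) (hM : BaseRegs k N M) {i n : ℕ} (hi : M.reg 10 = i)
    (hn : M.reg 11 = n + 1) (hlo : N ^ (k - 1) ≤ i) (hhi : i < N ^ k) (hw : N ^ k < 2 ^ w)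
    (hnw : n < 2 ^ w) (hS : N ^ k ≤ S) (hT : TableBelow k N i M)
    (hcount : ∀ m < N, ∀ nu : Rows k, moveCount m nu < 2 ^ w)
    (hQ : ∀ M', BaseRegs k N M' → M'.reg 10 = i + 1 → M'.reg 11 = n → TableBelow k N (i + 1) M' →
      Q M') : Ensures S w tab (entryProg k) Q M := by
  have hNpos : 0 < N := by
    by_contra h
    obtain rfl : N = 0 := by omega
    rw [zero_pow (by omega)] at hhi
    omega
  have hN : N < 2 ^ w := (Nat.le_self_pow (by omega) N).trans_lt hw
  obtain ⟨lam, hlam, ha⟩ := exists_address (k := k) hNpos i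
  have hdiv : i / N ^ (k - 1) < N := by
    rw [Nat.div_lt_iff_lt_mul (by positivity), ← pow_succ', Nat.sub_add_cancel (by omega)]
    exact hhi
  have hdiv0 : 0 < i / N ^ (k - 1) := Nat.div_pos hlo (by positivity)
  obtain ⟨m, hm⟩ : ∃ m, i / N ^ (k - 1) = m + 1 := ⟨i / N ^ (k - 1) - 1, by omega⟩
  rw [hm] at ha hdiv
  simp only [entryProg]
  rw [block, Ensures, Ensures, ArithOp.eval, hM.zero, hi]
  refine ⟨by omega, ?_⟩
  have f1 := frame_set M (x := 1) (n := 2) (by omega) (by omega) (i + 0)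
  set M1 := M.set 1 (i + 0) with hM1
  have e1 : M1.reg 1 = i := by simp [M1]
  clear_value M1
  rw [block, Ensures]
  have last : ∀ M', BaseRegs k N M' → M'.reg 10 = i → M'.reg 11 = n + 1 →
      TableBelow k N (i + 1) M' →
      Ensures S w tab (block [.arith .plus 10 10 17, .arith .minus 11 11 17]) Q M' := by
    intro M' b1 b2 b3 b4
    simp only [block, Ensures, ArithOp.eval, b2, b1.one]
    refine ⟨by omega, by simp [b3, b1.one, hnw], hQ _ ?_ ?_ ?_ ?_⟩
    · exact b1.congr fun x hx => by
        rw [Memory.set_reg, if_neg (by omega), Memory.set_reg, if_neg (by omega)]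
    · simp
    · simp [b3, b1.one]
    · exact b4
  refine ensures_guardProg (hM.frame f1 (by omega)) (e1.trans ha) hlam (by omega) hN le_rfl ?_ ?_
  · intro M2 f2 hs e2
    have hanti : Antitone lam := antitone_of_succ fun s h => hs s h (by omega)
    have f3 := (f1.trans f2 (n := 7) (by omega) (by omega)).set (n := 7) le_rfl (x := 6)
      (by omega) (by omega) 0
    have hsum : ((moveCodes k).map (moveWeight m lam)).sum = moveCount (m + 1) lam :=
      moveCount_succ.symm
    have hc := hcount _ hdiv lam
    refine ⟨by positivity, ensures_sumProg hk (hM.frame f3 (by omega))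
      ((f3.2 10 (by omega)).trans (hi.trans ha)) hanti hlam hdiv hw.le hS ?_
      (hcount m (by omega)) (fun _ h => h) ?_ ?_⟩
    · intro nu hnu
      rw [f3.1, hT m (by omega) nu hnu, if_pos]
      refine (address_lt hnu).trans_le ?_
      rw [ha, address]
      omega
    · rw [hsum]; simpa using hc
    · intro M4 f4 e4
      have f5 := f3.trans f4 (n := 7) le_rfl le_rfl
      have e10 := f5.2 10 (by omega)
      have e6 : M4.reg 6 = moveCount (m + 1) lam := by rw [e4, hsum]; simp
      simp only [block, Ensures, e10, hi, e6]
      refine ⟨by omega, ?_⟩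
      refine last _ ((hM.frame f5 (by omega)).congr fun x _ => rfl) (e10.trans hi)
        ((f5.2 11 (by omega)).trans hn) ?_
      refine TableBelow.put ?_ ha hlam
      intro m' hm' lam' hlam'
      rw [f5.1]
      exact hT m' hm' lam' hlam'
  · intro M2 f2 hanti
    have f3 := f1.trans f2 (n := 7) (by omega) (by omega)
    refine last _ (hM.frame f3 (by omega)) ((f3.2 10 (by omega)).trans hi)
      ((f3.2 11 (by omega)).trans hn) ?_
    refine TableBelow.skip ?_ ha hlam (codeCount_of_not_antitone hanti)
    intro m' hm' lam' hlam'
    rw [f3.1]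
    exact hT m' hm' lam' hlam'

theorem address_eq_zero (hN : 0 < N) (h : address N 0 lam = 0) (hlam : ∀ r, lam r < N) :
    lam = 0 := by
  refine (address_inj hlam (m := 0) (m' := 0) (mu := 0) (fun _ => hN) ?_).2
  rw [h]
  simp [address]

/-- With no moves left, only the empty shape has a walk. Its address is 0, and the rest of the first
layer consists of initial zeros. -/
theorem ensures_tableStart (hk : 2 ≤ k) (hN : 1 ≤ N) (hw : N ^ k < 2 ^ w) (hS : N ^ k ≤ S)
    (hQ : ∀ M', BaseRegs k N M' → M'.reg 10 = N ^ (k - 1) →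
      M'.reg 11 = N ^ k - N ^ (k - 1) → TableBelow k N (N ^ (k - 1)) M' → Q M') :
    Ensures S w tab (tableStart k) Q (inputMemory N) := by
  have hpow : ∀ s ≤ k, N ^ s ≤ N ^ k := fun s hs => Nat.pow_le_pow_right hN hs
  have h1 := hpow 1 (by omega)
  rw [pow_one] at h1
  have h0 := hpow 0 (by omega)
  have h2 := hpow (k - 1) (by omega)
  have hQN : N ^ (k - 1) * N = N ^ k := by rw [← pow_succ, Nat.sub_add_cancel (by omega)]
  refine ensures_baseProg (by omega) (by omega) (fun s hs => (hpow s (by omega)).trans_lt hw) ?_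
  intro M a b c
  have hp := b.pow (k - 1) le_rfl
  simp only [block, Ensures, ArithOp.eval, b.zero, b.one, Memory.put_reg, hp, add_zero]
  have hb : BaseRegs k N (M.put 0 0 1) := b.congr fun x _ => rfl
  have hb2 := hb.frame (frame_set _ (x := 10) (n := 11) (by omega) (by omega) (N ^ (k - 1)))
    (by omega)
  rw [hb2.input, hb2.pow (k - 1) le_rfl, hQN]
  refine ⟨by omega, by omega, by omega, ?_⟩
  have hb3 := hb2.frame (frame_set _ (x := 11) (n := 12) (by omega) (by omega) (N ^ k))
    (by omega)
  rw [hb3.pow (k - 1) le_rfl, Memory.set_reg, if_pos rfl]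
  refine ⟨by omega, hQ _ (hb3.frame (frame_set _ (by omega) (by omega) _) le_rfl) (by simp)
    (by simp) ?_⟩
  intro m hm lam hlam
  simp only [Memory.set_arr]
  rw [Memory.put_arr, a]
  by_cases h : address N m lam = 0
  · have hm0 : m = 0 := by
      by_contra hne
      have : 0 < m * N ^ (k - 1) := by positivity
      rw [address] at h
      omega
    subst hm0
    have := address_eq_zero hN h hlam
    subst this
    rw [if_pos ⟨rfl, h⟩, h, if_pos (by positivity)]
    simp [moveCount, codeCount]
  · rw [if_neg (by simp [h])]
    split_ifs with hlt
    · have hm0 : m = 0 := by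
        by_contra hne
        have : N ^ (k - 1) ≤ m * N ^ (k - 1) := Nat.le_mul_of_pos_left _ (by omega)
        rw [address] at hlt
        omega
      subst hm0
      rw [moveCount, codeCount, if_neg]
      rintro rfl
      exact h (by simp [address])
    · rfl

/-- The program that computes the table is correct, with bounds for its time and space. -/
theorem reaches_tableProg (hk : 2 ≤ k) (hN : 1 ≤ N) (hw : N ^ k < 2 ^ w) (hS : N ^ k ≤ S)
    (hcount : ∀ m < N, ∀ nu : Rows k, moveCount m nu < 2 ^ w) :
    Reaches S w tab (tableProg k)
      ((tableStart k).cost + 2 + N ^ k * ((entryProg k).cost + 1))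
      (fun M => ∀ m < N, ∀ lam : Rows k, (∀ r, lam r < N) →
        M.arr 0 (address N m lam) = moveCount m lam) (inputMemory N) := by
  set n := N ^ k - N ^ (k - 1) with hn
  have h2 : N ^ (k - 1) ≤ N ^ k := Nat.pow_le_pow_right hN (by omega)
  refine Reaches.mono (t := 1 + (tableStart k).cost + (n * ((entryProg k).cost + 1) + 1)) ?_ ?_
    fun _ h => h
  · refine Reaches.seq (Ensures.reaches ?_)
    refine ensures_tableStart hk hN hw hS fun M b1 b2 b3 b4 => ?_
    -- Register 11 counts the `n` entries still to be computed, so the next address is `N ^ k - n`.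
    refine Reaches.loop (fun n M => n ≤ N ^ k - N ^ (k - 1) ∧ BaseRegs k N M ∧
      M.reg 10 = N ^ k - n ∧ M.reg 11 = n ∧ TableBelow k N (N ^ k - n) M) ?_ ?_
      ⟨hn.le, b1, by omega, b3, ?_⟩
    · rintro n M ⟨c1, c2, c3, c4, c5⟩
      refine ⟨by omega, Ensures.reaches ?_⟩
      refine ensures_entryProg hk c2 c3 c4 (by omega) (by omega) hw (by omega) hS c5 hcount ?_
      intro M' d1 d2 d3 d4
      rw [show N ^ k - (n + 1) + 1 = N ^ k - n by omega] at d2 d4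
      exact ⟨by omega, d1, d2, d3, d4⟩
    · rintro M ⟨-, -, -, c4, c5⟩
      refine ⟨c4, fun m hm lam hlam => ?_⟩
      rw [c5 m hm lam hlam, if_pos (by simpa using address_lt_pow hk hlam hm)]
    · rw [hn, show N ^ k - (N ^ k - N ^ (k - 1)) = N ^ (k - 1) by omega]
      exact b4
  · have : n * ((entryProg k).cost + 1) ≤ N ^ k * ((entryProg k).cost + 1) :=
      Nat.mul_le_mul_right _ (by omega)
    omega

end

end

noncomputable section

/-! ## Tableaux between the steps of a walk -/

/-- The tableau after `i` steps has the shape of the walk, and its entries are vertices. -/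
structure HalfTab {k : ℕ} (X : ℕ → Rows k) (i : ℕ) : Prop where
  isTab : IsTab (tableauAt X i)
  few : FewRows k (tableauAt X i)
  shape : shapeOf k (tableauAt X i) = X i
  entries : ∀ r, ∀ z ∈ tableauAt X i r, 1 ≤ z ∧ z ≤ (i + 1) / 2

theorem halfTab {k n : ℕ} {X : ℕ → Rows k} {nu : Rows k} (hX : X ∈ loopFreeWalks k n 0 nu) {i : ℕ}
    (hi : i ≤ 2 * n) : HalfTab X i := by
  rcases Nat.even_or_odd' i with ⟨v, rfl | rfl⟩
  · have h := walkTab hX (v := v) (by omega)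
    refine ⟨h.isTab, h.few, h.shape, fun r z hz => ?_⟩
    have := h.entries r z hz
    omega
  · have h := walkTab hX (v := v) (by omega)
    obtain ⟨hs, -, h1, -⟩ := h.step le_rfl hX (by omega)
    refine ⟨hs.isTab_mid, hs.few_mid, h1, fun r z hz => ?_⟩
    rcases hs.new_mid r z hz with rfl | ⟨s, hs⟩
    · omega
    · have := h.entries s z hs
      omega

/-- The entries of a row are distinct vertices met so far. For the walks of the sampler this keeps
all digits below `N`. -/
theorem HalfTab.le {k : ℕ} {X : ℕ → Rows k} {i : ℕ} (h : HalfTab X i) (r : Fin (k - 1)) :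
    X i r ≤ (i + 1) / 2 := by
  rw [← h.shape, shapeOf]
  have : tableauAt X i (r + 1) ⊆ Finset.Icc 1 ((i + 1) / 2) := fun z hz =>
    Finset.mem_Icc.mpr (h.entries _ z hz)
  simpa using Finset.card_le_card this

/-- A vertex whose second step adds a square has an idle first step, so the vertex is not yet an
entry. This matters for the binary coding, where adding an entry that is already present would cause
a carry. -/
theorem notMem_of_grow {k n : ℕ} {X : ℕ → Rows k} {nu : Rows k}
    (hX : X ∈ loopFreeWalks k n 0 nu) {i : ℕ} (hi : i < 2 * n) {j : Fin (k - 1)}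
    (h : X (i + 1) = X i + box j) (s : ℕ) : i / 2 + 1 ∉ tableauAt X i s := by
  intro hm
  rcases Nat.even_or_odd' i with ⟨v, rfl | rfl⟩
  · have := (halfTab hX hi.le).entries s _ hm
    omega
  · have hstay : X (2 * v + 1) = X (2 * v) := by
      rcases hX.2.2.2.2 v (by omega) with ⟨a, h1, h2⟩ | ⟨h1, -⟩ | ⟨h1, -⟩ | ⟨a, b, h1, h2, -⟩
      · exact absurd (h.symm.trans h2) (add_box_ne _ _)
      · exact h1
      · exact h1
      · refine absurd ?_ (add_add_box_ne (X (2 * v + 1)) j b)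
        rw [← h]
        exact h2.symm
    rw [tableauAt_odd, hstay, tableauStep_stay] at hm
    have := (halfTab hX (i := 2 * v) (by omega)).entries s _ hm
    omega

/-! ## Rows as natural numbers -/

/-- The natural number with binary digits `1` at the elements of `S`. -/
def bits (S : Finset ℕ) : ℕ := ∑ z ∈ S, 2 ^ z

theorem bits_insert {S : Finset ℕ} {x : ℕ} (h : x ∉ S) : bits (insert x S) = bits S + 2 ^ x := by
  rw [bits, Finset.sum_insert h, add_comm, bits]

theorem bits_erase {S : Finset ℕ} {x : ℕ} (h : x ∈ S) : bits (S.erase x) = bits S - 2 ^ x := by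
  conv_rhs => rw [← Finset.insert_erase h]
  rw [bits_insert (Finset.notMem_erase x S), Nat.add_sub_cancel]

theorem bits_lt {S : Finset ℕ} {n : ℕ} (h : ∀ z ∈ S, z < n) : bits S < 2 ^ n :=
  Nat.geomSum_lt le_rfl h

theorem two_pow_le_bits {S : Finset ℕ} {x : ℕ} (h : x ∈ S) : 2 ^ x ≤ bits S :=
  Finset.single_le_sum (f := fun z => 2 ^ z) (fun _ _ => Nat.zero_le _) h

/-- The entries from `x` on contribute multiples of `2 ^ x`. With `log_bits`, the largest entry
below `x` is found by a remainder and a leading digit. -/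
theorem bits_mod (S : Finset ℕ) (x : ℕ) : bits S % 2 ^ x = bits (S.filter (· < x)) := by
  have h : bits S = bits (S.filter (· < x)) + bits (S.filter fun z => ¬ z < x) :=
    (Finset.sum_filter_add_sum_filter_not S (· < x) _).symm
  have hd : 2 ^ x ∣ bits (S.filter fun z => ¬ z < x) := by
    apply Finset.dvd_sum
    intro z hz
    rw [Finset.mem_filter] at hz
    exact pow_dvd_pow 2 (by omega)
  rw [h, Nat.add_mod, Nat.mod_eq_zero_of_dvd hd, add_zero, Nat.mod_mod]
  apply Nat.mod_eq_of_lt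
  apply bits_lt
  intro z hz
  exact (Finset.mem_filter.mp hz).2

theorem log_bits {S : Finset ℕ} (h : S.Nonempty) : Nat.log 2 (bits S) = S.sup id := by
  apply Nat.log_eq_of_pow_le_of_lt_pow
  · exact two_pow_le_bits (sup_id_mem h)
  · exact bits_lt fun z hz => Nat.lt_succ_of_le (Finset.le_sup (f := id) hz)

end

noncomputable section

/-! ## The steps of the sampler -/

/-- Reverse row insertion into the rows `1, …, r`, which are in the registers `21, 23, …`; the
entry is in register `1`, and the power of two with this exponent in register `2`. -/
def bumpProg : ℕ → Program
  | 0 => .skip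
  | r + 1 => block [.arith .rest 3 (2 * r + 21) 2, .arith .lead 1 3 3,
      .arith .plus (2 * r + 21) (2 * r + 21) 2, .load 2 2 1,
      .arith .minus (2 * r + 21) (2 * r + 21) 2, bumpProg r]

/-- Append the first `n` digits of the address in register `10` to the array `1`. -/
def writeProg : ℕ → Program
  | 0 => .skip
  | r + 1 => .seq (writeProg r)
      (block [.arith .plus 1 10 18, digitProg 2 r, .store 1 16 2, .arith .plus 16 16 17])

/-- Add a square to row `j + 1`. -/
def growProg (j : ℕ) : Program :=
  block [.arith .plus 10 10 (2 * j + 20), .arith .plus (2 * j + 21) (2 * j + 21) 15]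

/-- Remove a square from row `j + 1`. -/
def shrinkProg (j : ℕ) : Program :=
  block [.arith .lead 1 (2 * j + 21) 18, .load 2 2 1,
    .arith .minus (2 * j + 21) (2 * j + 21) 2, bumpProg j, .arith .plus 3 14 17, .store 0 1 3,
    .arith .minus 10 10 (2 * j + 20)]

/-- The first step of a move. -/
def firstHalf {k : ℕ} : Code k → Program
  | (some a, some _) => growProg a
  | (none, some b) => shrinkProg b
  | (_, none) => .skip

/-- The second step of a move. -/
def secondHalf {k : ℕ} : Code k → Program
  | (some _, some b) => shrinkProg b
  | (some a, none) => growProg a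
  | (none, _) => .skip

/-- Row `r + 1` of the tableau is in register `2 * r + 21`. -/
def RowRegs (k : ℕ) (T : ℕ → Finset ℕ) (M : Memory) : Prop :=
  ∀ r : Fin (k - 1), M.reg (2 * r + 21) = bits (T (r + 1))

/-- The memories agree except for the rows of the tableau and the registers `1`, `2`, `3`. -/
def RowFrame (M M' : Memory) : Prop :=
  M'.arr = M.arr ∧ ∀ x, x = 0 ∨ (4 ≤ x ∧ x ≤ 20) ∨ (20 ≤ x ∧ x % 2 = 0) → M'.reg x = M.reg x

theorem RowFrame.refl (M : Memory) : RowFrame M M := ⟨rfl, fun _ _ => rfl⟩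

theorem RowFrame.trans {M M' M'' : Memory} (h : RowFrame M M') (h' : RowFrame M' M'') :
    RowFrame M M'' := ⟨h'.1.trans h.1, fun x hx => (h'.2 x hx).trans (h.2 x hx)⟩

theorem RowFrame.set {M M' : Memory} (h : RowFrame M M') {x : ℕ}
    (hx : x = 1 ∨ x = 2 ∨ x = 3 ∨ (21 ≤ x ∧ x % 2 = 1)) (v : ℕ) : RowFrame M (M'.set x v) := by
  refine ⟨h.1, fun y hy => ?_⟩
  rw [Memory.set_reg, if_neg (by omega)]
  exact h.2 y hy

theorem BaseRegs.rowFrame {k N : ℕ} {M M' : Memory} (h : BaseRegs k N M) (hM : RowFrame M M') :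
    BaseRegs k N M' := h.congr fun x hx => hM.2 x (by omega)

theorem RowRegs.set_of_lt {k : ℕ} {T : ℕ → Finset ℕ} {M : Memory} (h : RowRegs k T M) {x : ℕ}
    (hx : x < 21) (v : ℕ) : RowRegs k T (M.set x v) := by
  intro r
  rw [Memory.set_reg, if_neg (by omega)]
  exact h r

theorem RowRegs.set_row {k : ℕ} {T : ℕ → Finset ℕ} {M : Memory} (h : RowRegs k T M)
    {j : ℕ} {v : ℕ} {R : Finset ℕ} (hv : v = bits R) :
    RowRegs k (Function.update T (j + 1) R) (M.set (2 * j + 21) v) := by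
  intro r
  rw [Memory.set_reg, Function.update_apply]
  by_cases hr : (r : ℕ) = j
  · rw [if_pos (by omega), if_pos (by omega), hv]
  · rw [if_neg (by omega), if_neg (by omega)]
    exact h r

section

variable {S w k N m : ℕ} {tab : ℕ → ℕ → ℕ} {lam : Rows k} {M : Memory} {Q : Memory → Prop}

/-- The gap condition provides an entry below `x` in the row, so the remainder is not 0 and its
leading digit is the entry to be replaced. Between the addition and the subtraction a row below `2 ^
(v + 1)` grows by at most `2 ^ v`; hence the bound `2 ^ (v + 2)`. -/
theorem ensures_bumpProg {v r x : ℕ} {T : ℕ → Finset ℕ} (hr : r ≤ k - 1) (hT : IsTab T)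
    (hx : Gap r T x) (h1 : M.reg 1 = x) (h2 : M.reg 2 = 2 ^ x) (hR : RowRegs k T M)
    (hpow : ∀ z ≤ v, M.arr 2 z = 2 ^ z) (hv : ∀ s, ∀ z ∈ T s, z ≤ v) (hxv : x ≤ v)
    (hw : 2 ^ (v + 2) ≤ 2 ^ w) (hS : v < S)
    (hQ : ∀ M', RowFrame M M' → M'.reg 1 = (bump r T x).2 → RowRegs k (bump r T x).1 M' → Q M') :
    Ensures S w tab (bumpProg r) Q M := by
  induction r generalizing M T x with
  | zero => exact hQ M (RowFrame.refl M) h1 hR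
  | succ r ih =>
    have hs := hx.rowSwap
    obtain ⟨hT', hx'⟩ := hT.reverse_step hx hs
    rw [bump_succ] at hQ
    set y := bumped (T (r + 1)) x with hy
    have hyv : y ≤ v := hv _ y hs.mem
    have hrow : M.reg (2 * r + 21) = bits (T (r + 1)) := hR ⟨r, by omega⟩
    have hlog : Nat.log 2 (bits (T (r + 1)) % 2 ^ x) = y := by
      rw [bits_mod, log_bits]
      · rfl
      · exact ⟨y, by simp [hs.mem, hs.lt]⟩
    have hb : bits (T (r + 1)) < 2 ^ (v + 1) := bits_lt fun z hz => Nat.lt_succ_of_le (hv _ z hz)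
    have hm := Nat.mod_le (bits (T (r + 1))) (2 ^ x)
    have hvp : v < 2 ^ v := Nat.lt_two_pow_self
    have hvp1 : 2 ^ (v + 1) = 2 * 2 ^ v := pow_succ' 2 v
    have hvp2 : 2 ^ (v + 2) = 2 * 2 ^ (v + 1) := pow_succ' 2 (v + 1)
    have hxp : 2 ^ x ≤ 2 ^ v := Nat.pow_le_pow_right (by omega) hxv
    have hy0 : 0 < 2 ^ y := by positivity
    have hyp : 2 ^ y ≤ 2 ^ v := Nat.pow_le_pow_right (by omega) hyv
    have hnew : bits (T (r + 1)) + 2 ^ x - 2 ^ y = bits (insert x ((T (r + 1)).erase y)) := by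
      rw [bits_insert (by simp [hs.notMem]), bits_erase hs.mem]
      have := two_pow_le_bits hs.mem
      omega
    have n3 : ¬ (2 * r + 21 = 3) := by omega
    have n1 : ¬ (2 * r + 21 = 1) := by omega
    have n2 : ¬ (2 * r + 21 = 2) := by omega
    have m2 : ¬ (2 = 2 * r + 21) := by omega
    have m1 : ¬ (1 = 2 * r + 21) := by omega
    simp only [bumpProg, block, Ensures, ArithOp.eval, hrow, h2, Memory.set_reg, if_true, hlog,
      n1, n2, n3, m1, m2, if_false, Memory.set_arr, hpow y hyv,
      show (2 : ℕ) = 1 ↔ False by simp, show (2 : ℕ) = 3 ↔ False by simp, hnew]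
    refine ⟨by omega, by omega, by omega, by omega, by omega, by omega, ?_⟩
    refine ih (by omega) hT' hx' ?_ ?_ ?_ hpow ?_ hyv ?_
    · simp
    · simp
    · intro s
      rw [Memory.set_reg, Function.update_apply]
      by_cases hsr : (s : ℕ) = r
      · rw [if_pos (by omega), if_pos (by omega)]
      · rw [if_neg (by omega), if_neg (by omega), Memory.set_reg, if_neg (by omega),
          Memory.set_reg, if_neg (by omega), Memory.set_reg, if_neg (by omega),
          Memory.set_reg, if_neg (by omega)]
        exact hR s
    · intro s z hz
      rw [Function.update_apply] at hz
      split_ifs at hz with h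
      · rcases Finset.mem_insert.mp hz with rfl | hz
        · exact hxv
        · exact hv _ z (Finset.mem_of_mem_erase hz)
      · exact hv s z hz
    · intro M' f e1 e2
      refine hQ M' (RowFrame.trans ?_ f) e1 e2
      exact (((((RowFrame.refl M).set (by omega) _).set (by omega) _).set (by omega) _).set
        (by omega) _).set (by omega) _

theorem ensures_writeProg (hM : BaseRegs k N M) {p : ℕ} (ha : M.reg 10 = address N m lam)
    (hp : M.reg 16 = p) (hlam : ∀ r, lam r < N) (hw : address N m lam < 2 ^ w) {n : ℕ}
    (hn : n ≤ k - 1) (hpw : p + n < 2 ^ w) (hpS : p + n ≤ S)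
    (hQ : ∀ M', (∀ x, x = 0 ∨ (3 ≤ x ∧ x ≠ 16) → M'.reg x = M.reg x) → M'.reg 16 = p + n →
      (∀ b, b ≠ 1 → M'.arr b = M.arr b) →
      (∀ q, q < p ∨ p + n ≤ q → M'.arr 1 q = M.arr 1 q) →
      (∀ r : Fin (k - 1), (r : ℕ) < n → M'.arr 1 (p + r) = lam r) → Q M') :
    Ensures S w tab (writeProg n) Q M := by
  induction n generalizing Q with
  | zero => exact hQ M (fun _ _ => rfl) hp (fun _ _ => rfl) (fun _ _ => rfl) fun r hr => by omega
  | succ n ih =>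
    refine ih (by omega) (by omega) (by omega) fun M1 a1 a2 a3 a4 a5 => ?_
    have hM1 : BaseRegs k N M1 := hM.congr fun x hx => a1 x (by omega)
    have e10 := a1 10 (by omega)
    rw [block, Ensures, Ensures, ArithOp.eval, hM1.zero, add_zero, e10, ha]
    refine ⟨hw, ?_⟩
    have f1 := frame_set M1 (x := 1) (n := 3) (by omega) (by omega) (address N m lam)
    have hM2 := hM1.frame f1 (by omega)
    have e1 : (M1.set 1 (address N m lam)).reg 1 = address N m lam := by simp
    generalize M1.set 1 (address N m lam) = M2 at *
    refine ensures_digitProg (by omega) hM2 e1 hlam (by rwa [e1]) (⟨n, by omega⟩ : Fin (k - 1)) ?_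
    have f2 := (f1.set (n := 3) le_rfl (x := 2) (by omega) (by omega) (M2.reg 1 / N ^ n)).set
      (n := 3) le_rfl (x := 2) (by omega) (by omega) (lam ⟨n, by omega⟩)
    have e2 : ((M2.set 2 (M2.reg 1 / N ^ n)).set 2 (lam ⟨n, by omega⟩)).reg 2 =
      lam ⟨n, by omega⟩ := by simp
    dsimp only
    generalize (M2.set 2 (M2.reg 1 / N ^ n)).set 2 (lam ⟨n, by omega⟩) = M3 at *
    have hM3 := hM1.frame f2 (by omega)
    have e16 : M3.reg 16 = p + n := (f2.2 16 (by omega)).trans a2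
    simp only [block, Ensures, ArithOp.eval, Memory.put_reg, e16, e2, hM3.one]
    refine ⟨by omega, by omega, hQ _ ?_ ?_ ?_ ?_ ?_⟩
    · intro x hx
      rw [Memory.set_reg, if_neg (by omega), Memory.put_reg, f2.2 x (by omega)]
      exact a1 x hx
    · simp; ring
    · intro b hb
      rw [Memory.set_arr, ← a3 b hb, ← f2.1]
      funext q
      rw [Memory.put_arr, if_neg (by tauto)]
    · intro q hq
      rw [Memory.set_arr, Memory.put_arr, if_neg (by omega), f2.1]
      exact a4 q (by omega)
    · intro r hr
      rw [Memory.set_arr, Memory.put_arr]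
      by_cases h : (r : ℕ) = n
      · subst h
        simp
      · rw [if_neg (by omega), f2.1]
        exact a5 r (by omega)

/-- The memory of the sampler after `i` steps of the walk `X`, at the vertex `v`, if `i'` shapes
after the first one have been written. -/
structure WalkState {k : ℕ} (N : ℕ) (X : ℕ → Rows k) (m u n v i i' : ℕ) (M : Memory) : Prop where
  base : BaseRegs k N M
  addr : M.reg 10 = address N m (X i)
  rows : RowRegs k (tableauAt X i) M
  pointer : M.reg 16 = (k - 1) * (i' + 1)
  vertex : M.reg 14 = v
  digit : M.reg 15 = 2 ^ v
  draw : M.reg 7 = u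
  left : M.reg 11 = n
  pow : ∀ z ≤ v, M.arr 2 z = 2 ^ z
  walk : ∀ l ≤ i', ∀ r : Fin (k - 1), M.arr 1 ((k - 1) * l + r) = X l r
  arcs : ∀ e c, 0 < c → (M.arr 0 e = c ↔ ∃ l < i, l / 2 + 2 = c ∧
    (tableauStep (l / 2 + 1) (X l) (X (l + 1)) (tableauAt X l)).2 = some e)

variable {X : ℕ → Rows k} {u n v i i' : ℕ}

theorem tableauAt_succ (X : ℕ → Rows k) (i : ℕ) : tableauAt X (i + 1) =
    (tableauStep (i / 2 + 1) (X i) (X (i + 1)) (tableauAt X i)).1 := rfl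

theorem arcs_of_none (h : ∀ e c, 0 < c → (M.arr 0 e = c ↔ ∃ l < i, l / 2 + 2 = c ∧
      (tableauStep (l / 2 + 1) (X l) (X (l + 1)) (tableauAt X l)).2 = some e))
    (h0 : (tableauStep (i / 2 + 1) (X i) (X (i + 1)) (tableauAt X i)).2 = none) (e c : ℕ)
    (hc : 0 < c) : M.arr 0 e = c ↔ ∃ l < i + 1, l / 2 + 2 = c ∧
      (tableauStep (l / 2 + 1) (X l) (X (l + 1)) (tableauAt X l)).2 = some e := by
  rw [h e c hc]
  constructor
  · rintro ⟨l, h1, h2⟩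
    exact ⟨l, by omega, h2⟩
  · rintro ⟨l, h1, h2, h3⟩
    rcases Nat.lt_succ_iff_lt_or_eq.mp h1 with h4 | rfl
    · exact ⟨l, h4, h2, h3⟩
    · rw [h0] at h3
      cases h3

theorem WalkState.stay (h : WalkState N X m u n v i i' M) (hX : X (i + 1) = X i) :
    WalkState N X m u n v (i + 1) i' M := by
  have hs : tableauStep (i / 2 + 1) (X i) (X (i + 1)) (tableauAt X i) = (tableauAt X i, none) := by
    rw [hX, tableauStep_stay]
  refine { h with addr := ?_, rows := ?_, arcs := ?_ }
  · rw [hX]; exact h.addr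
  · rw [tableauAt_succ, hs]; exact h.rows
  · exact arcs_of_none h.arcs (by rw [hs])

theorem ensures_growProg {L : ℕ} (hX : X ∈ loopFreeWalks k L 0 0) (hi : i < 2 * L)
    (hv : v = i / 2 + 1) (h : WalkState N X m u n v i i' M) {j : Fin (k - 1)}
    (hj : X (i + 1) = X i + box j) (hw : 2 ^ (v + 2) ≤ 2 ^ w)
    (haw : address N m (X (i + 1)) < 2 ^ w)
    (hQ : ∀ M', WalkState N X m u n v (i + 1) i' M' → Q M') :
    Ensures S w tab (growProg j) Q M := by
  have hs : tableauStep (i / 2 + 1) (X i) (X (i + 1)) (tableauAt X i) =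
      (Function.update (tableauAt X i) (j + 1) (insert v (tableauAt X i (j + 1))), none) := by
    rw [hj, tableauStep_add, hv]
  have hnot : v ∉ tableauAt X i (j + 1) := hv ▸ notMem_of_grow hX hi hj _
  have hT := halfTab hX hi.le
  have hp : M.reg (2 * j + 20) = N ^ (j : ℕ) := h.base.pow j (by omega)
  have hrow := h.rows j
  have hb : bits (tableauAt X i (j + 1)) < 2 ^ (v + 1) := bits_lt fun z hz => by
    have := hT.entries _ z hz; omega
  have hvp1 : 2 ^ (v + 1) = 2 * 2 ^ v := pow_succ' 2 v
  have hvp2 : 2 ^ (v + 2) = 2 * 2 ^ (v + 1) := pow_succ' 2 (v + 1)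
  have ha : address N m (X i) + N ^ (j : ℕ) = address N m (X (i + 1)) := by
    rw [hj, address_add_box]
  have n1 : ¬ (2 * (j : ℕ) + 21 = 10) := by omega
  simp only [growProg, block, Ensures, ArithOp.eval, hp, h.addr, ha, Memory.set_reg, n1, if_false,
    hrow, h.digit, show (15 : ℕ) = 10 ↔ False by simp]
  refine ⟨haw, by omega, hQ _ ?_⟩
  have reg : ∀ x : ℕ, x ≠ 10 → x ≠ 2 * j + 21 → ((M.set 10 (address N m (X (i + 1)))).set
      (2 * j + 21) (bits (tableauAt X i (j + 1)) + 2 ^ v)).reg x = M.reg x := by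
    intro x h1 h2
    rw [Memory.set_reg, if_neg h2, Memory.set_reg, if_neg h1]
  refine ⟨h.base.congr fun x hx => reg x (by omega) (by omega), ?_, ?_,
    (reg _ (by omega) (by omega)).trans h.pointer, (reg _ (by omega) (by omega)).trans h.vertex,
    (reg _ (by omega) (by omega)).trans h.digit, (reg _ (by omega) (by omega)).trans h.draw,
    (reg _ (by omega) (by omega)).trans h.left, h.pow, h.walk, ?_⟩
  · rw [Memory.set_reg, if_neg (by omega), Memory.set_reg, if_pos rfl]
  · rw [tableauAt_succ, hs]
    exact (h.rows.set_of_lt (by omega) _).set_row (bits_insert hnot).symm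
  · exact arcs_of_none h.arcs (by rw [hs])

/-- The next member of the walk is a shape, so the square is a corner, and its entry is the leading
digit of the row. The number stored is `v + 1`, since the arc (y, v) of the braid is the arc (y,
v+1) of the partition. -/
theorem ensures_shrinkProg {L : ℕ} (hX : X ∈ loopFreeWalks k L 0 0) (hi : i < 2 * L)
    (hv : v = i / 2 + 1) (h : WalkState N X m u n v i i' M) {j : Fin (k - 1)}
    (hj : X i = X (i + 1) + box j) (hw : 2 ^ (v + 2) ≤ 2 ^ w)
    (haw : address N m (X i) < 2 ^ w) (hS : v < S)
    (hQ : ∀ M', WalkState N X m u n v (i + 1) i' M' → Q M') :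
    Ensures S w tab (shrinkProg j) Q M := by
  set T := tableauAt X i with hTdef
  have hs : tableauStep (i / 2 + 1) (X i) (X (i + 1)) T =
      ((removeRow j T).1, some (removeRow j T).2) := by
    conv_lhs => rw [hj]
    rw [tableauStep_remove]
  have hT := halfTab hX hi.le
  have hc : (T (j + 2)).card < (T (j + 1)).card :=
    corner_of_antitone hT.few (hX.2.2.1 (i + 1)) (hT.shape.trans hj)
  obtain ⟨hT1, hgap⟩ := hT.isTab.erase_last hc
  have hne : (T (j + 1)).Nonempty := Finset.card_pos.mp (by omega)
  have hrow := h.rows j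
  have hent : ∀ s, ∀ z ∈ T s, z ≤ v := fun s z hz => by
    have := hT.entries s z hz; omega
  set x := (T (j + 1)).sup id with hx
  have hxm : x ∈ T (j + 1) := sup_id_mem hne
  have hxv : x ≤ v := hent _ x hxm
  have hlog := log_bits hne
  have hb : bits (T (j + 1)) < 2 ^ (v + 1) := bits_lt fun z hz => Nat.lt_succ_of_le (hent _ z hz)
  have hvp : v < 2 ^ v := Nat.lt_two_pow_self
  have hvp1 : 2 ^ (v + 1) = 2 * 2 ^ v := pow_succ' 2 v
  have hvp2 : 2 ^ (v + 2) = 2 * 2 ^ (v + 1) := pow_succ' 2 (v + 1)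
  have hxp : 2 ^ x ≤ 2 ^ v := Nat.pow_le_pow_right (by omega) hxv
  have hx0 : 0 < 2 ^ x := by positivity
  have n1 : ¬ (2 * (j : ℕ) + 21 = 1) := by omega
  have n2 : ¬ (2 * (j : ℕ) + 21 = 2) := by omega
  rw [← hTdef] at hrow
  simp only [shrinkProg, block, Ensures, ArithOp.eval, hrow, hlog, ← hx, Memory.set_reg, if_true,
    Memory.set_arr, h.pow x hxv, n1, n2, if_false]
  refine ⟨by omega, by omega, by omega, by omega, ?_⟩
  refine ensures_bumpProg (k := k) (v := v) (r := j) (x := x) (by omega) hT1 hgap ?_ ?_ ?_ h.pow ?_ hxv hw hS ?_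
  · rw [Memory.set_reg, if_neg (by omega)]; simp
  · rw [Memory.set_reg, if_neg (by omega)]; simp
  · exact ((h.rows.set_of_lt (x := 1) (by omega) _).set_of_lt (x := 2) (by omega) _).set_row (bits_erase hxm).symm
  · intro s z hz
    rw [Function.update_apply] at hz
    split_ifs at hz
    · exact hent _ z (Finset.mem_of_mem_erase hz)
    · exact hent _ z hz
  intro M' f e1 e2
  change M'.reg 1 = (removeRow j T).2 at e1
  change RowRegs k (removeRow j T).1 M' at e2
  replace f : RowFrame M M' := RowFrame.trans
    ((((RowFrame.refl M).set (by omega) _).set (by omega) _).set (by omega) _) f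
  set y := (removeRow j T).2 with hy
  have hyx : y ≤ x := (removeRow_spec hT.isTab hc).2.2.2.2.1
  have hM' := h.base.rowFrame f
  have hp : M'.reg (2 * j + 20) = N ^ (j : ℕ) := hM'.pow j (by omega)
  have r14 : M'.reg 14 = v := (f.2 14 (by omega)).trans h.vertex
  have r10 : M'.reg 10 = address N m (X i) := (f.2 10 (by omega)).trans h.addr
  have n3 : ¬ (2 * (j : ℕ) + 20 = 3) := by omega
  have ha : address N m (X i) - N ^ (j : ℕ) = address N m (X (i + 1)) := by
    rw [hj, address_add_box, Nat.add_sub_cancel]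
  simp only [Memory.set_reg, Memory.put_reg, r14, hM'.one, e1, n3, if_false, hp, r10, ha,
    show (1 : ℕ) = 3 ↔ False by simp, show (10 : ℕ) = 3 ↔ False by simp]
  refine ⟨by omega, by omega, by omega, hQ _ ?_⟩
  set M1 := ((M'.set 3 (v + 1)).put 0 y (v + 1)).set 10 (address N m (X (i + 1))) with hM1
  have reg : ∀ x : ℕ, x ≠ 10 → x ≠ 3 → M1.reg x = M'.reg x := by
    intro x h1 h2
    rw [hM1, Memory.set_reg, if_neg h1, Memory.put_reg, Memory.set_reg, if_neg h2]
  have arr : ∀ b q, b ≠ 0 → M1.arr b q = M.arr b q := by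
    intro b q hb
    rw [hM1, Memory.set_arr, Memory.put_arr, if_neg (by tauto), Memory.set_arr, f.1]
  have reg' : ∀ x, x ≠ 10 → 4 ≤ x → x ≤ 20 → M1.reg x = M.reg x := fun x h1 h2 h3 =>
    (reg x h1 (by omega)).trans (f.2 x (by omega))
  refine ⟨hM'.congr fun x hx => reg x (by omega) (by omega), ?_, ?_,
    (reg' _ (by omega) (by omega) (by omega)).trans h.pointer,
    (reg' _ (by omega) (by omega) (by omega)).trans h.vertex,
    (reg' _ (by omega) (by omega) (by omega)).trans h.digit,
    (reg' _ (by omega) (by omega) (by omega)).trans h.draw,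
    (reg' _ (by omega) (by omega) (by omega)).trans h.left,
    fun z hz => (arr _ _ (by omega)).trans (h.pow z hz),
    fun l hl r => (arr _ _ (by omega)).trans (h.walk l hl r), ?_⟩
  · rw [hM1, Memory.set_reg, if_pos rfl]
  · rw [tableauAt_succ, ← hTdef, hs]
    exact fun r => (reg _ (by omega) (by omega)).trans (e2 r)
  · intro e c hc
    have hstep : (tableauStep (i / 2 + 1) (X i) (X (i + 1)) (tableauAt X i)).2 = some y := by
      rw [← hTdef, hs]
    rw [hM1, Memory.set_arr, Memory.put_arr, Memory.set_arr, f.1]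
    by_cases he : e = y
    · subst he
      rw [if_pos ⟨rfl, rfl⟩]
      constructor
      · rintro rfl
        exact ⟨i, by omega, by omega, hstep⟩
      · rintro ⟨l, h1, h2, h3⟩
        -- Two reports of `y` would be two arcs with the same left end. Hence no earlier value at
        -- the index `y` is overwritten.
        have b1 : (y, l / 2 + 1) ∈ walkToBraid L X := ⟨l, by omega, rfl, h3⟩
        have b2 : (y, i / 2 + 1) ∈ walkToBraid L X := ⟨i, by omega, rfl, hstep⟩
        have := congrArg Prod.snd ((isBraid_walkToBraid hX).1.2.1 _ b1 _ b2 rfl)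
        simp only at this
        omega
    · rw [if_neg (by simp [he]), h.arcs e c hc]
      constructor
      · rintro ⟨l, h1, h2⟩
        exact ⟨l, by omega, h2⟩
      · rintro ⟨l, h1, h2, h3⟩
        rcases Nat.lt_succ_iff_lt_or_eq.mp h1 with h4 | rfl
        · exact ⟨l, h4, h2, h3⟩
        · rw [hstep] at h3
          exact absurd (Option.some.inj h3).symm he

theorem ensures_writeProg_walk (h : WalkState N X m u n v (i + 1) i M)
    (hlt : ∀ r, X (i + 1) r < N) (haw : address N m (X (i + 1)) < 2 ^ w)
    (hw : (k - 1) * (i + 2) < 2 ^ w) (hS : (k - 1) * (i + 2) ≤ S)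
    (hQ : ∀ M', WalkState N X m u n v (i + 1) (i + 1) M' → Q M') :
    Ensures S w tab (writeProg (k - 1)) Q M := by
  have e : (k - 1) * (i + 1) + (k - 1) = (k - 1) * (i + 2) := by ring
  refine ensures_writeProg h.base h.addr h.pointer hlt haw le_rfl (by omega) (by omega) ?_
  intro M' a1 a2 a3 a4 a5
  refine hQ M' ⟨h.base.congr fun x hx => a1 x (by omega), (a1 _ (by omega)).trans h.addr,
    fun r => (a1 _ (by omega)).trans (h.rows r), by rw [a2, e],
    (a1 _ (by omega)).trans h.vertex, (a1 _ (by omega)).trans h.digit,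
    (a1 _ (by omega)).trans h.draw, (a1 _ (by omega)).trans h.left, ?_, ?_, ?_⟩
  · intro z hz
    rw [a3 2 (by omega)]
    exact h.pow z hz
  · intro l hl r
    rcases Nat.lt_or_eq_of_le hl with hl | rfl
    · rw [a4 _ (Or.inl ?_)]
      · exact h.walk l (by omega) r
      · calc (k - 1) * l + r < (k - 1) * l + (k - 1) := by omega
          _ = (k - 1) * (l + 1) := by ring
          _ ≤ (k - 1) * (i + 1) := Nat.mul_le_mul_left _ hl
    · exact a5 r r.2
  · intro e c hc
    rw [a3 0 (by omega)]
    exact h.arcs e c hc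

end

end

noncomputable section

/-! ## The sampler -/

/-- Carry out a move, and go to the next layer of the table. -/
def takeProg {k : ℕ} (c : Code k) : Program :=
  block [firstHalf c, writeProg (k - 1), secondHalf c, writeProg (k - 1),
    .arith .minus 10 10 (2 * (k - 1) + 20)]

/-- Carry out the move that is determined by the number in register `7`. -/
def selectProg {k : ℕ} : List (Code k) → Program
  | [] => .skip
  | c :: cs => block [codeValue (.fetch 5 0 1) c, .arith .minus 6 5 7,
      .cond 6 (takeProg c) (block [.arith .minus 7 7 5, selectProg cs])]

/-- The moves at the next vertex. -/
def vertexProg (k : ℕ) : Program :=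
  block [.arith .plus 14 14 17, .arith .plus 15 15 15, .store 2 14 15, selectProg (moveCodes k),
    .arith .minus 11 11 17]

/-- Register `7` gets the number of walks. -/
def totalProg (k : ℕ) : Program :=
  block [baseProg k, .arith .times 13 12 (2 * (k - 1) + 20), .fetch 7 0 13]

/-- Prepare the memory for the empty walk. -/
def walkStart (k : ℕ) : Program :=
  block [.arith .plus 11 12 18, .arith .times 10 12 (2 * (k - 1) + 20), .store 2 18 17,
    .arith .plus 15 17 18, .const 16 (k - 1)]

/-- Draw the number of a walk, and construct this walk and its partition. -/
def samplerProg (k : ℕ) : Program :=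
  .seq (totalProg k) (.seq (.random 7 7) (.seq (walkStart k) (.loop 11 (vertexProg k))))

section

variable {S w k N m : ℕ} {tab : ℕ → ℕ → ℕ} {lam : Rows k} {M : Memory} {Q : Memory → Prop}
  {X : ℕ → Rows k} {u n v i i' : ℕ}

theorem ensures_firstHalf {L : ℕ} {c : Code k} (hX : X ∈ loopFreeWalks k L 0 0)
    (hi : i < 2 * L) (hv : v = i / 2 + 1) (h : WalkState N X m u n v i i' M)
    (hc : Allowed (X i) c) (hmid : X (i + 1) = mid (X i) c) (hw : 2 ^ (v + 2) ≤ 2 ^ w)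
    (haw : address N m (X i) < 2 ^ w) (haw' : address N m (X (i + 1)) < 2 ^ w) (hS : v < S)
    (hQ : ∀ M', WalkState N X m u n v (i + 1) i' M' → Q M') :
    Ensures S w tab (firstHalf c) Q M := by
  obtain ⟨a, b⟩ := c
  cases b with
  | none =>
    have hp : firstHalf ((a, none) : Code k) = .skip := by cases a <;> rfl
    have hm : mid (X i) (a, none) = X i := by cases a <;> rfl
    rw [hp]
    exact hQ M (h.stay (hmid.trans hm))
  | some b =>
    cases a with
    | some a => exact ensures_growProg hX hi hv h hmid hw haw' hQ
    | none =>
      obtain ⟨-, -, -, h4⟩ := hc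
      simp only [target, obox, add_zero] at h4
      exact ensures_shrinkProg hX hi hv h (by rw [hmid]; exact h4.symm) hw haw hS hQ

theorem ensures_secondHalf {L : ℕ} {c : Code k} (hX : X ∈ loopFreeWalks k L 0 0)
    (hi : i < 2 * L) (hv : v = i / 2 + 1) (h : WalkState N X m u n v i i' M)
    (hc : Allowed lam c) (hmid : X i = mid lam c) (htarget : X (i + 1) = target lam c)
    (hw : 2 ^ (v + 2) ≤ 2 ^ w) (haw : address N m (X i) < 2 ^ w)
    (haw' : address N m (X (i + 1)) < 2 ^ w) (hS : v < S)
    (hQ : ∀ M', WalkState N X m u n v (i + 1) i' M' → Q M') :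
    Ensures S w tab (secondHalf c) Q M := by
  obtain ⟨a, b⟩ := c
  cases a with
  | none =>
    have hp : secondHalf ((none, b) : Code k) = .skip := by cases b <;> rfl
    rw [hp]
    refine hQ M (h.stay ?_)
    rw [htarget, hmid]
    cases b <;> simp [target, mid, obox]
  | some a =>
    cases b with
    | some b =>
      obtain ⟨-, -, -, h4⟩ := hc
      refine ensures_shrinkProg hX hi hv h ?_ hw haw hS hQ
      rw [htarget, hmid]
      exact h4.symm
    | none =>
      refine ensures_growProg hX hi hv h ?_ hw haw' hQ
      rw [htarget, hmid]
      simp [target, mid, obox]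

theorem ensures_takeProg (hk : 2 ≤ k) {c : Code k} (hN : 1 ≤ N)
    (hX : X ∈ loopFreeWalks k (N - 1) 0 0) (hi : 2 * v + 2 ≤ 2 * (N - 1)) (hm : m + 1 < N)
    (h : WalkState N X (m + 1) u n (v + 1) (2 * v) (2 * v) M) (hc : Allowed (X (2 * v)) c)
    (hmid : X (2 * v + 1) = mid (X (2 * v)) c) (htarget : X (2 * v + 2) = target (X (2 * v)) c)
    (hw2 : 2 ^ (N + 1) ≤ 2 ^ w) (hNk : N ^ k ≤ 2 ^ w) (hkw : 2 * k * N < 2 ^ w)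
    (hS : 2 * k * N ≤ S)
    (hQ : ∀ M', WalkState N X m u n (v + 1) (2 * v + 2) (2 * v + 2) M' → Q M') :
    Ensures S w tab (takeProg c) Q M := by
  have hlt : ∀ i ≤ 2 * (N - 1), ∀ r, X i r < N := fun i hi r => by
    have := (halfTab hX hi).le r
    omega
  have haw : ∀ i ≤ 2 * (N - 1), address N (m + 1) (X i) < 2 ^ w := fun i hi =>
    (address_lt_pow hk (hlt i hi) hm).trans_le hNk
  have hvw : 2 ^ (v + 1 + 2) ≤ 2 ^ w :=
    (Nat.pow_le_pow_right (by omega) (by omega)).trans hw2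
  have hNS : N ≤ 2 * k * N := Nat.le_mul_of_pos_left _ (by omega)
  -- The walk has `2 * N - 1` members with `k - 1` rows each; this bounds the output pointer and the
  -- length of the array.
  have hptr : ∀ i ≤ 2 * N, (k - 1) * i ≤ 2 * k * N := fun i hi => by
    calc (k - 1) * i ≤ k * (2 * N) := Nat.mul_le_mul (by omega) hi
      _ = 2 * k * N := by ring
  simp only [takeProg]
  rw [block, Ensures]
  refine ensures_firstHalf hX (by omega) (by omega) h hc hmid hvw (haw _ (by omega))
    (haw _ (by omega)) (by omega) fun M1 h1 => ?_
  rw [block, Ensures]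
  refine ensures_writeProg_walk h1 (hlt _ (by omega)) (haw _ (by omega))
    ((hptr _ (by omega)).trans_lt hkw) ((hptr _ (by omega)).trans hS) fun M2 h2 => ?_
  rw [block, Ensures]
  refine ensures_secondHalf hX (by omega) (by omega) h2 hc hmid htarget hvw (haw _ (by omega))
    (haw _ (by omega)) (by omega) fun M3 h3 => ?_
  rw [block, Ensures]
  refine ensures_writeProg_walk h3 (hlt _ (by omega)) (haw _ (by omega))
    ((hptr _ (by omega)).trans_lt hkw) ((hptr _ (by omega)).trans hS) fun M4 h4 => ?_
  have ha := h4.addr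
  rw [address_succ] at ha
  have hb := haw (2 * v + 2) (by omega)
  rw [address_succ] at hb
  have hs : M4.reg 10 - N ^ (k - 1) = address N m (X (2 * v + 2)) := by
    rw [ha]; exact Nat.add_sub_cancel _ _
  simp only [block, Ensures, ArithOp.eval, h4.base.pow (k - 1) le_rfl, hs]
  refine ⟨by omega, hQ _ ?_⟩
  have reg : ∀ x : ℕ, x ≠ 10 → (M4.set 10 (address N m (X (2 * v + 2)))).reg x = M4.reg x := by
    intro x hx
    rw [Memory.set_reg, if_neg hx]
  exact ⟨h4.base.congr fun x hx => reg x (by omega), by simp,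
    fun r => (reg _ (by omega)).trans (h4.rows r), (reg _ (by omega)).trans h4.pointer,
    (reg _ (by omega)).trans h4.vertex, (reg _ (by omega)).trans h4.digit,
    (reg _ (by omega)).trans h4.draw, (reg _ (by omega)).trans h4.left, h4.pow, h4.walk, h4.arcs⟩

/-- This carries out `pick`: the truncated difference of the weight and `u` is not 0 exactly if the
rank lies in the current interval; otherwise the weight is subtracted from the rank. -/
theorem ensures_selectProg (hk : 2 ≤ k) (hM : BaseRegs k N M)
    (ha : M.reg 10 = address N (m + 1) lam) (hanti : Antitone lam) (hlam : ∀ r, lam r < N)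
    (hm : m + 1 < N) (hw : N ^ k ≤ 2 ^ w)
    (htab : ∀ nu : Rows k, (∀ r, nu r < N) → tab 0 (address N m nu) = moveCount m nu)
    (hcount : ∀ m < N, ∀ nu : Rows k, moveCount m nu < 2 ^ w) {L : List (Code k)}
    (hL : ∀ c ∈ L, c ∈ moveCodes k) (hu : M.reg 7 = u) (huw : u < 2 ^ w)
    (hsum : u < (L.map (moveWeight m lam)).sum)
    (hQ : ∀ M', Frame 8 M M' → M'.reg 7 = (pick (moveWeight m lam) (none, none) L u).2 →
      Ensures S w tab (takeProg (pick (moveWeight m lam) (none, none) L u).1) Q M') :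
    Ensures S w tab (selectProg L) Q M := by
  induction L generalizing M u with
  | nil => simp at hsum
  | cons c cs ih =>
    rw [List.map_cons, List.sum_cons] at hsum
    refine ensures_codeValue hk hM ha hanti hlam hm hw ?_ (hL c (by simp)) ?_
    · intro M' nu f h1 h2 h3 Q' hQ'
      have e : tab 0 (M'.reg 1) = moveCount m nu := by rw [h3, htab nu h1]
      simp only [Ensures, e]
      exact ⟨hcount m (by omega) nu, hQ'⟩
    · intro M1 f1 e1
      have e7 : M1.reg 7 = u := (f1.2 7 (by omega)).trans hu
      have hle : moveWeight m lam c < 2 ^ w := by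
        rw [moveWeight, codeWeight]
        split_ifs
        · exact hcount m (by omega) _
        · positivity
      have f2 := f1.set (n := 7) (by omega) (x := 6) (by omega) (by omega)
        (moveWeight m lam c - u)
      have r5 : (M1.set 6 (moveWeight m lam c - u)).reg 5 = moveWeight m lam c := by simp [e1]
      have r6 : (M1.set 6 (moveWeight m lam c - u)).reg 6 = moveWeight m lam c - u := by simp
      have r7 : (M1.set 6 (moveWeight m lam c - u)).reg 7 = u := by simp [e7]
      simp only [Ensures, block, ArithOp.eval, e1, e7]
      generalize M1.set 6 (moveWeight m lam c - u) = M2 at *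
      rw [r5, r6, r7]
      refine ⟨by omega, fun h => ?_, fun h => ⟨by omega, ?_⟩⟩
      · have hlt : u < moveWeight m lam c := by omega
        have hp : pick (moveWeight m lam) (none, none) (c :: cs) u = (c, u) := by
          rw [pick, if_pos hlt]
        rw [hp] at hQ
        exact hQ _ (f2.mono (by omega)) r7
      · have hlt : ¬ u < moveWeight m lam c := by omega
        have hp : pick (moveWeight m lam) (none, none) (c :: cs) u =
            pick (moveWeight m lam) (none, none) cs (u - moveWeight m lam c) := by
          rw [pick, if_neg hlt]
        rw [hp] at hQ
        have f3 := f2.set (n := 8) (by omega) (x := 7) (by omega) (by omega)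
          (u - moveWeight m lam c)
        refine ih (u := u - moveWeight m lam c) (hM.frame f3 (by omega)) ((f3.2 10 (by omega)).trans ha)
          (fun c hc => hL c (by simp [hc])) (by simp) (by omega) (by omega) ?_
        exact fun M' f e => hQ M' (f3.trans f le_rfl le_rfl) e

theorem WalkState.frame {M' : Memory} {u' : ℕ} (h : WalkState N X m u n v i i' M)
    (hf : Frame 8 M M') (hu : M'.reg 7 = u') : WalkState N X m u' n v i i' M' where
  base := h.base.frame hf (by omega)
  addr := (hf.2 _ (by omega)).trans h.addr
  rows r := (hf.2 _ (by omega)).trans (h.rows r)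
  pointer := (hf.2 _ (by omega)).trans h.pointer
  vertex := (hf.2 _ (by omega)).trans h.vertex
  digit := (hf.2 _ (by omega)).trans h.digit
  draw := hu
  left := (hf.2 _ (by omega)).trans h.left
  pow := by rw [hf.1]; exact h.pow
  walk := by rw [hf.1]; exact h.walk
  arcs := by rw [hf.1]; exact h.arcs

/-- One level of `decode`: the rank in register 7 selects the code, and the rank inside the selected
interval is the rank of the rest of the walk. Doubling register 15 extends the list of powers of two
in array 2, which has to reach the current vertex. -/
theorem ensures_vertexProg (hk : 2 ≤ k) (hN : 1 ≤ N) (hX : X ∈ loopFreeWalks k (N - 1) 0 0)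
    (hvn : v + (n + 1) = N - 1)
    (htab : ∀ m < N, ∀ nu : Rows k, (∀ r, nu r < N) → tab 0 (address N m nu) = moveCount m nu)
    (hcount : ∀ m < N, ∀ nu : Rows k, moveCount m nu < 2 ^ w)
    (h : WalkState N X (n + 1) u (n + 1) v (2 * v) (2 * v) M)
    (hu : u < moveCount (n + 1) (X (2 * v)))
    (hdec : ∀ i, X (2 * v + i) = decode (moveCodes k) mid (n + 1) (X (2 * v)) u i)
    (hw2 : 2 ^ (N + 1) ≤ 2 ^ w) (hNk : N ^ k ≤ 2 ^ w) (hkw : 2 * k * N < 2 ^ w)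
    (hS : 2 * k * N ≤ S)
    (hQ : ∀ M' u', WalkState N X n u' n (v + 1) (2 * (v + 1)) (2 * (v + 1)) M' →
      u' < moveCount n (X (2 * (v + 1))) →
      (∀ i, X (2 * (v + 1) + i) = decode (moveCodes k) mid n (X (2 * (v + 1))) u' i) → Q M') :
    Ensures S w tab (vertexProg k) Q M := by
  have hNS : N ≤ 2 * k * N := Nat.le_mul_of_pos_left _ (by omega)
  have hlt : ∀ r, X (2 * v) r < N := fun r => by
    have := (halfTab hX (i := 2 * v) (by omega)).le r
    omega
  have hvp1 : 2 ^ (v + 1) = 2 ^ v + 2 ^ v := by rw [pow_succ]; ring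
  have hvw : 2 ^ (v + 1) ≤ 2 ^ N := Nat.pow_le_pow_right (by omega) (by omega)
  have hNw : 2 ^ (N + 1) = 2 ^ N + 2 ^ N := by rw [pow_succ]; ring
  have hpos : 0 < 2 ^ N := by positivity
  simp only [vertexProg]
  simp only [block, Ensures, ArithOp.eval, h.vertex, h.base.one, h.digit, Memory.set_reg,
    if_true, show (15 : ℕ) = 14 ↔ False by simp, show (14 : ℕ) = 15 ↔ False by simp, if_false]
  refine ⟨by omega, by omega, by omega, ?_⟩
  set M1 := ((M.set 14 (v + 1)).set 15 (2 ^ v + 2 ^ v)).put 2 (v + 1) (2 ^ v + 2 ^ v) with hM1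
  have reg : ∀ x : ℕ, x ≠ 14 → x ≠ 15 → M1.reg x = M.reg x := by
    intro x h1 h2
    rw [hM1, Memory.put_reg, Memory.set_reg, if_neg h2, Memory.set_reg, if_neg h1]
  have arr : ∀ b q, b ≠ 2 → M1.arr b q = M.arr b q := by
    intro b q hb
    rw [hM1, Memory.put_arr, if_neg (by tauto)]
    rfl
  have h1 : WalkState N X (n + 1) u (n + 1) (v + 1) (2 * v) (2 * v) M1 := by
    refine ⟨h.base.congr fun x hx => reg x (by omega) (by omega),
      (reg _ (by omega) (by omega)).trans h.addr,
      fun r => (reg _ (by omega) (by omega)).trans (h.rows r),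
      (reg _ (by omega) (by omega)).trans h.pointer, ?_, ?_,
      (reg _ (by omega) (by omega)).trans h.draw, (reg _ (by omega) (by omega)).trans h.left,
      ?_, fun l hl r => (arr _ _ (by omega)).trans (h.walk l hl r),
      fun e c hc => ?_⟩
    · simp [hM1]
    · simp [hM1, hvp1]
    · intro z hz
      rw [hM1, Memory.put_arr]
      by_cases e : z = v + 1
      · rw [if_pos ⟨rfl, e⟩, e, hvp1]
      · rw [if_neg (by tauto)]
        exact h.pow z (by omega)
    · rw [arr _ _ (by omega)]
      exact h.arcs e c hc
  clear_value M1
  have hpick := (pick_bijOn (moveWeight n (X (2 * v))) (none, none) (moveCodes k)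
    (nodup_moveCodes k)).mapsTo (show u ∈ Set.Iio _ from hu)
  refine ensures_selectProg hk h1.base h1.addr (hX.2.2.1 _) hlt (by omega) hNk
    (htab n (by omega)) hcount (fun _ h => h) h1.draw (hu.trans (hcount _ (by omega) _)) hu ?_
  intro M2 f2 e2
  set p := pick (moveWeight n (X (2 * v))) (none, none) (moveCodes k) u with hp
  obtain ⟨hp1, hp2⟩ := hpick
  have hall : Allowed (X (2 * v)) p.1 ∧ p.2 < moveCount n (target (X (2 * v)) p.1) := by
    rw [moveWeight, codeWeight] at hp2
    split_ifs at hp2 with ha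
    · exact ⟨ha, hp2⟩
    · omega
  have hd : ∀ i, X (2 * v + i) = consPair (X (2 * v)) (mid (X (2 * v)) p.1)
    (decode (moveCodes k) mid n (target (X (2 * v)) p.1) p.2) i := hdec
  have hmid : X (2 * v + 1) = mid (X (2 * v)) p.1 := hd 1
  have htarget : X (2 * v + 2) = target (X (2 * v)) p.1 := (hd 2).trans (decode_zero _ _ _ _ _)
  have h2 := h1.frame f2 e2
  refine ensures_takeProg hk hN hX (by omega) (by omega) h2 hall.1 hmid htarget hw2 hNk hkw hS ?_
  intro M3 h3
  have hn : n < 2 ^ w := by omega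
  simp only [h3.left, h3.base.one, Nat.add_sub_cancel]
  refine ⟨hn, hQ _ p.2 ?_ ?_ ?_⟩
  · have reg : ∀ x : ℕ, x ≠ 11 → (M3.set 11 n).reg x = M3.reg x := by
      intro x hx
      rw [Memory.set_reg, if_neg hx]
    exact ⟨h3.base.congr fun x hx => reg x (by omega), (reg _ (by omega)).trans h3.addr,
      fun r => (reg _ (by omega)).trans (h3.rows r), (reg _ (by omega)).trans h3.pointer,
      (reg _ (by omega)).trans h3.vertex, (reg _ (by omega)).trans h3.digit,
      (reg _ (by omega)).trans h3.draw, by simp, h3.pow, h3.walk, h3.arcs⟩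
  · rw [show 2 * (v + 1) = 2 * v + 2 by ring, htarget]
    exact hall.2
  · intro i
    rw [show 2 * (v + 1) = 2 * v + 2 by ring, htarget,
      show 2 * v + 2 + i = 2 * v + (i + 2) by ring]
    exact hd (i + 2)

theorem ensures_totalProg (hk : 2 ≤ k) (hN : 1 ≤ N) (hw : N ^ k < 2 ^ w)
    (htab : ∀ m < N, ∀ nu : Rows k, (∀ r, nu r < N) → tab 0 (address N m nu) = moveCount m nu)
    (hcount : ∀ m < N, ∀ nu : Rows k, moveCount m nu < 2 ^ w)
    (hQ : ∀ M', M'.arr = (fun _ _ => 0) → BaseRegs k N M' →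
      M'.reg 7 = moveCount (N - 1) (0 : Rows k) → M'.reg 14 = 0 →
      (∀ r, M'.reg (2 * r + 21) = 0) → Q M') :
    Ensures S w tab (totalProg k) Q (inputMemory N) := by
  have hpow : ∀ s ≤ k, N ^ s ≤ N ^ k := fun s hs => Nat.pow_le_pow_right hN hs
  have h1 := hpow 1 (by omega)
  rw [pow_one] at h1
  refine ensures_baseProg (by omega) (by omega) (fun s hs => (hpow s (by omega)).trans_lt hw) ?_
  intro M a b c
  have e : (N - 1) * N ^ (k - 1) = address N (N - 1) (0 : Rows k) := by simp [address]
  have ht := htab (N - 1) (by omega) 0 (fun _ => hN)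
  simp only [block, Ensures, ArithOp.eval, b.pred, b.pow (k - 1) le_rfl, e, Memory.set_reg,
    if_true, ht]
  refine ⟨(address_lt_pow hk (fun _ => hN) (by omega)).trans hw, hcount _ (by omega) _,
    hQ _ a ?_ (by simp) ?_ ?_⟩
  · exact b.congr fun x hx => by
      rw [Memory.set_reg, if_neg (by omega), Memory.set_reg, if_neg (by omega)]
  · rw [Memory.set_reg, if_neg (by omega), Memory.set_reg, if_neg (by omega)]
    exact c 14 (by omega) (by omega) (by omega) fun s => by omega
  · intro r
    rw [Memory.set_reg, if_neg (by omega), Memory.set_reg, if_neg (by omega)]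
    exact c _ (by omega) (by omega) (by omega) fun s => by omega

/-- The first member of the walk is empty and already present as zeros, so the output pointer starts
at `k - 1`. -/
theorem ensures_walkStart (hk : 2 ≤ k) (hN : 1 ≤ N) (hw : N ^ k < 2 ^ w) (hkw : k < 2 ^ w)
    (hS : 0 < S) (hX : X 0 = 0) (ha : M.arr = fun _ _ => 0) (hM : BaseRegs k N M)
    (h7 : M.reg 7 = u) (h14 : M.reg 14 = 0) (hrow : ∀ r, M.reg (2 * r + 21) = 0)
    (hQ : ∀ M', WalkState N X (N - 1) u (N - 1) 0 0 0 M' → Q M') :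
    Ensures S w tab (walkStart k) Q M := by
  have hpow : ∀ s ≤ k, N ^ s ≤ N ^ k := fun s hs => Nat.pow_le_pow_right hN hs
  have h1 := hpow 1 (by omega)
  rw [pow_one] at h1
  have e : (N - 1) * N ^ (k - 1) = address N (N - 1) (0 : Rows k) := by simp [address]
  have hp : 2 * (k - 1) + 20 ≠ 11 := by omega
  simp only [walkStart, block, Ensures, ArithOp.eval, hM.pred, hM.zero, hM.one, Memory.set_reg,
    hp, if_false, hM.pow (k - 1) le_rfl, Memory.put_reg, add_zero, e,
    show (12 : ℕ) = 11 ↔ False by simp, show (18 : ℕ) = 11 ↔ False by simp,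
    show (17 : ℕ) = 11 ↔ False by simp, show (18 : ℕ) = 10 ↔ False by simp,
    show (17 : ℕ) = 10 ↔ False by simp]
  refine ⟨by omega, (address_lt_pow hk (fun _ => hN) (by omega)).trans hw, hS, by omega,
    by omega, hQ _ ?_⟩
  set M1 := ((((M.set 11 (N - 1)).set 10 (address N (N - 1) (0 : Rows k))).put 2 0 1).set 15
    1).set 16 (k - 1) with hM1
  have reg : ∀ x : ℕ, x ≠ 10 → x ≠ 11 → x ≠ 15 → x ≠ 16 → M1.reg x = M.reg x := by
    intro x h1 h2 h3 h4
    simp [hM1, h1, h2, h3, h4]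
  have arr : ∀ b q, b ≠ 2 → M1.arr b q = 0 := by
    intro b q hb
    rw [hM1, Memory.set_arr, Memory.set_arr, Memory.put_arr, if_neg (by tauto), Memory.set_arr,
      Memory.set_arr, ha]
  refine ⟨hM.congr fun x hx => reg x (by omega) (by omega) (by omega) (by omega), ?_, ?_, ?_,
    (reg _ (by omega) (by omega) (by omega) (by omega)).trans h14, ?_,
    (reg _ (by omega) (by omega) (by omega) (by omega)).trans h7, ?_, ?_, ?_, ?_⟩
  · rw [hX]; simp [hM1]
  · intro r
    rw [reg _ (by omega) (by omega) (by omega) (by omega), hrow]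
    rfl
  · simp [hM1]
  · simp [hM1]
  · simp [hM1]
  · intro z hz
    obtain rfl : z = 0 := by omega
    simp [hM1, Memory.put_arr]
  · intro l hl r
    obtain rfl : l = 0 := by omega
    rw [arr _ _ (by omega), hX]
    rfl
  · intro e c hc
    rw [arr _ _ (by omega)]
    constructor
    · omega
    · rintro ⟨l, hl, -⟩
      omega

/-- The sampler constructs each walk and its braid for exactly one of the random numbers. -/
theorem execute_samplerProg (hk : 2 ≤ k) (hN : 1 ≤ N)
    (htab : ∀ m < N, ∀ nu : Rows k, (∀ r, nu r < N) → tab 0 (address N m nu) = moveCount m nu)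
    (hcount : ∀ m < N, ∀ nu : Rows k, moveCount m nu < 2 ^ w)
    (hw2 : 2 ^ (N + 1) ≤ 2 ^ w) (hNk : N ^ k < 2 ^ w) (hkw : 2 * k * N < 2 ^ w)
    (hS : 2 * k * N ≤ S) {t : ℕ}
    (ht : (totalProg k).cost + (walkStart k).cost + 5 + N * ((vertexProg k).cost + 1) ≤ t)
    {W : ℕ} (hW : moveCount (N - 1) (0 : Rows k) = W + 1) :
    ∃ R : Fin (W + 1) → Memory,
      (∀ a, ∀ l ≤ 2 * (N - 1), ∀ r : Fin (k - 1), (R a).arr 1 ((k - 1) * l + r) =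
        decode (moveCodes k) mid (N - 1) (0 : Rows k) a l r) ∧
      (∀ a, ∀ e c, 0 < c → ((R a).arr 0 e = c ↔ ∃ b, c = b + 1 ∧
        (e, b) ∈ walkToBraid (N - 1)
          (decode (moveCodes k) mid (N - 1) (0 : Rows k) a))) ∧
      execute t S w tab (samplerProg k) N =
        (PMF.uniformOfFintype (Fin (W + 1))).map fun a => some (R a) := by
  have hNS : N ≤ 2 * k * N := Nat.le_mul_of_pos_left _ (by omega)
  have hkk : k ≤ 2 * k * N := by
    calc k ≤ (2 * N) * k := Nat.le_mul_of_pos_left _ (by omega)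
      _ = 2 * k * N := by ring
  obtain ⟨s1, hs1, M0, hr0, a0, b0, c0, d0, e0⟩ :=
    (ensures_totalProg (S := S) (Q := fun M' => M'.arr = (fun _ _ => 0) ∧ BaseRegs k N M' ∧
      M'.reg 7 = moveCount (N - 1) (0 : Rows k) ∧ M'.reg 14 = 0 ∧
      (∀ r, M'.reg (2 * r + 21) = 0)) hk hN hNk htab hcount
      fun M' a b c d e => ⟨a, b, c, d, e⟩).reaches
  have hWw : W + 1 < 2 ^ w := hW ▸ hcount (N - 1) (by omega) 0
  have hNc : (N - 1) * ((vertexProg k).cost + 1) ≤ N * ((vertexProg k).cost + 1) :=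
    Nat.mul_le_mul_right _ (by omega)
  have key : ∀ u ≤ W, Reaches S w tab (.seq (walkStart k) (.loop 11 (vertexProg k)))
      (1 + (walkStart k).cost + ((N - 1) * ((vertexProg k).cost + 1) + 1))
      (fun M' => (∀ l ≤ 2 * (N - 1), ∀ r : Fin (k - 1), M'.arr 1 ((k - 1) * l + r) =
        decode (moveCodes k) mid (N - 1) (0 : Rows k) u l r) ∧
      (∀ e c, 0 < c → (M'.arr 0 e = c ↔ ∃ b, c = b + 1 ∧ (e, b) ∈ walkToBraid (N - 1)
          (decode (moveCodes k) mid (N - 1) (0 : Rows k) u)))) (M0.set 7 u) := by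
    intro u hu
    set X := decode (moveCodes k) mid (N - 1) (0 : Rows k) u with hXdef
    have hlt : u < moveCount (N - 1) (0 : Rows k) := by omega
    have hX : X ∈ loopFreeWalks k (N - 1) 0 0 :=
      (decode_bijOn_loopFreeWalks k (N - 1) 0).mapsTo hlt
    refine Reaches.seq (Ensures.reaches ?_)
    refine ensures_walkStart (X := X) (u := u) hk hN hNk (by omega) (by omega) hX.1 a0
      (b0.frame (frame_set _ (n := 8) (by omega) (by omega) u) (by omega)) (by simp)
      (by simpa using d0) (fun r => ?_) fun M1 h1 => ?_
    · rw [Memory.set_reg, if_neg (by omega)]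
      exact e0 r
    -- Invariant: with `n` moves to go after the vertex `v`, register 7 contains the rank of the
    -- remaining walk among all walks of `n` moves from the current shape to the empty one.
    refine Reaches.loop (fun n M => ∃ v u', v + n = N - 1 ∧
      WalkState N X n u' n v (2 * v) (2 * v) M ∧ u' < moveCount n (X (2 * v)) ∧
      ∀ i, X (2 * v + i) = decode (moveCodes k) mid n (X (2 * v)) u' i) ?_ ?_
      ⟨0, u, by omega, h1, ?_, ?_⟩
    · rintro n M ⟨v, u', h2, h3, h4, h5⟩
      refine ⟨by rw [h3.left]; omega, Ensures.reaches ?_⟩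
      refine ensures_vertexProg hk hN hX h2 htab hcount h3 h4 h5 hw2 hNk.le hkw hS ?_
      intro M' u'' h6 h7 h8
      exact ⟨v + 1, u'', by omega, h6, h7, h8⟩
    · rintro M ⟨v, u', h2, h3, -, -⟩
      obtain rfl : v = N - 1 := by omega
      refine ⟨h3.left, fun l hl r => h3.walk l hl r, fun e c hc => ?_⟩
      rw [h3.arcs e c hc]
      constructor
      · rintro ⟨l, h4, h5, h6⟩
        exact ⟨l / 2 + 1, h5.symm, l, h4, rfl, h6⟩
      · rintro ⟨b, h4, l, h5, h6, h7⟩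
        dsimp only at h6 h7
        exact ⟨l, h5, by omega, h7⟩
    · rw [Nat.mul_zero, hX.1]; exact hlt
    · intro i
      rw [Nat.mul_zero, hX.1, Nat.zero_add]
  obtain ⟨R, hR, hex⟩ := execute_random (t := t) ⟨s1, hs1, M0, hr0, rfl⟩ (c0.trans hW)
    (by omega) _ key (by omega)
  exact ⟨R, fun a => (hR a).1, fun a => (hR a).2, hex⟩

end

end

noncomputable section

/-! ## Counting walks with a given beginning -/

theorem ncard_sep_of_bijOn {α β : Type*} {f : α → β} {s : Set α} {t : Set β}
    (h : Set.BijOn f s t) {P : α → Prop} {R : β → Prop} (hPR : ∀ a ∈ s, P a ↔ R (f a)) :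
    {a ∈ s | P a}.ncard = {b ∈ t | R b}.ncard := by
  have e : {b ∈ t | R b} = f '' {a ∈ s | P a} := by
    ext b
    constructor
    · rintro ⟨hb, hr⟩
      obtain ⟨a, ha, rfl⟩ := h.surjOn hb
      exact ⟨a, ⟨ha, (hPR a ha).mpr hr⟩, rfl⟩
    · rintro ⟨a, ⟨ha, hp⟩, rfl⟩
      exact ⟨h.mapsTo ha, (hPR a ha).mp hp⟩
  rw [e, (h.injOn.mono fun _ h => h.1).ncard_image]

open Classical in
theorem ncard_pick {α : Type*} (f : α → ℕ) (d : α) {L : List α} (hL : L.Nodup) (P : α → Prop) :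
    {u ∈ Set.Iio (L.map f).sum | P (pick f d L u).1}.ncard =
      ∑ c ∈ L.toFinset, if P c then f c else 0 := by
  rw [ncard_sep_of_bijOn (pick_bijOn f d L hL) (R := fun p => P p.1) fun _ _ => Iff.rfl]
  have e : {p : α × ℕ | p ∈ {p : α × ℕ | p.1 ∈ L ∧ p.2 < f p.1} ∧ P p.1} =
      (((L.toFinset.filter P).sigma fun c => Finset.range (f c)).map
        (Equiv.sigmaEquivProd α ℕ).toEmbedding : Finset (α × ℕ)) := by
    ext ⟨c, u⟩
    simp only [Set.mem_ofPred_eq, Finset.coe_map, Set.mem_image, Finset.mem_coe, Finset.mem_sigma,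
      Finset.mem_filter, List.mem_toFinset, Finset.mem_range]
    constructor
    · rintro ⟨⟨h1, h2⟩, h3⟩
      exact ⟨⟨c, u⟩, ⟨⟨h1, h3⟩, h2⟩, rfl⟩
    · rintro ⟨⟨c', u'⟩, ⟨⟨h1, h3⟩, h2⟩, h⟩
      cases h
      exact ⟨⟨h1, h2⟩, h3⟩
  rw [e, Set.ncard_coe_finset, Finset.card_map, Finset.card_sigma, Finset.sum_filter]
  simp

section

variable {k n m : ℕ} {lam mu nu : Rows k}

-- By unranking, the walks with a given property of the first two steps correspond to the intervals
-- of ranks of the codes with this property.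
open Classical in
theorem ncard_walks_first_move (F : Rows k → Rows k → Prop) :
    {Y ∈ loopFreeWalks k (m + 1) lam 0 | F (Y 1) (Y 2)}.ncard =
      ∑ c : Code k, if ¬ IsLoopCode c ∧ F (mid lam c) (target lam c) then
        codeWeight (moveCodes k) m lam c else 0 := by
  rw [← ncard_sep_of_bijOn (decode_bijOn_loopFreeWalks k (m + 1) lam)
    (P := fun u => F (mid lam (pick (codeWeight (moveCodes k) m lam) (none, none)
      (moveCodes k) u).1) (target lam (pick (codeWeight (moveCodes k) m lam) (none, none)
      (moveCodes k) u).1)) ?_]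
  · refine (ncard_pick (codeWeight (moveCodes k) m lam) (none, none) (nodup_moveCodes k)
      fun c => F (mid lam c) (target lam c)).trans ?_
    refine (Finset.sum_congr (s₂ := Finset.univ.filter fun c => ¬ IsLoopCode c) ?_
      fun _ _ => rfl).trans ?_
    · ext c
      simp [mem_moveCodes]
    rw [Finset.sum_filter]
    refine Finset.sum_congr rfl fun c _ => ?_
    by_cases h : IsLoopCode c
    · simp [h]
    · simp [h]
  · intro u _
    have h1 : decode (moveCodes k) mid (m + 1) lam u 2 = target lam
        (pick (codeWeight (moveCodes k) m lam) (none, none) (moveCodes k) u).1 :=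
      decode_zero _ _ _ _ _
    rw [h1]
    exact Iff.rfl

theorem codeWeight_eq_of_allowed {L : List (Code k)} {c : Code k} (h : Allowed lam c) :
    codeWeight L m lam c = codeCount L m (target lam c) := if_pos h

theorem codeWeight_eq_zero {L : List (Code k)} {c : Code k} (h : ¬ Allowed lam c) :
    codeWeight L m lam c = 0 := if_neg h

/-- Exactly one code fits the given move if `nu` is a shape; its weight is the number of
continuations. If `nu` is not a shape, both sides are 0. -/
theorem ncard_walks_first_two (h1 : Antitone lam) (h2 : Antitone mu)
    (hm : LoopFreeMove lam mu nu) :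
    {Y ∈ loopFreeWalks k (m + 1) lam 0 | Y 1 = mu ∧ Y 2 = nu}.ncard = moveCount m nu := by
  classical
  rw [ncard_walks_first_move (fun a b => a = mu ∧ b = nu)]
  by_cases h3 : Antitone nu
  · obtain ⟨c, hc, ha, rfl, rfl⟩ := (loopFreeMove_iff h1 h2 h3).mp hm
    rw [Finset.sum_eq_single c]
    · rw [if_pos ⟨mem_moveCodes.mp hc, rfl, rfl⟩, codeWeight_eq_of_allowed ha, moveCount]
    · intro d _ hd
      split_ifs with h
      · apply codeWeight_eq_zero
        intro ha'
        exact hd (mid_target_inj ha' ha h.2.1 h.2.2)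
      · rfl
    · simp
  · rw [moveCount, codeCount_of_not_antitone h3]
    refine Finset.sum_eq_zero fun c _ => ?_
    split_ifs with h
    · apply codeWeight_eq_zero
      rintro ⟨-, -, h4, -⟩
      rw [h.2.2] at h4
      exact h3 h4
    · rfl

theorem codeWeight_none_none (h1 : Antitone lam) :
    codeWeight (moveCodes k) m lam (none, none) = moveCount m lam := by
  have e : target lam (none, none) = lam := by simp [target, obox]
  rw [codeWeight_eq_of_allowed, e, moveCount]
  refine ⟨h1, ?_, ?_, ?_⟩
  · simpa [obox] using h1
  · rw [e]; exact h1
  · rw [e]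

theorem codeWeight_some_none (h1 : Antitone lam) (a : Fin (k - 1)) :
    codeWeight (moveCodes k) m lam (some a, none) = moveCount m (lam + box a) := by
  have e : target lam (some a, none) = lam + box a := by simp [target, obox]
  by_cases h : Antitone (lam + box a)
  · rw [codeWeight_eq_of_allowed, e, moveCount]
    refine ⟨h1, h, ?_, ?_⟩
    · rw [e]; exact h
    · rw [e]; simp [obox]
  · rw [codeWeight_eq_zero fun h' => h h'.2.1, moveCount, codeCount_of_not_antitone h]

theorem eq_add_box_of_allowed {b : Fin (k - 1)} (h : Allowed lam (none, some b)) :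
    lam = mid lam (none, some b) + box b := by
  have := h.2.2.2
  simp only [target, obox, add_zero] at this
  exact this.symm

theorem codeWeight_none_some (h2 : Antitone mu) (b : Fin (k - 1)) (h1 : Antitone (mu + box b)) :
    codeWeight (moveCodes k) m (mu + box b) (none, some b) = moveCount m mu := by
  have e : target (mu + box b) (none, some b) = mu := by simp [target, obox]
  rw [codeWeight_eq_of_allowed, e, moveCount]
  refine ⟨h1, ?_, ?_, ?_⟩
  · simpa [obox] using h1
  · rw [e]; exact h2
  · rw [e]; simp [obox]

theorem codeWeight_some_some (h1 : Antitone lam) {a : Fin (k - 1)} (h2 : Antitone (lam + box a))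
    (b : Fin (k - 1)) : codeWeight (moveCodes k) m lam (some a, some b) =
      if 1 ≤ (lam + box a) b then moveCount m (lam + box a - box b) else 0 := by
  have e : target lam (some a, some b) = lam + box a - box b := rfl
  split_ifs with h
  · have e2 : lam + box a - box b + box b = lam + box a := by
      funext r
      simp only [Pi.add_apply, Pi.sub_apply, box_apply] at h ⊢
      by_cases hr : r = b
      · subst hr; rw [if_pos rfl]; omega
      · rw [if_neg hr]; omega
    by_cases h3 : Antitone (lam + box a - box b)
    · rw [codeWeight_eq_of_allowed (c := (some a, some b)) ⟨h1, h2, h3, e2⟩, e, moveCount]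
    · rw [codeWeight_eq_zero fun h' => h3 h'.2.2.1, moveCount, codeCount_of_not_antitone h3]
  · apply codeWeight_eq_zero
    intro h'
    have := congrFun h'.2.2.2 b
    simp only [obox, Pi.add_apply, box_apply, if_true] at this h
    omega

theorem sum_code (f : Code k → ℕ) : ∑ c, f c = f (none, none) + ∑ b, f (none, some b) +
    (∑ a, f (some a, none) + ∑ a, ∑ b, f (some a, some b)) := by
  rw [Fintype.sum_prod_type, Fintype.sum_option, Fintype.sum_option]
  congr 1
  rw [← Finset.sum_add_distrib]
  exact Finset.sum_congr rfl fun a _ => Fintype.sum_option _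

theorem isLoopCode_some_some {a b : Fin (k - 1)} :
    IsLoopCode ((some a, some b) : Code k) ↔ (a : ℕ) = 0 ∧ (b : ℕ) = 0 := by
  constructor
  · rintro ⟨j, t, h, h1, h2⟩
    cases h
    exact ⟨h1, h2⟩
  · exact fun h => ⟨a, b, rfl, h⟩

theorem not_isLoopCode_none_left (b : Option (Fin (k - 1))) :
    ¬ IsLoopCode ((none, b) : Code k) := by
  rintro ⟨j, t, h, -⟩
  cases h

theorem not_isLoopCode_none_right (a : Option (Fin (k - 1))) :
    ¬ IsLoopCode ((a, none) : Code k) := by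
  rintro ⟨j, t, h, -⟩
  cases h

/-- Add up the weights of the codes with middle `mu`. An idle first step leaves the codes with no
second step or an addition; a removed square determines the code; an added square leaves the
removals other than the loop. These are the three cases of the definition. -/
theorem halfWalkCount_eq (hk : 2 ≤ k) (h1 : Antitone lam) (h2 : Antitone mu) :
    halfWalkCount k m lam mu = ({Y ∈ loopFreeWalks k (m + 1) lam 0 | Y 1 = mu}.ncard : ℤ) := by
  classical
  rw [ncard_walks_first_move (fun a _ => a = mu), halfWalkCount, if_neg (by simpa using h2)]
  obtain ⟨g, hg⟩ : ∃ g : Code k → ℕ, g = fun c => if ¬ IsLoopCode c ∧ mid lam c = mu then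
    codeWeight (moveCodes k) m lam c else 0 := ⟨_, rfl⟩
  trans ((∑ c, g c : ℕ) : ℤ)
  swap
  · rw [hg]
    refine congrArg Nat.cast (Finset.sum_congr rfl fun c _ => ?_)
    dsimp only
    split_ifs <;> rfl
  have g0 : ∀ c, mid lam c ≠ mu → g c = 0 := fun c hc => by
    rw [hg]; exact if_neg fun h => hc h.2
  have g1 : ∀ c, ¬ IsLoopCode c → mid lam c = mu → g c = codeWeight (moveCodes k) m lam c :=
    fun c h h' => by rw [hg]; exact if_pos ⟨h, h'⟩
  have gb : ∀ b, lam ≠ mu + box b → g (none, some b) = 0 := by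
    intro b hb
    by_cases h : mid lam (none, some b) = mu
    · rw [g1 _ (not_isLoopCode_none_left _) h]
      apply codeWeight_eq_zero
      intro ha
      have := eq_add_box_of_allowed ha
      rw [h] at this
      exact hb this
    · exact g0 _ h
  have gl : ∀ a b : Fin (k - 1), ((a : ℕ) = 0 ∧ (b : ℕ) = 0) → g (some a, some b) = 0 := fun a b h => by
    rw [hg]; exact if_neg fun h' => h'.1 (isLoopCode_some_some.mpr h)
  clear hg
  rw [sum_code]
  simp only [walkCount_eq hk]
  by_cases e : mu = lam
  · subst e
    have z1 : ∀ b, g (none, some b) = 0 := fun b => gb b (add_box_ne _ _).symm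
    have z2 : ∀ a b, g (some a, some b) = 0 := fun a b => g0 _ (add_box_ne _ _)
    have z3 : ∀ a, g (some a, none) = moveCount m (mu + box a) := fun a => by
      rw [g1 _ (not_isLoopCode_none_right _) rfl, codeWeight_some_none h2]
    have z4 : g (none, none) = moveCount m mu := by
      rw [g1 _ (not_isLoopCode_none_right _) rfl, codeWeight_none_none h2]
    simp only [if_true, z1, z2, z3, z4, Finset.sum_const_zero, add_zero]
    push_cast
    rfl
  · rw [if_neg e]
    have z4 : g (none, none) = 0 := g0 _ fun h => e h.symm
    have z3 : ∀ a, g (some a, none) = 0 := fun a => g0 _ fun h => e h.symm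
    simp only [z3, z4, Finset.sum_const_zero, zero_add]
    by_cases hr : ∃ j, lam = mu + box j
    · rw [if_pos hr]
      obtain ⟨j, rfl⟩ := hr
      have z2 : ∀ a b, g (some a, some b) = 0 := fun a b => g0 _ (add_add_box_ne mu j a)
      simp only [z2, Finset.sum_const_zero, add_zero]
      rw [Finset.sum_eq_single j, g1 _ (not_isLoopCode_none_left _) (by simp [mid]),
        codeWeight_none_some h2 j h1]
      · exact fun b _ hb => gb b fun h => hb (box_inj.mp (add_left_cancel h)).symm
      · simp
    · rw [if_neg hr]
      have z1 : ∀ b, g (none, some b) = 0 := fun b => gb b fun h => hr ⟨b, h⟩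
      simp only [z1, Finset.sum_const_zero, zero_add]
      push_cast
      refine Finset.sum_congr rfl fun a _ => ?_
      split_ifs with h
      · refine Finset.sum_congr rfl fun b _ => ?_
        subst h
        by_cases hl : (a : ℕ) = 0 ∧ (b : ℕ) = 0
        · rw [if_neg fun h => h.2 hl, gl a b hl, Nat.cast_zero]
        · rw [g1 _ (fun h => hl (isLoopCode_some_some.mp h)) rfl, codeWeight_some_some h1 h2]
          simp only [hl, not_false_eq_true, and_true]
          split_ifs <;> simp
      · have z2 : ∀ b, g (some a, some b) = 0 := fun b => g0 _ fun h' => h h'.symm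
        simp [z2]

/-- Moves are pairs of steps, so walks can be cut and glued at even times: any walk from the shape
reached to the empty shape continues the beginning. -/
theorem bijOn_tail {X0 : ℕ → Rows k} (hX : X0 ∈ loopFreeWalks k n 0 0) {s : ℕ} (hs : s ≤ n) :
    Set.BijOn (fun (X : ℕ → Rows k) i => X (2 * s + i))
      {X ∈ loopFreeWalks k n 0 0 | ∀ l ≤ 2 * s, X l = X0 l}
      (loopFreeWalks k (n - s) (X0 (2 * s)) 0) := by
  have e2 : 2 * s + 2 * (n - s) = 2 * n := by omega
  refine ⟨?_, ?_, ?_⟩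
  · rintro X ⟨⟨a0, a1, a2, a3, a4⟩, hl⟩
    refine ⟨hl _ le_rfl, ?_, fun i => a2 _, fun i hi => ?_, fun t ht => ?_⟩
    · change X (2 * s + 2 * (n - s)) = 0
      rw [e2, a1]
    · change X (2 * s + i) = X (2 * s + 2 * (n - s))
      rw [e2]
      exact a3 _ (by omega)
    · have := a4 (s + t) (by omega)
      rw [show 2 * (s + t) = 2 * s + 2 * t by ring] at this
      exact this
  · rintro X ⟨-, hl⟩ Y ⟨-, hl'⟩ h
    funext i
    by_cases hi : i ≤ 2 * s
    · rw [hl i hi, hl' i hi]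
    · have := congrFun h (i - 2 * s)
      simpa [Nat.add_sub_cancel' (show 2 * s ≤ i by omega)] using this
  · rintro Y ⟨b0, b1, b2, b3, b4⟩
    obtain ⟨a0, -, a2, -, a4⟩ := hX
    let X : ℕ → Rows k := fun i => if i ≤ 2 * s then X0 i else Y (i - 2 * s)
    have lo : ∀ i ≤ 2 * s, X i = X0 i := fun i hi => if_pos hi
    have hi : ∀ i, X (2 * s + i) = Y i := by
      intro i
      by_cases h : i = 0
      · subst h
        exact (lo _ le_rfl).trans b0.symm
      · simp only [X]
        rw [if_neg (by omega), Nat.add_sub_cancel_left]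
    refine ⟨X, ⟨⟨(lo 0 (by omega)).trans a0, ?_, fun i => ?_, fun i h => ?_, fun t ht => ?_⟩, lo⟩,
      funext hi⟩
    · rw [← e2, hi, b1]
    · simp only [X]
      split_ifs
      · exact a2 i
      · exact b2 _
    · rw [← e2, hi, show i = 2 * s + (i - 2 * s) by omega, hi]
      exact b3 _ (by omega)
    · by_cases h : t < s
      · rw [lo _ (by omega), lo _ (by omega), lo _ (by omega)]
        exact a4 t ht
      · have := b4 (t - s) (by omega)
        rw [← hi, ← hi, ← hi] at this
        rw [show 2 * s + 2 * (t - s) = 2 * t by omega] at this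
        rw [show 2 * s + (2 * (t - s) + 1) = 2 * t + 1 by omega] at this
        rw [show 2 * s + (2 * (t - s) + 2) = 2 * t + 2 by omega] at this
        exact this

/-- The walks that agree with `x` up to the step `i`. -/
def walksAlong (k n : ℕ) (x : ℕ → Rows k) (i : ℕ) : Set (ℕ → Rows k) :=
  {X ∈ loopFreeWalks k n 0 0 | ∀ l ≤ i, X l = x l}

theorem walksAlong_anti (x : ℕ → Rows k) {i j : ℕ} (h : i ≤ j) :
    walksAlong k n x j ⊆ walksAlong k n x i :=
  fun _ hX => ⟨hX.1, fun l hl => hX.2 l (hl.trans h)⟩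

/-- The Markov property in terms of counting: once a beginning of even length occurs at all, the
number of its continuations depends only on the last shape. -/
theorem ncard_walksAlong_sep {x : ℕ → Rows k} {s : ℕ} (hs : s ≤ n)
    (hne : (walksAlong k n x (2 * s)).Nonempty) (R : (ℕ → Rows k) → Prop) :
    {X ∈ walksAlong k n x (2 * s) | R fun i => X (2 * s + i)}.ncard =
      {Y ∈ loopFreeWalks k (n - s) (x (2 * s)) 0 | R Y}.ncard := by
  obtain ⟨X0, hX0, h0⟩ := hne
  have hb := bijOn_tail hX0 hs
  rw [h0 _ le_rfl] at hb
  have e : {X ∈ loopFreeWalks k n 0 0 | ∀ l ≤ 2 * s, X l = X0 l} = walksAlong k n x (2 * s) := by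
    ext X
    refine and_congr_right fun _ => forall_congr' fun l => forall_congr' fun hl => ?_
    rw [h0 l hl]
  rw [e] at hb
  exact ncard_sep_of_bijOn hb fun _ _ => Iff.rfl

theorem ncard_walksAlong_even {x : ℕ → Rows k} {s : ℕ} (hs : s ≤ n)
    (hne : (walksAlong k n x (2 * s)).Nonempty) :
    (walksAlong k n x (2 * s)).ncard = moveCount (n - s) (x (2 * s)) := by
  have := ncard_walksAlong_sep hs hne fun _ => True
  simp only [and_true, Set.ofPred_mem_eq] at this
  rw [this, ncard_loopFreeWalks_zero]

theorem antitone_of_mem_walksAlong {x X : ℕ → Rows k} {i l : ℕ} (h : X ∈ walksAlong k n x i)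
    (hl : l ≤ i) : Antitone (x l) := by
  rw [← h.2 l hl]
  exact h.1.2.2.1 l

/-- Cut at the even time before: fixing one more step is a condition on the first step of the
remaining walk, which `halfWalkCount` counts. -/
theorem ncard_walksAlong_odd (hk : 2 ≤ k) {x : ℕ → Rows k} {s : ℕ} (hs : s < n)
    (hne : (walksAlong k n x (2 * s)).Nonempty) :
    ((walksAlong k n x (2 * s + 1)).ncard : ℤ) =
      halfWalkCount k (n - s - 1) (x (2 * s)) (x (2 * s + 1)) := by
  have e : walksAlong k n x (2 * s + 1) =
      {X ∈ walksAlong k n x (2 * s) | X (2 * s + 1) = x (2 * s + 1)} := by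
    ext X
    constructor
    · exact fun h => ⟨walksAlong_anti x (by omega) h, h.2 _ le_rfl⟩
    · rintro ⟨h1, h2⟩
      refine ⟨h1.1, fun l hl => ?_⟩
      rcases Nat.le_succ_iff.mp hl with h | rfl
      · exact h1.2 l h
      · exact h2
  by_cases h2 : Antitone (x (2 * s + 1))
  · obtain ⟨X0, h0⟩ := hne
    rw [halfWalkCount_eq hk (antitone_of_mem_walksAlong h0 le_rfl) h2,
      show n - s - 1 + 1 = n - s by omega, e]
    exact congrArg Nat.cast (ncard_walksAlong_sep hs.le ⟨X0, h0⟩ fun Y => Y 1 = x (2 * s + 1))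
  · rw [halfWalkCount, if_pos h2]
    have : walksAlong k n x (2 * s + 1) = ∅ := by
      rw [Set.eq_empty_iff_forall_notMem]
      exact fun X hX => h2 (antitone_of_mem_walksAlong hX le_rfl)
    rw [this]
    simp

theorem ncard_walksAlong_next {x : ℕ → Rows k} {s : ℕ} (hs : s < n)
    (hne : (walksAlong k n x (2 * s + 1)).Nonempty)
    (hm : LoopFreeMove (x (2 * s)) (x (2 * s + 1)) (x (2 * s + 2))) :
    (walksAlong k n x (2 * s + 2)).ncard = moveCount (n - s - 1) (x (2 * s + 2)) := by
  have e : walksAlong k n x (2 * s + 2) = {X ∈ walksAlong k n x (2 * s) |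
      X (2 * s + 1) = x (2 * s + 1) ∧ X (2 * s + 2) = x (2 * s + 2)} := by
    ext X
    constructor
    · exact fun h => ⟨walksAlong_anti x (by omega) h, h.2 _ (by omega), h.2 _ le_rfl⟩
    · rintro ⟨h1, h2, h3⟩
      refine ⟨h1.1, fun l hl => ?_⟩
      rcases Nat.le_succ_iff.mp hl with h | rfl
      · rcases Nat.le_succ_iff.mp h with h | rfl
        · exact h1.2 l h
        · exact h2
      · exact h3
  obtain ⟨X0, h0⟩ := hne
  rw [← ncard_walks_first_two (m := n - s - 1) (antitone_of_mem_walksAlong h0 (by omega))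
    (antitone_of_mem_walksAlong h0 le_rfl) hm, show n - s - 1 + 1 = n - s by omega, e]
  exact ncard_walksAlong_sep hs.le ⟨X0, walksAlong_anti x (by omega) h0⟩
    fun Y => Y 1 = x (2 * s + 1) ∧ Y 2 = x (2 * s + 2)

end

end

noncomputable section

/-! ## The distribution of the output -/

section

variable {k n N : ℕ}

theorem finite_loopFreeWalks (n : ℕ) (lam : Rows k) : (loopFreeWalks k n lam 0).Finite := by
  rw [← (decode_bijOn_loopFreeWalks k n lam).image_eq]
  exact (Set.finite_Iio _).image _

theorem moveCount_pos (n : ℕ) : 0 < moveCount n (0 : Rows k) := by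
  rw [← ncard_loopFreeWalks_zero, Set.ncard_pos (finite_loopFreeWalks n 0)]
  refine ⟨fun _ => 0, rfl, rfl, fun _ _ _ _ => le_rfl, fun _ _ => rfl, fun s _ => ?_⟩
  exact Or.inr (Or.inr (Or.inl ⟨rfl, rfl⟩))

theorem prob_map_uniform {W : ℕ} (R : Fin (W + 1) → Memory) (E : Memory → Prop) :
    prob ((PMF.uniformOfFintype (Fin (W + 1))).map fun a => some (R a)) E =
      ({a | E (R a)}.ncard : ℝ) / (W + 1 : ℕ) := by
  classical
  have e : (fun a => some (R a)) ⁻¹' {r | ∃ M, r = some M ∧ E M} = {a | E (R a)} := by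
    ext a
    constructor
    · rintro ⟨M, h, hM⟩
      cases h
      exact hM
    · exact fun h => ⟨R a, rfl, h⟩
  rw [prob, PMF.toOuterMeasure_map_apply, e, PMF.toOuterMeasure_uniformOfFintype_apply,
    ENNReal.toReal_div, Set.ncard_eq_toFinset_card', Set.toFinset_card, Fintype.card_fin,
    ENNReal.toReal_natCast, ENNReal.toReal_natCast]

/-- If the random numbers correspond to the walks, probabilities are ratios of numbers of
walks. -/
theorem prob_eq_ncard {W : ℕ} (hW : moveCount n (0 : Rows k) = W + 1) {R : Fin (W + 1) → Memory}
    {E : Memory → Prop} {F : (ℕ → Rows k) → Prop}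
    (h : ∀ a : Fin (W + 1), E (R a) ↔ F (decode (moveCodes k) mid n (0 : Rows k) a)) :
    prob ((PMF.uniformOfFintype (Fin (W + 1))).map fun a => some (R a)) E =
      ({X ∈ loopFreeWalks k n 0 0 | F X}.ncard : ℝ) / moveCount n (0 : Rows k) := by
  have hb : Set.BijOn (fun a : Fin (W + 1) => (a : ℕ)) Set.univ
      (Set.Iio (moveCount n (0 : Rows k))) := by
    refine ⟨fun a _ => ?_, fun a _ b _ h => Fin.ext h, fun u hu => ?_⟩
    · rw [Set.mem_Iio, hW]; exact a.2
    · rw [Set.mem_Iio, hW] at hu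
      exact ⟨⟨u, hu⟩, trivial, rfl⟩
  have := ncard_sep_of_bijOn ((decode_bijOn_loopFreeWalks k n (0 : Rows k)).comp hb)
    (P := fun a => E (R a)) (R := F) fun a _ => h a
  simp only [Set.mem_univ, true_and] at this
  rw [prob_map_uniform, this, hW]

/-- The output consists of the walk `X` and of the arcs of its partition. -/
structure Outputs {k : ℕ} (N : ℕ) (X : ℕ → Rows k) (M : Memory) : Prop where
  walk : outputWalk k (2 * (N - 1)) M = X
  arcs : ∀ e c, 0 < c → (M.arr 0 e = c ↔ ∃ b, c = b + 1 ∧ (e, b) ∈ walkToBraid (N - 1) X)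

/-- The number `b + 1` stored for an arc (e, b) of the braid is the successor of `e` in the
partition. Both sides list the same arcs, since no arc leaves `[N]`. -/
theorem Outputs.outputsPartition_iff (hN : 1 ≤ N) {X : ℕ → Rows k} {M : Memory}
    (h : Outputs N X M) (hX : X ∈ loopFreeWalks k (N - 1) 0 0)
    (P : Finpartition (Finset.Icc 1 N)) :
    OutputsPartition M P ↔ walkToBraid (N - 1) X = partitionToBraid P := by
  constructor
  · intro hP
    ext ⟨e, b⟩
    constructor
    · intro he
      obtain ⟨h1, h2, h3⟩ := (isBraid_walkToBraid hX).1.1 _ he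
      dsimp only at h1 h2 h3
      exact (hP e (Finset.mem_Icc.mpr ⟨h1, by omega⟩) (b + 1) (by omega)).mp
        ((h.arcs e (b + 1) (by omega)).mpr ⟨b, rfl, he⟩)
    · intro he
      have hA : IsArc P e (b + 1) := he
      have h1 := hA.mem
      have h2 := hA.lt
      obtain ⟨b', h3, h4⟩ := (h.arcs e (b + 1) (by omega)).mp
        ((hP e (Finset.mem_Icc.mpr ⟨h1.1, by omega⟩) (b + 1) (by omega)).mpr hA)
      obtain rfl : b = b' := by omega
      exact h4
  · intro hP i _ j hj
    rw [h.arcs i j hj, hP]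
    constructor
    · rintro ⟨b, rfl, h⟩
      exact h
    · exact fun hA => ⟨j - 1, by omega, by
        change IsArc P i (j - 1 + 1)
        rwa [Nat.sub_add_cancel hj]⟩

theorem ncard_eq_of_bijOn {α β : Type*} {f : α → β} {s : Set α} {t : Set β}
    (h : Set.BijOn f s t) : s.ncard = t.ncard := by
  rw [← h.image_eq, h.injOn.ncard_image]

theorem ncard_regularNoncrossing (hk : 2 ≤ k) (hN : 1 ≤ N) :
    (regularNoncrossing k 2 N).ncard = moveCount (N - 1) (0 : Rows k) := by
  rw [ncard_eq_of_bijOn (partitionToBraid_bijOn k N hN),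
    ← ncard_eq_of_bijOn (walkToBraid_bijOn hk (N - 1)), ncard_loopFreeWalks_zero]

theorem ncard_walks_of_partition (hk : 2 ≤ k) (hN : 1 ≤ N) {P : Finpartition (Finset.Icc 1 N)}
    (hP : P ∈ regularNoncrossing k 2 N) :
    {X ∈ loopFreeWalks k (N - 1) 0 0 | walkToBraid (N - 1) X = partitionToBraid P}.ncard = 1 := by
  have hb := walkToBraid_bijOn hk (N - 1)
  obtain ⟨X, hX, e⟩ := hb.surjOn ((partitionToBraid_bijOn k N hN).mapsTo hP)
  rw [Set.ncard_eq_one]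
  refine ⟨X, Set.ext fun Y => ⟨fun hY => hb.injOn hY.1 hX (hY.2.trans e.symm), ?_⟩⟩
  rintro rfl
  exact ⟨hX, e⟩

end

/-! ## Bounds for the resources -/

theorem pow_lt_two_pow {N k C : ℕ} (hN : 1 ≤ N) (hC : k < C) : N ^ k < 2 ^ (C * N) := by
  calc N ^ k ≤ (2 ^ N) ^ k := Nat.pow_le_pow_left Nat.lt_two_pow_self.le k
    _ = 2 ^ (k * N) := by rw [← pow_mul, mul_comm]
    _ < 2 ^ (C * N) := Nat.pow_lt_pow_right (by omega) (Nat.mul_lt_mul_of_pos_right hC hN)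

theorem moveCount_lt_two_pow {k N C m : ℕ} (hN : 1 ≤ N) (hm : m < N)
    (hC : (moveCodes k).length < C) (nu : Rows k) : moveCount m nu < 2 ^ (C * N) := by
  calc moveCount m nu ≤ (moveCodes k).length ^ m := codeCount_le _ _ _
    _ ≤ (2 ^ (moveCodes k).length) ^ m := Nat.pow_le_pow_left Nat.lt_two_pow_self.le m
    _ = 2 ^ ((moveCodes k).length * m) := by rw [← pow_mul]
    _ ≤ 2 ^ ((moveCodes k).length * N) :=
      Nat.pow_le_pow_right (by omega) (Nat.mul_le_mul_left _ hm.le)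
    _ < 2 ^ (C * N) := Nat.pow_lt_pow_right (by omega) (Nat.mul_lt_mul_of_pos_right hC hN)

/-- A constant for the time, the space and the word length of both programs. -/
def machineConst (k : ℕ) : ℕ :=
  2 * k + (moveCodes k).length + (tableStart k).cost + (entryProg k).cost + (totalProg k).cost +
    (walkStart k).cost + (vertexProg k).cost + 10

end

/-! ### Assembly: counts, bijections, and the algorithm with its resources and its law. -/

theorem theorem4p4 (k : ℕ) (hk : 2 ≤ k) :
    -- the transition counts are numbers of loop-free braid walks
    (∀ (m : ℕ) (lam : Rows k),
      walkCount k m lam = ((loopFreeWalks k m 0 lam).ncard : ℤ) ∧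
      walkCount k m lam = ((loopFreeWalks k m lam 0).ncard : ℤ)) ∧
    -- the bijections between 2-regular partitions, loop-free braids and loop-free braid walks
    (∀ N : ℕ, 1 ≤ N →
      Set.BijOn partitionToBraid (regularNoncrossing k 2 N) (loopFreeBraids k (N - 1)) ∧
      Set.BijOn (walkToBraid (N - 1)) (loopFreeWalks k (N - 1) 0 0)
        (loopFreeBraids k (N - 1))) ∧
    -- the algorithm
    ∃ (pre sampler : Program) (C : ℕ), ∀ N : ℕ, 1 ≤ N →
      ∃ table : Memory,
        -- preprocessing: time `O(N ^ (k + 1))`, space `O(N ^ k)`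
        execute (C * N ^ (k + 1)) (C * N ^ k) (C * N) (fun _ _ => 0) pre N
          = PMF.pure (some table) ∧
        -- it yields the transition counts
        (∀ m < N, ∀ lam : Rows k, (∀ r, lam r < N) →
          (table.arr 0 (m * N ^ (k - 1) + ∑ r, lam r * N ^ (r : ℕ)) : ℤ) = walkCount k m lam) ∧
        -- sampling: time `O(N)`, space `O(N)`
        ∃ law : PMF (Option Memory),
          law = execute (C * N) (C * N) (C * N) table.arr sampler N ∧
          -- the partition is uniformly distributed
          (∀ P ∈ regularNoncrossing k 2 N,
            prob law (fun M => OutputsPartition M P)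
              = 1 / ((regularNoncrossing k 2 N).ncard : ℝ)) ∧
          -- it is the partition of the loop-free braid walk that the sampler has generated
          (∀ r ∈ law.support, ∃ M, r = some M ∧
            outputWalk k (2 * (N - 1)) M ∈ loopFreeWalks k (N - 1) 0 0 ∧
            ∃ P ∈ regularNoncrossing k 2 N, OutputsPartition M P ∧
              partitionToBraid P = walkToBraid (N - 1) (outputWalk k (2 * (N - 1)) M)) ∧
          -- the walk is a Markov process with the transition probabilities given by the counts
          (∀ s < N - 1, ∀ x : ℕ → Rows k,
            prob law (fun M => ∀ i ≤ 2 * s + 1, outputWalk k (2 * (N - 1)) M i = x i)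
              = prob law (fun M => ∀ i ≤ 2 * s, outputWalk k (2 * (N - 1)) M i = x i) *
                (halfWalkCount k (N - 1 - s - 1) (x (2 * s)) (x (2 * s + 1)) /
                  walkCount k (N - 1 - s) (x (2 * s))) ∧
            (LoopFreeMove (x (2 * s)) (x (2 * s + 1)) (x (2 * s + 2)) →
              prob law (fun M => ∀ i ≤ 2 * s + 2, outputWalk k (2 * (N - 1)) M i = x i)
                = prob law (fun M => ∀ i ≤ 2 * s + 1, outputWalk k (2 * (N - 1)) M i = x i) *
                  (walkCount k (N - 1 - s - 1) (x (2 * s + 2)) /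
                    halfWalkCount k (N - 1 - s - 1) (x (2 * s)) (x (2 * s + 1))))) := by

  refine ⟨fun m lam => ?_, fun N hN => ⟨partitionToBraid_bijOn k N hN,
    walkToBraid_bijOn hk (N - 1)⟩, tableProg k, samplerProg k, machineConst k, fun N hN => ?_⟩
  · rw [walkCount_eq hk, ncard_loopFreeWalks_comm k m 0 lam, ncard_loopFreeWalks_zero]
    exact ⟨rfl, rfl⟩
  set C := machineConst k with hC
  have hNk : N ^ k < 2 ^ (C * N) := pow_lt_two_pow hN (by rw [hC, machineConst]; omega)
  have hcount : ∀ m < N, ∀ nu : Rows k, moveCount m nu < 2 ^ (C * N) := fun m hm =>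
    moveCount_lt_two_pow hN hm (by rw [hC, machineConst]; omega)
  have hkC : 2 * k * N ≤ C * N := Nat.mul_le_mul_right _ (by rw [hC, machineConst]; omega)
  have hkw : 2 * k * N < 2 ^ (C * N) := hkC.trans_lt Nat.lt_two_pow_self
  have hw2 : 2 ^ (N + 1) ≤ 2 ^ (C * N) := by
    refine Nat.pow_le_pow_right (by omega) ?_
    calc N + 1 ≤ 2 * N := by omega
      _ ≤ C * N := Nat.mul_le_mul_right _ (by rw [hC, machineConst]; omega)
  -- Each of the at most `N ^ k` entries takes a bounded number of steps at unit cost, so the bound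
  -- holds with a factor `N` to spare.
  have hpre : (tableStart k).cost + 2 + N ^ k * ((entryProg k).cost + 1) ≤ C * N ^ (k + 1) := by
    have h1 : N ^ k ≤ N ^ (k + 1) := Nat.pow_le_pow_right hN (by omega)
    have h0 : 1 ≤ N ^ (k + 1) := Nat.one_le_pow _ _ hN
    calc _ ≤ ((tableStart k).cost + 2) * N ^ (k + 1) +
          ((entryProg k).cost + 1) * N ^ (k + 1) := by
          rw [mul_comm (N ^ k)]
          exact Nat.add_le_add (Nat.le_mul_of_pos_right _ h0) (Nat.mul_le_mul_left _ h1)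
      _ = ((tableStart k).cost + 2 + ((entryProg k).cost + 1)) * N ^ (k + 1) := by ring
      _ ≤ C * N ^ (k + 1) := Nat.mul_le_mul_right _ (by rw [hC, machineConst]; omega)
  obtain ⟨table, htable, hexec⟩ := ((reaches_tableProg (tab := fun _ _ => 0) (S := C * N ^ k) hk hN
    hNk (Nat.le_mul_of_pos_left _ (by rw [hC, machineConst]; omega)) hcount).mono
    (t' := C * N ^ (k + 1)) hpre fun _ h => h).execute
  refine ⟨table, hexec, fun m hm lam hlam => ?_, ?_⟩
  · rw [walkCount_eq hk]
    exact congrArg Nat.cast (htable m hm lam hlam)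
  have htab : ∀ m < N, ∀ nu : Rows k, (∀ r, nu r < N) →
      table.arr 0 (address N m nu) = moveCount m nu := htable
  -- The walk that never moves is loop-free, so the draw is from a nonempty set.
  obtain ⟨W, hW⟩ : ∃ W, moveCount (N - 1) (0 : Rows k) = W + 1 :=
    ⟨moveCount (N - 1) (0 : Rows k) - 1, by have := moveCount_pos (k := k) (N - 1); omega⟩
  have htime : (totalProg k).cost + (walkStart k).cost + 5 + N * ((vertexProg k).cost + 1) ≤
      C * N := by
    calc _ ≤ ((totalProg k).cost + (walkStart k).cost + 5) * N +
          ((vertexProg k).cost + 1) * N := by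
          rw [mul_comm N]
          exact Nat.add_le_add_right (Nat.le_mul_of_pos_right _ hN) _
      _ = ((totalProg k).cost + (walkStart k).cost + 5 + ((vertexProg k).cost + 1)) * N := by
          ring
      _ ≤ C * N := Nat.mul_le_mul_right _ (by rw [hC, machineConst]; omega)
  obtain ⟨R, hR1, hR2, hlaw⟩ := execute_samplerProg hk hN htab hcount hw2 hNk hkw hkC htime hW
  set D : ℕ → ℕ → Rows k := decode (moveCodes k) mid (N - 1) (0 : Rows k) with hD
  have hDmem : ∀ a : Fin (W + 1), D a ∈ loopFreeWalks k (N - 1) 0 0 := fun a =>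
    (decode_bijOn_loopFreeWalks k (N - 1) 0).mapsTo (by rw [Set.mem_Iio, hW]; exact a.2)
  have hout : ∀ a : Fin (W + 1), Outputs N (D a) (R a) := by
    refine fun a => ⟨?_, hR2 a⟩
    funext i r
    rw [outputWalk, hR1 a _ (min_le_right _ _)]
    rcases le_total i (2 * (N - 1)) with h | h
    · rw [min_eq_left h]
    · rw [min_eq_right h, (hDmem a).2.2.2.1 i h]
  -- The probability of a beginning is the number of walks with this beginning over the number of
  -- all walks, so a transition probability is a quotient of two such numbers.
  have hprefix : ∀ (x : ℕ → Rows k) (i : ℕ),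
      prob (execute (C * N) (C * N) (C * N) table.arr (samplerProg k) N)
        (fun M => ∀ l ≤ i, outputWalk k (2 * (N - 1)) M l = x l) =
      ((walksAlong k (N - 1) x i).ncard : ℝ) / moveCount (N - 1) (0 : Rows k) := by
    intro x i
    rw [hlaw]
    refine prob_eq_ncard hW (F := fun X => ∀ l ≤ i, X l = x l) fun a => ?_
    rw [(hout a).walk]
  have hpos : (0 : ℝ) < moveCount (N - 1) (0 : Rows k) := by
    exact_mod_cast moveCount_pos (k := k) (N - 1)
  have hfin : ∀ x i, (walksAlong k (N - 1) x i).Finite := fun x i =>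
    (finite_loopFreeWalks (N - 1) 0).subset fun _ h => h.1
  refine ⟨_, rfl, fun P hP => ?_, fun r hr => ?_, fun s hs x => ⟨?_, fun hm => ?_⟩⟩
  · rw [hlaw, prob_eq_ncard hW
      (F := fun X => walkToBraid (N - 1) X = partitionToBraid P) fun a =>
        (hout a).outputsPartition_iff hN (hDmem a) P, ncard_walks_of_partition hk hN hP,
      ncard_regularNoncrossing hk hN, Nat.cast_one]
  · rw [hlaw, PMF.support_map] at hr
    obtain ⟨a, -, rfl⟩ := hr
    obtain ⟨P, hP, e⟩ := (partitionToBraid_bijOn k N hN).surjOn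
      ((walkToBraid_bijOn hk (N - 1)).mapsTo (hDmem a))
    refine ⟨R a, rfl, ?_, P, hP, ?_, ?_⟩
    · rw [(hout a).walk]
      exact hDmem a
    · exact ((hout a).outputsPartition_iff hN (hDmem a) P).mpr e.symm
    · rw [(hout a).walk, e]
  · rw [hprefix, hprefix, walkCount_eq hk]
    -- An impossible beginning makes both sides 0, whatever the quotient is. Otherwise the
    -- denominator of the quotient is the number of walks with this beginning, and it cancels.
    rcases Set.eq_empty_or_nonempty (walksAlong k (N - 1) x (2 * s)) with h | h
    · have h' := Set.subset_eq_empty (walksAlong_anti x (Nat.le_succ (2 * s))) h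
      rw [h', h]
      simp
    · rw [← ncard_walksAlong_odd hk hs h, ← ncard_walksAlong_even hs.le h]
      have := (Set.ncard_pos (hfin x (2 * s))).mpr h
      push_cast
      field_simp
  · rw [hprefix, hprefix, walkCount_eq hk]
    rcases Set.eq_empty_or_nonempty (walksAlong k (N - 1) x (2 * s + 1)) with h | h
    · have h' := Set.subset_eq_empty (walksAlong_anti x (Nat.le_succ (2 * s + 1))) h
      rw [h', h]
      simp
    · rw [← ncard_walksAlong_odd hk hs (h.mono (walksAlong_anti x (Nat.le_succ _))),
        ← ncard_walksAlong_next hs h hm]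
      have := (Set.ncard_pos (hfin x (2 * s + 1))).mpr h
      push_cast
      field_simp
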